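/- Consider real-valued solutions of the first Painlevé equation $y''=6y^2-x$. Each solution is considered on its interval of existence, i.e. the largest open interval of $\mathbb R$ to which it extends as a solution; two solutions are the same if they have the same interval of existence and coincide on it. For $x_0\le 0$ let $$X(x_0)=\inf_{y_0,y_1\in\mathbb R} a(x_0,y_0,y_1)\in[-\infty,\infty],$$ where $a(x_0,y_0,y_1)\in[-\infty,x_0)$ is the left end point of the interval of existence of the solution with $y(x_0)=y_0$, $y'(x_0)=y_1$. **Theorem.** Let $x_0\le 0$. Then $-\infty<X(x_0)<x_0$, and for every real $x_1<x_0$: 1. if $x_1<X(x_0)$, there is no solution with interval of existence $(x_1,x_0)$; 2. if $x_1=X(x_0)$, there is exactly one solution with interval of existence $(x_1,x_0)$; 3. if $X(x_0)<x_1<x_0$, there are exactly two solutions with interval of existence $(x_1,x_0)$. Moreover, a function $y$ is a solution with interval of existence $(x_1,x_0)$ if and only if it satisfies $y''=6y^2-x$ on $(x_1,x_0)$ and has infinite boundary values: $y(x)\to+\infty$ as $x\downarrow x_1$ and as $x\uparrow x_0$. Thus 1–3 count the solutions of the boundary value problem with infinite boundary data. -/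

import Mathlib

open Set Filter Topology

namespace PainleveOne

/-- On the open set `J`, the function `y` is twice differentiable and satisfies
the first Painlevé equation `y'' = 6 y ^ 2 - x`. Values of `y` off `J` do not matter. -/
def IsSolutionOn (y : ℝ → ℝ) (J : Set ℝ) : Prop :=
  ∀ x ∈ J, DifferentiableAt ℝ y x ∧ HasDerivAt (deriv y) (6 * y x ^ 2 - x) x

/-- `J` is the interval of existence of the real solution `y`: a nonempty open interval on
which `y` solves the equation, such that `y|J` has no extension to a solution on a
strictly larger open interval. -/
structure HasIntervalOfExistence (y : ℝ → ℝ) (J : Set ℝ) : Prop where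
  isOpen : IsOpen J
  isConnected : IsConnected J
  isSolutionOn : IsSolutionOn y J
  maximal : ∀ (z : ℝ → ℝ) (K : Set ℝ), IsOpen K → IsConnected K → J ⊆ K →
    IsSolutionOn z K → EqOn z y J → K = J

/-- The left end point of an interval, possibly `-∞`. -/
noncomputable def leftEnd (J : Set ℝ) : EReal :=
  sInf ((fun x : ℝ => (x : EReal)) '' J)

/-- `X(x₀)` is the infimum, over all initial data `y(x₀) = y₀`, `y'(x₀) = y₁`, of the left end
point `a(x₀, y₀, y₁)` of the interval of existence of the solution with these data.
A priori it is an extended real number. -/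
noncomputable def X (x₀ : ℝ) : EReal :=
  sInf {a : EReal | ∃ (y₀ y₁ : ℝ) (y : ℝ → ℝ) (J : Set ℝ),
    HasIntervalOfExistence y J ∧ x₀ ∈ J ∧ y x₀ = y₀ ∧ deriv y x₀ = y₁ ∧ a = leftEnd J}

/-- The set of solutions with interval of existence `(x₁, x₀)`, each regarded as a function
on that interval. -/
def solutionsWithInterval (x₁ x₀ : ℝ) : Set (Ioo x₁ x₀ → ℝ) :=
  (Ioo x₁ x₀).domRestrict '' {y : ℝ → ℝ | HasIntervalOfExistence y (Ioo x₁ x₀)}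

end PainleveOne

/-! Put `t = -x` and `U(t) = y(-t)`. The equation becomes `U'' = 6U² + t`, and a solution with
interval `(x₁, x₀)` becomes one on `(t₀, T)`, with `t₀ = -x₀ ≥ 0` and `T = -x₁`, that is infinite at
both ends. On this interval `t = |t|`. With the forcing `|t|`, even and nonnegative on the whole
line, every solution is convex and blows up to `+∞` at finite times on both sides (`exists_blowUp`).
It is therefore described by the place `τ` and the value `m` of its minimum, and both blow-up times
are continuous in `(τ, m)`.

Fix `t₀`. At `t₀` all solutions behave like `(t - t₀)⁻²` up to `o(1)` (`BlowUp.tendsto_sub_left`),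
so differences vanish there. Energy comparison shows that the order near `t₀` is the order of the
minimum values (`BlowUp.min_lt_min`). Hence exactly one solution starts from `t₀` for each `m`
(`exists_minPoint`), and its right blow-up time `f(m)` is continuous, exceeds `t₀` and tends to `t₀`
as `|m| → ∞`.

The core is that `f` has no local minimum (`BlowUp.exists_not_le_right`). Suppose `U` blew up no
later than a slightly lower `Um` and a higher `Up`. The Wronskian of `U - Um` and `Up - U` starts
from `0` and increases, yet at the first zero of `Up - U`, or at the common blow-up time, it would
have to be `≤ 0`. This needs `Um < U` throughout: a crossing could only occur on the increasing
branch of `U` (`BlowUp.exists_crossing_deriv_nonneg`), and then `Um` would blow up first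
(`BlowUp.right_lt_of_crossing`). So `f` takes its maximum once and every value strictly between `t₀`
and the maximum exactly twice (`encard_levels`).

Finally `X(x₀) = -max f` (`X_eq`). A solution regular at `t₀` cannot outlive all the singular ones,
by connectedness of the set of `m`. Conversely, moving the minimum of a singular solution slightly
to the left makes it regular at `t₀` at an arbitrarily small cost in lifetime. -/

namespace PainleveOne

/-! ### Local existence, uniqueness and continuous dependence, by truncating the vector field. -/

section

/-- The pair `(U, V)` solves `U' = V`, `V' = 6 U ^ 2 + g` at every point of `s`. -/
def Sol (g U V : ℝ → ℝ) (s : Set ℝ) : Prop :=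
  ∀ t ∈ s, HasDerivAt U (V t) t ∧ HasDerivAt V (6 * U t ^ 2 + g t) t

variable {g U V U₁ V₁ U₂ V₂ : ℝ → ℝ} {s s' : Set ℝ}

lemma Sol.mono (h : Sol g U V s) (hs : s' ⊆ s) : Sol g U V s' := fun t ht => h t (hs ht)

lemma Sol.continuousOn (h : Sol g U V s) : ContinuousOn U s :=
  fun t ht => (h t ht).1.continuousAt.continuousWithinAt

lemma Sol.continuousOn' (h : Sol g U V s) : ContinuousOn V s :=
  fun t ht => (h t ht).2.continuousAt.continuousWithinAt

/-- Truncation of a real number to `[-N, N]`. -/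
def clamp (N x : ℝ) : ℝ := max (-N) (min x N)

lemma clamp_eq {N x : ℝ} (h : |x| ≤ N) : clamp N x = x := by
  rw [abs_le] at h
  simp [clamp, h.1, h.2]

lemma abs_clamp_le {N : ℝ} (hN : 0 ≤ N) (x : ℝ) : |clamp N x| ≤ N := by
  rw [abs_le]
  exact ⟨le_max_left _ _, max_le (by linarith) (min_le_right _ _)⟩

lemma abs_clamp_sub_le (N x y : ℝ) : |clamp N x - clamp N y| ≤ |x - y| := by
  unfold clamp
  calc _ ≤ max |(-N) - (-N)| |min x N - min y N| := abs_max_sub_max_le_max _ _ _ _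
    _ ≤ max 0 (max |x - y| |N - N|) := by
        simpa using abs_min_sub_min_le_max x N y N
    _ = _ := by simp

/-- The vector field of the equation with both unknowns truncated. -/
def field (g : ℝ → ℝ) (N t : ℝ) (p : ℝ × ℝ) : ℝ × ℝ :=
  (clamp N p.2, 6 * clamp N p.1 ^ 2 + g t)

lemma lipschitzWith_field {N : ℝ} (hN : 0 ≤ N) (t : ℝ) :
    LipschitzWith (Real.toNNReal (12 * N + 1)) (field g N t) := by
  apply LipschitzWith.of_dist_le_mul
  intro p q
  rw [Real.coe_toNNReal _ (by positivity), Prod.dist_eq, Prod.dist_eq]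
  simp only [field, Real.dist_eq]
  have h1 := abs_clamp_sub_le N p.1 q.1
  have h2 := abs_clamp_sub_le N p.2 q.2
  have h3 := abs_clamp_le hN p.1
  have h4 := abs_clamp_le hN q.1
  have h5 : |p.1 - q.1| ≤ max |p.1 - q.1| |p.2 - q.2| := le_max_left _ _
  have h6 : |p.2 - q.2| ≤ max |p.1 - q.1| |p.2 - q.2| := le_max_right _ _
  set M := max |p.1 - q.1| |p.2 - q.2|
  have hM : 0 ≤ M := (abs_nonneg _).trans h5
  apply max_le
  · nlinarith
  · have e : 6 * clamp N p.1 ^ 2 + g t - (6 * clamp N q.1 ^ 2 + g t)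
      = 6 * ((clamp N p.1 + clamp N q.1) * (clamp N p.1 - clamp N q.1)) := by ring
    have h7 : |clamp N p.1 + clamp N q.1| ≤ 2 * N := (abs_add_le _ _).trans (by linarith)
    have h8 : |clamp N p.1 + clamp N q.1| * |clamp N p.1 - clamp N q.1| ≤ 2 * N * M :=
      mul_le_mul h7 (h1.trans h5) (abs_nonneg _) (by positivity)
    rw [e, abs_mul, abs_mul, abs_of_pos (by norm_num : (0:ℝ) < 6)]
    nlinarith

lemma norm_field_le {N G t : ℝ} (hN : 0 ≤ N) (hG : |g t| ≤ G) (p : ℝ × ℝ) :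
    ‖field g N t p‖ ≤ N + 6 * N ^ 2 + G := by
  have h3 := abs_clamp_le hN p.1
  have h4 := abs_clamp_le hN p.2
  have hG0 : 0 ≤ G := (abs_nonneg _).trans hG
  rw [Prod.norm_def]
  simp only [field, Real.norm_eq_abs]
  apply max_le
  · nlinarith
  · refine (abs_add_le _ _).trans ?_
    have h5 : |clamp N p.1| ^ 2 ≤ N ^ 2 := pow_le_pow_left₀ (abs_nonneg _) h3 2
    rw [abs_mul, abs_pow, abs_of_pos (by norm_num : (0:ℝ) < 6)]
    linarith

lemma exists_abs_le_on_Icc (hg : Continuous g) (a b : ℝ) :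
    ∃ G, 0 ≤ G ∧ ∀ t ∈ Icc a b, |g t| ≤ G := by
  obtain ⟨G, hG⟩ := isCompact_Icc.exists_bound_of_continuousOn (s := Icc a b) hg.continuousOn
  exact ⟨max G 0, le_max_right _ _, fun t ht => (hG t ht).trans (le_max_left _ _)⟩

lemma exists_truncated_solution (hg : Continuous g) {N R : ℝ} (hN : 0 ≤ N) (hR : 0 < R)
    (τ : ℝ) (p : ℝ × ℝ) : ∃ γ : ℝ → ℝ × ℝ, γ τ = p ∧
      ∀ t ∈ Ioo (τ - R) (τ + R), HasDerivAt γ (field g N t (γ t)) t := by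
  obtain ⟨G, hG0, hG⟩ := exists_abs_le_on_Icc hg (τ - R) (τ + R)
  set L : NNReal := Real.toNNReal (N + 6 * N ^ 2 + G)
  have hL : (L : ℝ) = N + 6 * N ^ 2 + G := Real.coe_toNNReal _ (by positivity)
  have hp : IsPicardLindelof (field g N) (tmin := τ - R) (tmax := τ + R)
      ⟨τ, by linarith, by linarith⟩ p (L * Real.toNNReal R) 0 L
      (Real.toNNReal (12 * N + 1)) := by
    refine ⟨fun t _ => (lipschitzWith_field hN t).lipschitzOnWith, fun x _ => ?_,
      fun t ht x _ => ?_, ?_⟩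
    · unfold field
      fun_prop
    · rw [hL]
      exact norm_field_le hN (hG t ht) x
    · simp [Real.coe_toNNReal _ hR.le]
  obtain ⟨γ, h0, h1⟩ := hp.exists_eq_forall_mem_Icc_hasDerivWithinAt₀
  exact ⟨γ, h0, fun t ht => (h1 t (Ioo_subset_Icc_self ht)).hasDerivAt (Icc_mem_nhds ht.1 ht.2)⟩

lemma dist_le_exp_of_forward {v : ℝ → ℝ × ℝ → ℝ × ℝ} {K : NNReal}
    (hv : ∀ t, LipschitzWith K (v t)) {f h : ℝ → ℝ × ℝ} {a b : ℝ}
    (hf : ∀ t ∈ Icc a b, HasDerivAt f (v t (f t)) t)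
    (hh : ∀ t ∈ Icc a b, HasDerivAt h (v t (h t)) t) {t : ℝ} (ht : t ∈ Icc a b) :
    dist (f t) (h t) ≤ dist (f a) (h a) * Real.exp (K * (t - a)) :=
  dist_le_of_trajectories_ODE hv (fun t ht => (hf t ht).continuousAt.continuousWithinAt)
    (fun t ht => (hf t (Ico_subset_Icc_self ht)).hasDerivWithinAt)
    (fun t ht => (hh t ht).continuousAt.continuousWithinAt)
    (fun t ht => (hh t (Ico_subset_Icc_self ht)).hasDerivWithinAt) le_rfl t ht

lemma dist_le_exp_of_hasDerivAt {v : ℝ → ℝ × ℝ → ℝ × ℝ} {K : NNReal}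
    (hv : ∀ t, LipschitzWith K (v t)) {f h : ℝ → ℝ × ℝ} {a b : ℝ}
    (hf : ∀ t ∈ Icc a b, HasDerivAt f (v t (f t)) t)
    (hh : ∀ t ∈ Icc a b, HasDerivAt h (v t (h t)) t) {τ t : ℝ} (hτ : τ ∈ Icc a b)
    (ht : t ∈ Icc a b) :
    dist (f t) (h t) ≤ dist (f τ) (h τ) * Real.exp (K * |t - τ|) := by
  rcases le_total τ t with hle | hle
  · rw [abs_of_nonneg (by linarith)]
    exact dist_le_exp_of_forward hv (fun t ht => hf t ⟨hτ.1.trans ht.1, ht.2⟩)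
      (fun t ht => hh t ⟨hτ.1.trans ht.1, ht.2⟩) ⟨hle, ht.2⟩
  · rw [abs_of_nonpos (by linarith)]
    have key : ∀ f : ℝ → ℝ × ℝ, (∀ t ∈ Icc a b, HasDerivAt f (v t (f t)) t) →
        ∀ t ∈ Icc (-τ) (-a), HasDerivAt (fun t => f (-t)) (-(v (-t) (f (-t)))) t := by
      intro f hf t ht
      have := (hf (-t) ⟨by linarith [ht.2], by linarith [ht.1, hτ.2]⟩).scomp t (hasDerivAt_neg t)
      simpa [Function.comp_def] using this
    have := dist_le_exp_of_forward (v := fun t p => -(v (-t) p)) (K := K)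
      (fun t => (hv (-t)).neg)
      (key f hf) (key h hh) (t := -t) ⟨by linarith, by linarith [ht.1]⟩
    simp only [neg_neg] at this
    convert this using 3
    ring_nf

lemma Sol.hasDerivAt_prod {N t : ℝ} (h : Sol g U V s) (ht : t ∈ s) (hU : |U t| ≤ N)
    (hV : |V t| ≤ N) :
    HasDerivAt (fun t => (U t, V t)) (field g N t (U t, V t)) t := by
  have := (h t ht).1.prodMk (h t ht).2
  simpa [field, clamp_eq hU, clamp_eq hV] using this

lemma sol_of_hasDerivAt_field {N : ℝ} {γ : ℝ → ℝ × ℝ}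
    (h : ∀ t ∈ s, HasDerivAt γ (field g N t (γ t)) t)
    (h1 : ∀ t ∈ s, |(γ t).1| ≤ N) (h2 : ∀ t ∈ s, |(γ t).2| ≤ N) :
    Sol g (fun t => (γ t).1) (fun t => (γ t).2) s := by
  intro t ht
  have hγ := h t ht
  have e : field g N t (γ t) = ((γ t).2, 6 * (γ t).1 ^ 2 + g t) := by
    simp [field, clamp_eq (h1 t ht), clamp_eq (h2 t ht)]
  rw [e] at hγ
  exact ⟨by simpa using! hasFDerivAt_fst.comp_hasDerivAt t hγ,
    by simpa using! hasFDerivAt_snd.comp_hasDerivAt t hγ⟩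

lemma Sol.exists_bound {a b : ℝ} (h : Sol g U V (Icc a b)) :
    ∃ N, 0 ≤ N ∧ ∀ t ∈ Icc a b, |U t| ≤ N ∧ |V t| ≤ N := by
  obtain ⟨A, hA⟩ := isCompact_Icc.exists_bound_of_continuousOn h.continuousOn
  obtain ⟨B, hB⟩ := isCompact_Icc.exists_bound_of_continuousOn h.continuousOn'
  refine ⟨max 0 (max A B), le_max_left _ _, fun t ht => ⟨(hA t ht).trans ?_, (hB t ht).trans ?_⟩⟩
  · exact (le_max_left _ _).trans (le_max_right _ _)
  · exact (le_max_right _ _).trans (le_max_right _ _)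

theorem Sol.eqOn_Icc {a b τ : ℝ} (h₁ : Sol g U₁ V₁ (Icc a b)) (h₂ : Sol g U₂ V₂ (Icc a b))
    (hτ : τ ∈ Icc a b) (hU : U₁ τ = U₂ τ) (hV : V₁ τ = V₂ τ) {t : ℝ} (ht : t ∈ Icc a b) :
    U₁ t = U₂ t ∧ V₁ t = V₂ t := by
  obtain ⟨A, hA, hA'⟩ := h₁.exists_bound
  obtain ⟨B, hB, hB'⟩ := h₂.exists_bound
  have := dist_le_exp_of_hasDerivAt (lipschitzWith_field (g := g) (N := max A B)
    (hA.trans (le_max_left _ _)))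
    (fun t ht => h₁.hasDerivAt_prod ht ((hA' t ht).1.trans (le_max_left _ _))
      ((hA' t ht).2.trans (le_max_left _ _)))
    (fun t ht => h₂.hasDerivAt_prod ht ((hB' t ht).1.trans (le_max_right _ _))
      ((hB' t ht).2.trans (le_max_right _ _))) hτ ht
  rw [hU, hV, dist_self, zero_mul] at this
  simpa using dist_le_zero.1 this

theorem Sol.eqOn [hs : s.OrdConnected] {τ : ℝ} (h₁ : Sol g U₁ V₁ s) (h₂ : Sol g U₂ V₂ s)
    (hτ : τ ∈ s) (hU : U₁ τ = U₂ τ) (hV : V₁ τ = V₂ τ) {t : ℝ} (ht : t ∈ s) :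
    U₁ t = U₂ t ∧ V₁ t = V₂ t := by
  have hsub : uIcc τ t ⊆ s := hs.uIcc_subset hτ ht
  exact Sol.eqOn_Icc (h₁.mono hsub) (h₂.mono hsub) left_mem_uIcc hU hV right_mem_uIcc

/-- The field truncated one unit above a bound for `(U, V)` is globally Lipschitz, so its solutions
exist on any interval. Grönwall keeps the perturbed one within distance `1` of `(U, V)`, where the
truncation is inactive. By continuity this persists slightly beyond `[α, β]`. -/
theorem Sol.exists_nearby (hg : Continuous g) {α β τ₀ ε : ℝ} (h : Sol g U V (Icc α β))
    (hτ₀ : τ₀ ∈ Icc α β) (hε : 0 < ε) :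
    ∃ δ > 0, ∀ τ ∈ Icc α β, ∀ a b, |τ - τ₀| < δ → |a - U τ₀| < δ → |b - V τ₀| < δ →
      ∃ U' V' : ℝ → ℝ, ∃ η > 0, Sol g U' V' (Ioo (α - η) (β + η)) ∧ U' τ = a ∧ V' τ = b ∧
        ∀ t ∈ Icc α β, |U' t - U t| < ε ∧ |V' t - V t| < ε := by
  obtain ⟨B, hB, hB'⟩ := h.exists_bound
  set N := B + 1
  have hN : 0 ≤ N := by positivity
  have hαβ : α ≤ β := hτ₀.1.trans hτ₀.2
  set K := Real.toNNReal (12 * N + 1)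
  set C := Real.exp (K * (β - α))
  have hC : 0 < C := Real.exp_pos _
  set ε' := min ε 1 / (2 * C)
  have hε' : 0 < ε' := by positivity
  have cU := (h τ₀ hτ₀).1.continuousAt
  have cV := (h τ₀ hτ₀).2.continuousAt
  rw [Metric.continuousAt_iff] at cU cV
  obtain ⟨δ₁, hδ₁, H₁⟩ := cU (ε' / 2) (by positivity)
  obtain ⟨δ₂, hδ₂, H₂⟩ := cV (ε' / 2) (by positivity)
  refine ⟨min (min δ₁ δ₂) (ε' / 2), by positivity, fun τ hτ a b hτ1 ha hb => ?_⟩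
  obtain ⟨γ, hγ0, hγ⟩ := exists_truncated_solution hg hN (R := β - α + 1) (by linarith) τ (a, b)
  have hsub : ∀ t ∈ Icc α β, t ∈ Ioo (τ - (β - α + 1)) (τ + (β - α + 1)) := fun t ht =>
    ⟨by linarith [hτ.2, ht.1], by linarith [hτ.1, ht.2]⟩
  have hτ1' := lt_min_iff.1 (lt_min_iff.1 hτ1).1
  have hd0 : dist (γ τ) (U τ, V τ) < ε' := by
    have e1 := H₁ (x := τ) (by rw [Real.dist_eq]; exact hτ1'.1)
    have e2 := H₂ (x := τ) (by rw [Real.dist_eq]; exact hτ1'.2)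
    rw [Real.dist_eq] at e1 e2
    have e3 := (lt_min_iff.1 ha).2
    have e4 := (lt_min_iff.1 hb).2
    rw [hγ0, Prod.dist_eq, Real.dist_eq, Real.dist_eq]
    rw [abs_lt] at e1 e2 e3 e4
    apply max_lt <;> rw [abs_lt] <;> constructor <;> simp only <;> linarith
  have hd : ∀ t ∈ Icc α β, dist (γ t) (U t, V t) < min ε 1 := by
    intro t ht
    have := dist_le_exp_of_hasDerivAt (lipschitzWith_field (g := g) hN)
      (fun t ht => hγ t (hsub t ht))
      (fun t ht => h.hasDerivAt_prod ht ((hB' t ht).1.trans (by linarith))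
        ((hB' t ht).2.trans (by linarith))) hτ ht
    have hexp : Real.exp (K * |t - τ|) ≤ C := by
      apply Real.exp_le_exp.2
      apply mul_le_mul_of_nonneg_left _ (NNReal.coe_nonneg _)
      rw [abs_le]
      constructor <;> linarith [ht.1, ht.2, hτ.1, hτ.2]
    calc _ ≤ _ := this
      _ ≤ ε' * C := mul_le_mul hd0.le hexp (Real.exp_pos _).le hε'.le
      _ = min ε 1 / 2 := by simp only [ε']; field_simp
      _ < _ := by linarith [show 0 < min ε 1 by positivity]
  have hd1 : ∀ t ∈ Icc α β, |(γ t).1 - U t| < min ε 1 ∧ |(γ t).2 - V t| < min ε 1 := by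
    intro t ht
    have := hd t ht
    rw [Prod.dist_eq, max_lt_iff, Real.dist_eq, Real.dist_eq] at this
    exact this
  set O : Set ℝ := {t | ∀ᶠ x in 𝓝 t, (|(γ x).1| ≤ N ∧ |(γ x).2| ≤ N) ∧
    x ∈ Ioo (τ - (β - α + 1)) (τ + (β - α + 1))}
  have hO : IsOpen O := isOpen_setOfPred_eventually_nhds
  have hO' : ∀ t ∈ Icc α β, t ∈ O := by
    intro t ht
    have hc := (hγ t (hsub t ht)).continuousAt
    have h1 : |(γ t).1| < N := by
      have e1 := lt_of_lt_of_le (hd1 t ht).1 (min_le_right _ _)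
      have e2 := (hB' t ht).1
      calc |(γ t).1| = |((γ t).1 - U t) + U t| := by ring_nf
        _ ≤ _ := abs_add_le _ _
        _ < N := by linarith
    have h2 : |(γ t).2| < N := by
      have e1 := lt_of_lt_of_le (hd1 t ht).2 (min_le_right _ _)
      have e2 := (hB' t ht).2
      calc |(γ t).2| = |((γ t).2 - V t) + V t| := by ring_nf
        _ ≤ _ := abs_add_le _ _
        _ < N := by linarith
    have c1 : ContinuousAt (fun x => |(γ x).1|) t := (hc.fst).abs
    have c2 : ContinuousAt (fun x => |(γ x).2|) t := (hc.snd).abs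
    filter_upwards [c1.eventually_lt_const h1, c2.eventually_lt_const h2,
      isOpen_Ioo.mem_nhds (hsub t ht)] with x hx1 hx2 hx3 using ⟨⟨hx1.le, hx2.le⟩, hx3⟩
  obtain ⟨η₁, hη₁, h₁⟩ := Metric.isOpen_iff.1 hO α (hO' α ⟨le_rfl, hαβ⟩)
  obtain ⟨η₂, hη₂, h₂⟩ := Metric.isOpen_iff.1 hO β (hO' β ⟨hαβ, le_rfl⟩)
  rw [Real.ball_eq_Ioo] at h₁ h₂
  have hsubO : ∀ t ∈ Ioo (α - min η₁ η₂) (β + min η₁ η₂),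
      (|(γ t).1| ≤ N ∧ |(γ t).2| ≤ N) ∧ t ∈ Ioo (τ - (β - α + 1)) (τ + (β - α + 1)) := by
    intro t ht
    suffices h : t ∈ O from Eventually.self_of_nhds (p := fun x => (|(γ x).1| ≤ N ∧ |(γ x).2| ≤ N) ∧
      x ∈ Ioo (τ - (β - α + 1)) (τ + (β - α + 1))) h
    rcases lt_or_ge t α with hl | hl
    · exact h₁ ⟨by linarith [ht.1, min_le_left η₁ η₂], by linarith⟩
    rcases le_or_gt t β with hr | hr
    · exact hO' t ⟨hl, hr⟩
    · exact h₂ ⟨by linarith, by linarith [ht.2, min_le_right η₁ η₂]⟩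
  refine ⟨fun t => (γ t).1, fun t => (γ t).2, min η₁ η₂, by positivity,
    sol_of_hasDerivAt_field (fun t ht => hγ t (hsubO t ht).2) (fun t ht => (hsubO t ht).1.1)
      (fun t ht => (hsubO t ht).1.2), by simp [hγ0], by simp [hγ0], fun t ht => ?_⟩
  exact ⟨(hd1 t ht).1.trans_le (min_le_left _ _), (hd1 t ht).2.trans_le (min_le_left _ _)⟩

/-- The existence time depends only on bounds for the data, as needed for continuation. The
truncated field has norm at most `L`, so in time `1 / L` the solution moves by at most `1` and does
not reach the truncation at `B + 1`. -/
theorem exists_uniform_local_solution (hg : Continuous g) (B R : ℝ) :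
    ∃ δ > 0, ∀ τ a b, |τ| ≤ R → |a| ≤ B → |b| ≤ B →
      ∃ U V, Sol g U V (Ioo (τ - δ) (τ + δ)) ∧ U τ = a ∧ V τ = b := by
  rcases lt_or_ge B 0 with hB | hB
  · exact ⟨1, one_pos, fun τ a b _ ha _ => absurd ((abs_nonneg a).trans ha) (by linarith)⟩
  obtain ⟨G, hG0, hG⟩ := exists_abs_le_on_Icc hg (-R - 1) (R + 1)
  set N := B + 1
  have hN : 0 ≤ N := by positivity
  set L := N + 6 * N ^ 2 + G
  have hL : 1 ≤ L := by nlinarith [sq_nonneg N]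
  refine ⟨1 / L, by positivity, fun τ a b hτ ha hb => ?_⟩
  have hδ : 1 / L ≤ 1 := by rw [div_le_one (by linarith)]; exact hL
  obtain ⟨γ, hγ0, hγ⟩ := exists_truncated_solution hg hN one_pos τ (a, b)
  have hsub : ∀ t ∈ Ioo (τ - 1 / L) (τ + 1 / L), t ∈ Ioo (τ - 1) (τ + 1) := fun t ht =>
    ⟨by linarith [ht.1], by linarith [ht.2]⟩
  rw [abs_le] at hτ
  have hb' : ∀ t ∈ Ioo (τ - 1 / L) (τ + 1 / L), ‖γ t - γ τ‖ ≤ 1 := by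
    intro t ht
    have := (convex_Ioo (τ - 1 / L) (τ + 1 / L)).norm_image_sub_le_of_norm_hasDerivWithin_le
      (f := γ) (C := L) (fun x hx => (hγ x (hsub x hx)).hasDerivWithinAt)
      (fun x hx => norm_field_le hN (hG x ⟨by linarith [(hsub x hx).1],
        by linarith [(hsub x hx).2]⟩) _)
      (x := τ) ⟨by linarith [show 0 < 1 / L by positivity],
        by linarith [show 0 < 1 / L by positivity]⟩ ht
    refine this.trans ?_
    have h1 : ‖t - τ‖ ≤ 1 / L := by
      rw [Real.norm_eq_abs, abs_le]
      constructor <;> linarith [ht.1, ht.2]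
    calc L * ‖t - τ‖ ≤ L * (1 / L) := mul_le_mul_of_nonneg_left h1 (by linarith)
      _ = 1 := by field_simp
  refine ⟨fun t => (γ t).1, fun t => (γ t).2, sol_of_hasDerivAt_field (N := N)
    (fun t ht => hγ t (hsub t ht)) (fun t ht => ?_) (fun t ht => ?_), by simp [hγ0], by simp [hγ0]⟩
  · have := (norm_fst_le (γ t - γ τ)).trans (hb' t ht)
    rw [hγ0, Prod.fst_sub, Real.norm_eq_abs] at this
    calc |(γ t).1| = |((γ t).1 - a) + a| := by ring_nf
      _ ≤ _ := abs_add_le _ _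
      _ ≤ N := by simp only [N]; linarith
  · have := (norm_snd_le (γ t - γ τ)).trans (hb' t ht)
    rw [hγ0, Prod.snd_sub, Real.norm_eq_abs] at this
    calc |(γ t).2| = |((γ t).2 - b) + b| := by ring_nf
      _ ≤ _ := abs_add_le _ _
      _ ≤ N := by simp only [N]; linarith

end

/-! ### Monotonicity, reflection, gluing, continuation and maximal solutions. -/

section

variable {g U V U₁ V₁ U₂ V₂ : ℝ → ℝ} {s s' : Set ℝ}

lemma monotoneOn_of_hasDerivAt {f f' : ℝ → ℝ} [hs : s.OrdConnected]
    (hf : ∀ t ∈ s, HasDerivAt f (f' t) t) (h0 : ∀ t ∈ s, 0 ≤ f' t) : MonotoneOn f s := by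
  refine monotoneOn_of_deriv_nonneg hs.convex
    (fun t ht => (hf t ht).continuousAt.continuousWithinAt)
    (fun t ht => (hf t (interior_subset ht)).differentiableAt.differentiableWithinAt) ?_
  intro t ht
  rw [(hf t (interior_subset ht)).deriv]
  exact h0 t (interior_subset ht)

lemma strictMonoOn_of_hasDerivAt {f f' : ℝ → ℝ} [hs : s.OrdConnected]
    (hf : ∀ t ∈ s, HasDerivAt f (f' t) t) (h0 : ∀ t ∈ interior s, 0 < f' t) :
    StrictMonoOn f s := by
  refine strictMonoOn_of_deriv_pos hs.convex
    (fun t ht => (hf t ht).continuousAt.continuousWithinAt) ?_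
  intro t ht
  rw [(hf t (interior_subset ht)).deriv]
  exact h0 t ht

lemma le_of_hasDerivAt_nonneg {f f' : ℝ → ℝ} {a b : ℝ} (hab : a ≤ b)
    (hf : ∀ t ∈ Icc a b, HasDerivAt f (f' t) t) (h0 : ∀ t ∈ Icc a b, 0 ≤ f' t) : f a ≤ f b :=
  monotoneOn_of_hasDerivAt hf h0 ⟨le_rfl, hab⟩ ⟨hab, le_rfl⟩ hab

lemma lt_of_hasDerivAt_pos {f f' : ℝ → ℝ} {a b : ℝ} (hab : a < b)
    (hf : ∀ t ∈ Icc a b, HasDerivAt f (f' t) t) (h0 : ∀ t ∈ Ioo a b, 0 < f' t) : f a < f b :=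
  strictMonoOn_of_hasDerivAt hf (by simpa using h0) ⟨le_rfl, hab.le⟩ ⟨hab.le, le_rfl⟩ hab

lemma Sol.reflect (h : Sol g U V s) :
    Sol (fun t => g (-t)) (fun t => U (-t)) (fun t => -V (-t)) (Neg.neg ⁻¹' s) := by
  intro t ht
  obtain ⟨h1, h2⟩ := h (-t) ht
  have e1 := h1.scomp t (hasDerivAt_neg t)
  have e2 := (h2.scomp t (hasDerivAt_neg t)).neg
  constructor
  · simpa [Function.comp_def] using! e1
  · simpa [Function.comp_def] using! e2

lemma Sol.reflect_Ioo {a b : ℝ} (h : Sol g U V (Ioo a b)) :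
    Sol (fun t => g (-t)) (fun t => U (-t)) (fun t => -V (-t)) (Ioo (-b) (-a)) :=
  h.reflect.mono fun t ht => ⟨by linarith [ht.2], by linarith [ht.1]⟩

lemma Sol.congr {t : ℝ} (h : Sol g U₁ V₁ {t}) (hU : U₂ =ᶠ[𝓝 t] U₁) (hV : V₂ =ᶠ[𝓝 t] V₁) :
    Sol g U₂ V₂ {t} := by
  rintro t rfl
  obtain ⟨h1, h2⟩ := h t rfl
  rw [hU.self_of_nhds, hV.self_of_nhds]
  exact ⟨h1.congr_of_eventuallyEq hU, h2.congr_of_eventuallyEq hV⟩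

lemma Sol.glue {S T a b p : ℝ} (h₁ : Sol g U₁ V₁ (Ioo S T)) (h₂ : Sol g U₂ V₂ (Ioo a b))
    (hp₁ : p ∈ Ioo S T) (hp₂ : p ∈ Ioo a b) (hU : U₁ p = U₂ p) (hV : V₁ p = V₂ p) :
    ∃ U V, Sol g U V (Ioo S b) ∧ EqOn U U₁ (Ioo S p) ∧ EqOn V V₁ (Ioo S p) ∧
      U p = U₁ p ∧ V p = V₁ p := by
  have agree : ∀ t ∈ Ioo (max S a) (min T b), U₁ t = U₂ t ∧ V₁ t = V₂ t := fun t ht =>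
    Sol.eqOn (s := Ioo (max S a) (min T b))
      (h₁.mono (Ioo_subset_Ioo (le_max_left _ _) (min_le_left _ _)))
      (h₂.mono (Ioo_subset_Ioo (le_max_right _ _) (min_le_right _ _)))
      ⟨max_lt hp₁.1 hp₂.1, lt_min hp₁.2 hp₂.2⟩ hU hV ht
  refine ⟨fun t => if t ≤ p then U₁ t else U₂ t, fun t => if t ≤ p then V₁ t else V₂ t,
    ?_, fun t ht => if_pos ht.2.le, fun t ht => if_pos ht.2.le, if_pos le_rfl, if_pos le_rfl⟩
  intro t ht
  suffices h : Sol g (fun t => if t ≤ p then U₁ t else U₂ t)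
    (fun t => if t ≤ p then V₁ t else V₂ t) {t} from h t rfl
  rcases lt_trichotomy t p with hlt | rfl | hlt
  · refine Sol.congr (h₁.mono (s' := {t}) (by
      rintro _ rfl; exact ⟨ht.1, hlt.trans hp₁.2⟩)) ?_ ?_ <;>
    · filter_upwards [eventually_lt_nhds hlt] with x hx using if_pos hx.le
  · have hmem : Ioo (max S a) (min T b) ∈ 𝓝 t :=
      Ioo_mem_nhds (max_lt hp₁.1 hp₂.1) (lt_min hp₁.2 hp₂.2)
    refine Sol.congr (h₁.mono (s' := {t}) (by rintro _ rfl; exact hp₁)) ?_ ?_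
    · filter_upwards [hmem] with x hx
      split_ifs with hx'
      · rfl
      · exact (agree x hx).1.symm
    · filter_upwards [hmem] with x hx
      split_ifs with hx'
      · rfl
      · exact (agree x hx).2.symm
  · refine Sol.congr (h₂.mono (s' := {t}) (by
      rintro _ rfl; exact ⟨hp₂.1.trans hlt, ht.2⟩)) ?_ ?_ <;>
    · filter_upwards [eventually_gt_nhds hlt] with x hx using if_neg (not_le.2 hx)

/-- A solution that stays bounded up to the right end point extends beyond it. -/
lemma Sol.extend_of_bounded (hg : Continuous g) {S T c B : ℝ} (h : Sol g U V (Ioo S T))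
    (hc : c ∈ Ioo S T) (hB : ∀ t ∈ Ico c T, |U t| ≤ B ∧ |V t| ≤ B) :
    ∃ U' V', ∃ η > 0, Sol g U' V' (Ioo S (T + η)) ∧ EqOn U' U (Ioo S T) ∧
      EqOn V' V (Ioo S T) := by
  obtain ⟨δ, hδ, H⟩ := exists_uniform_local_solution hg B (max |c| |T|)
  set p := max c (T - δ / 2)
  have hp : p ∈ Ico c T := ⟨le_max_left _ _, max_lt hc.2 (by linarith)⟩
  have hpS : p ∈ Ioo S T := ⟨hc.1.trans_le hp.1, hp.2⟩
  have hpT : T - δ / 2 ≤ p := le_max_right _ _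
  have hpabs : |p| ≤ max |c| |T| := by
    have h1 := neg_abs_le c
    have h2 := le_abs_self T
    rw [abs_le]
    exact ⟨by linarith [le_max_left |c| |T|, hp.1], by linarith [le_max_right |c| |T|, hp.2]⟩
  obtain ⟨W, Z, hW, hW1, hW2⟩ := H p (U p) (V p) hpabs (hB p hp).1 (hB p hp).2
  obtain ⟨U', V', h', _, _, e1, e2⟩ := h.glue hW hpS ⟨by linarith, by linarith⟩ hW1.symm hW2.symm
  have h'' := h'.mono (Ioo_subset_Ioo_right (show T + δ / 2 ≤ p + δ by linarith))
  have key : ∀ t ∈ Ioo S T, U' t = U t ∧ V' t = V t := fun t ht =>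
    Sol.eqOn (s := Ioo S T) (h''.mono (Ioo_subset_Ioo_right (by linarith))) h hpS e1 e2 ht
  exact ⟨U', V', δ / 2, by positivity, h'', fun t ht => (key t ht).1, fun t ht => (key t ht).2⟩

lemma Sol.monotoneOn_deriv [s.OrdConnected] (h : Sol g U V s) (hg0 : ∀ t ∈ s, 0 ≤ g t) :
    MonotoneOn V s :=
  monotoneOn_of_hasDerivAt (fun t ht => (h t ht).2)
    fun t ht => by nlinarith [hg0 t ht, sq_nonneg (U t)]

/-- At the right end point of a bounded interval on which the forcing term is nonnegative, a
solution either extends or tends to infinity. -/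
theorem Sol.tendsto_or_extend (hg : Continuous g) {S T : ℝ} (hST : S < T)
    (h : Sol g U V (Ioo S T)) (hg0 : ∀ t ∈ Ioo S T, 0 ≤ g t) :
    Tendsto U (𝓝[<] T) atTop ∨
    ∃ U' V', ∃ η > 0, Sol g U' V' (Ioo S (T + η)) ∧ EqOn U' U (Ioo S T) ∧
      EqOn V' V (Ioo S T) := by
  by_contra hcon
  push Not at hcon
  obtain ⟨hnt, hne⟩ := hcon
  have hV := h.monotoneOn_deriv hg0
  suffices ∃ c ∈ Ioo S T, ∃ B, ∀ t ∈ Ico c T, |U t| ≤ B ∧ |V t| ≤ B by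
    obtain ⟨c, hc, B, hB⟩ := this
    obtain ⟨U', V', η, hη, h1, h2, h3⟩ := h.extend_of_bounded hg hc hB
    exact hne U' V' η hη h1 h2 h3
  suffices ∃ c ∈ Ioo S T, ∃ B, ∀ t ∈ Ico c T, |U t| ≤ B by
    obtain ⟨c, hc, B, hB⟩ := this
    obtain ⟨G, hG0, hG⟩ := exists_abs_le_on_Icc hg S T
    have hB0 : 0 ≤ B := (abs_nonneg _).trans (hB c ⟨le_rfl, hc.2⟩)
    set K := 6 * B ^ 2 + G
    refine ⟨c, hc, max B (|V c| + K * (T - c)), fun t ht =>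
      ⟨(hB t ht).trans (le_max_left _ _), le_trans ?_ (le_max_right _ _)⟩⟩
    have hsub : ∀ x ∈ Icc c t, x ∈ Ioo S T := fun x hx =>
      ⟨hc.1.trans_le hx.1, hx.2.trans_lt ht.2⟩
    have h1 : V c ≤ V t := hV hc (hsub t ⟨ht.1, le_rfl⟩) ht.1
    have h2 : K * c - V c ≤ K * t - V t := by
      refine le_of_hasDerivAt_nonneg (f := fun x => K * x - V x)
        (f' := fun x => K * 1 - (6 * U x ^ 2 + g x)) ht.1
        (fun x hx => ((hasDerivAt_id x).const_mul K).sub (h x (hsub x hx)).2) ?_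
      intro x hx
      have e1 := hB x ⟨hx.1, hx.2.trans_lt ht.2⟩
      have e2 := abs_le.1 (hG x (Ioo_subset_Icc_self (hsub x hx)))
      have e3 : |U x| ^ 2 ≤ B ^ 2 := pow_le_pow_left₀ (abs_nonneg _) e1 2
      rw [sq_abs] at e3
      simp only [K]
      linarith [e2.2]
    have hK : 0 ≤ K := by positivity
    have h3 : K * (t - c) ≤ K * (T - c) := mul_le_mul_of_nonneg_left (by linarith [ht.2]) hK
    have h4 : 0 ≤ K * (T - c) := mul_nonneg hK (by linarith [hc.2])
    rw [abs_le]
    constructor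
    · linarith [neg_abs_le (V c)]
    · linarith [le_abs_self (V c)]
  -- `V` is nondecreasing. If it is positive somewhere, `U` increases from there on and is bounded
  -- unless it tends to infinity. Otherwise `V c ≤ V ≤ 0` after `c`, and `U` changes by a bounded
  -- amount.
  by_cases hpos : ∃ c ∈ Ioo S T, 0 < V c
  · obtain ⟨c, hc, hVc⟩ := hpos
    have hsub : Ico c T ⊆ Ioo S T := fun x hx => ⟨hc.1.trans_le hx.1, hx.2⟩
    have hUm : MonotoneOn U (Ico c T) := monotoneOn_of_hasDerivAt
      (fun t ht => (h t (hsub ht)).1) fun t ht => hVc.le.trans (hV hc (hsub ht) ht.1)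
    have : ∃ M, ∀ t ∈ Ico c T, U t ≤ M := by
      by_contra hM
      push Not at hM
      apply hnt
      rw [tendsto_atTop]
      intro M
      obtain ⟨t, ht, hMt⟩ := hM M
      filter_upwards [Ioo_mem_nhdsLT ht.2] with x hx
      exact hMt.le.trans (hUm ht ⟨ht.1.trans hx.1.le, hx.2⟩ hx.1.le)
    obtain ⟨M, hM⟩ := this
    refine ⟨c, hc, max |U c| |M|, fun t ht => ?_⟩
    have e1 := hM t ht
    have e2 := hUm ⟨le_rfl, hc.2⟩ ht ht.1
    rw [abs_le]
    constructor
    · linarith [neg_abs_le (U c), le_max_left |U c| |M|]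
    · linarith [le_abs_self M, le_max_right |U c| |M|]
  · push Not at hpos
    obtain ⟨c, hc⟩ : ∃ c, c ∈ Ioo S T := ⟨(S + T) / 2, by linarith, by linarith⟩
    have hVc := hpos c hc
    refine ⟨c, hc, |U c| + |V c| * (T - c), fun t ht => ?_⟩
    have hsub : ∀ x ∈ Icc c t, x ∈ Ioo S T := fun x hx =>
      ⟨hc.1.trans_le hx.1, hx.2.trans_lt ht.2⟩
    have e1 : U c - V c * c ≤ U t - V c * t := by
      refine le_of_hasDerivAt_nonneg (f := fun x => U x - V c * x)
        (f' := fun x => V x - V c * 1) ht.1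
        (fun x hx => (h x (hsub x hx)).1.sub ((hasDerivAt_id x).const_mul (V c))) ?_
      intro x hx
      have := hV hc (hsub x hx) hx.1
      linarith
    have e2 : -U c ≤ -U t := by
      refine le_of_hasDerivAt_nonneg (f := fun x => -U x)
        (f' := fun x => -V x) ht.1 (fun x hx => (h x (hsub x hx)).1.neg) ?_
      intro x hx
      have := hpos x (hsub x hx)
      linarith
    have e3 : |V c| * (t - c) ≤ |V c| * (T - c) :=
      mul_le_mul_of_nonneg_left (by linarith [ht.2]) (abs_nonneg _)
    have e4 : 0 ≤ |V c| * (T - c) := mul_nonneg (abs_nonneg _) (by linarith [hc.2])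
    have e5 : V c = -|V c| := by rw [abs_of_nonpos hVc]; ring
    have e6 : -|V c| * (t - c) = V c * (t - c) := by rw [← e5]
    rw [abs_le]
    constructor
    · nlinarith [neg_abs_le (U c)]
    · linarith [le_abs_self (U c)]

theorem exists_maximal_solution (hg : Continuous g) (τ a b : ℝ) :
    ∃ (U V : ℝ → ℝ) (J : Set ℝ), IsOpen J ∧ J.OrdConnected ∧ τ ∈ J ∧ Sol g U V J ∧
      U τ = a ∧ V τ = b ∧ ∀ (U' V' : ℝ → ℝ) (J' : Set ℝ), IsOpen J' → J'.OrdConnected → τ ∈ J' →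
        Sol g U' V' J' → U' τ = a → V' τ = b → J' ⊆ J := by
  classical
  let P : Set ℝ → (ℝ → ℝ) → (ℝ → ℝ) → Prop := fun J U V =>
    IsOpen J ∧ J.OrdConnected ∧ τ ∈ J ∧ Sol g U V J ∧ U τ = a ∧ V τ = b
  let F : Set (Set ℝ) := {J | ∃ U V, P J U V}
  -- The maximal solution takes at `t` the value of some chosen solution living on an interval
  -- containing `t`. By uniqueness the choice does not matter.
  have hchoice : ∀ t : ℝ, ∃ (I : Set ℝ) (U V : ℝ → ℝ), t ∈ ⋃₀ F → t ∈ I ∧ P I U V := by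
    intro t
    by_cases ht : t ∈ ⋃₀ F
    · obtain ⟨I, ⟨U, V, hP⟩, htI⟩ := ht
      exact ⟨I, U, V, fun _ => ⟨htI, hP⟩⟩
    · exact ⟨∅, 0, 0, fun h => absurd h ht⟩
  choose I u v huv using hchoice
  have agree : ∀ J U V t, P J U V → t ∈ J → u t t = U t ∧ v t t = V t := by
    intro J U V t hP ht
    obtain ⟨htI, -, hoc, hτI, hs, hu, hv⟩ := huv t ⟨J, ⟨U, V, hP⟩, ht⟩
    obtain ⟨-, hoc', hτJ, hs', hu', hv'⟩ := hP
    have : (I t ∩ J).OrdConnected := hoc.inter hoc'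
    exact Sol.eqOn (s := I t ∩ J) (hs.mono inter_subset_left) (hs'.mono inter_subset_right)
      ⟨hτI, hτJ⟩ (hu.trans hu'.symm) (hv.trans hv'.symm) ⟨htI, ht⟩
  obtain ⟨δ, hδ, H⟩ := exists_uniform_local_solution hg (max |a| |b|) |τ|
  obtain ⟨U₀, V₀, h₀, hU₀, hV₀⟩ := H τ a b le_rfl (le_max_left _ _) (le_max_right _ _)
  have hτ₀ : τ ∈ Ioo (τ - δ) (τ + δ) := ⟨by linarith, by linarith⟩
  have hP₀ : P (Ioo (τ - δ) (τ + δ)) U₀ V₀ := ⟨isOpen_Ioo, ordConnected_Ioo, hτ₀, h₀, hU₀, hV₀⟩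
  refine ⟨fun t => u t t, fun t => v t t, ⋃₀ F, ?_, ?_, ?_, ?_, ?_, ?_, ?_⟩
  · exact isOpen_sUnion fun J hJ => hJ.choose_spec.choose_spec.1
  · apply IsPreconnected.ordConnected
    refine isPreconnected_sUnion τ F (fun J hJ => ?_) fun J hJ => ?_
    · exact hJ.choose_spec.choose_spec.2.2.1
    · have := hJ.choose_spec.choose_spec.2.1
      exact this.isPreconnected
  · exact ⟨_, ⟨U₀, V₀, hP₀⟩, hτ₀⟩
  · rintro t ⟨J, ⟨U, V, hP⟩, ht⟩
    have hJ : J ∈ 𝓝 t := hP.1.mem_nhds ht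
    refine Sol.congr (t := t) (U₂ := fun t => u t t) (V₂ := fun t => v t t)
      (hP.2.2.2.1.mono (by rintro _ rfl; exact ht)) ?_ ?_ t rfl
    · filter_upwards [hJ] with x hx using (agree J U V x hP hx).1
    · filter_upwards [hJ] with x hx using (agree J U V x hP hx).2
  · exact (agree _ _ _ τ hP₀ hτ₀).1.trans hU₀
  · exact (agree _ _ _ τ hP₀ hτ₀).2.trans hV₀
  · intro U' V' J' h1 h2 h3 h4 h5 h6
    exact subset_sUnion_of_mem ⟨U', V', h1, h2, h3, h4, h5, h6⟩

end

/-! ### Forcing `|t|`: quantitative blow-up in finite time. -/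

section

variable {U V U₁ V₁ U₂ V₂ : ℝ → ℝ} {s s' : Set ℝ}

lemma Sol.reflect_abs_Ioo {a b : ℝ} (h : Sol abs U V (Ioo a b)) :
    Sol abs (fun t => U (-t)) (fun t => -V (-t)) (Ioo (-b) (-a)) := by
  simpa using! h.reflect_Ioo

lemma Sol.deriv_linear_lower {c a b : ℝ} (hab : a ≤ b) (h : Sol abs U V (Icc a b))
    (hc : ∀ t ∈ Icc a b, c ≤ 6 * U t ^ 2 + |t|) : V a + c * (b - a) ≤ V b := by
  have := le_of_hasDerivAt_nonneg (f := fun x => V x - c * x)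
    (f' := fun x => 6 * U x ^ 2 + |x| - c * 1) hab
    (fun x hx => (h x hx).2.sub ((hasDerivAt_id x).const_mul c))
    (fun x hx => by linarith [hc x hx])
  linarith

lemma Sol.quadratic_lower {c a b : ℝ} (hab : a ≤ b) (h : Sol abs U V (Icc a b))
    (hc : ∀ t ∈ Icc a b, c ≤ 6 * U t ^ 2 + |t|) :
    U a + V a * (b - a) + c / 2 * (b - a) ^ 2 ≤ U b := by
  have := le_of_hasDerivAt_nonneg
    (f := fun x => U x - V a * (x - a) - c / 2 * (x - a) ^ 2)
    (f' := fun x => V x - V a * 1 - c / 2 * (2 * (x - a) ^ (2 - 1) * 1)) hab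
    (fun x hx => (((h x hx).1.sub (((hasDerivAt_id x).sub_const a).const_mul (V a)))).sub
      ((((hasDerivAt_id x).sub_const a).pow 2).const_mul (c / 2)))
    (fun x hx => by
      have := (h.mono (Icc_subset_Icc_right hx.2)).deriv_linear_lower (c := c) hx.1
        (fun t ht => hc t ⟨ht.1, ht.2.trans hx.2⟩)
      norm_num
      linarith)
  simp only [sub_self, mul_zero, ne_eq, OfNat.ofNat_ne_zero, not_false_eq_true, zero_pow,
    sub_zero] at this
  linarith

lemma Sol.monotoneOn_abs [s.OrdConnected] (h : Sol abs U V s) : MonotoneOn V s :=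
  h.monotoneOn_deriv fun t _ => abs_nonneg t

lemma Sol.monotoneOn_of_deriv_nonneg {a b : ℝ} (h : Sol abs U V (Icc a b)) (hV : 0 ≤ V a) :
    MonotoneOn U (Icc a b) :=
  monotoneOn_of_hasDerivAt (fun t ht => (h t ht).1) fun _ ht =>
    hV.trans (h.monotoneOn_abs ⟨le_rfl, ht.1.trans ht.2⟩ ht ht.1)

/-- The energy `V² - 4U³` has derivative `2V|t|`, which is nonnegative while `U` increases. -/
lemma Sol.energy_le {a b : ℝ} (hab : a ≤ b) (h : Sol abs U V (Icc a b)) (hV : 0 ≤ V a) :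
    V a ^ 2 - 4 * U a ^ 3 ≤ V b ^ 2 - 4 * U b ^ 3 := by
  refine le_of_hasDerivAt_nonneg (f := fun x => V x ^ 2 - 4 * U x ^ 3)
    (f' := fun x => 2 * V x ^ (2 - 1) * (6 * U x ^ 2 + |x|) - 4 * (3 * U x ^ (3 - 1) * V x)) hab
    (fun x hx => ((h x hx).2.pow 2).sub (((h x hx).1.pow 3).const_mul 4)) fun x hx => ?_
  have : 0 ≤ V x := hV.trans (h.monotoneOn_abs ⟨le_rfl, hab⟩ hx hx.1)
  have := mul_nonneg this (abs_nonneg x)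
  norm_num
  nlinarith

/-- A solution that is large and nondecreasing at `a` blows up within time `3 / κ`. -/
theorem Sol.not_of_large {κ a : ℝ} (hκ : 0 < κ) (h : Sol abs U V (Icc a (a + 3 / κ)))
    (hU : κ ^ 2 ≤ U a) (hV : 0 ≤ V a) : False := by
  have hk : 0 < 1 / κ := by positivity
  have e3 : a + 3 / κ = a + 1 / κ + 2 * (1 / κ) := by ring
  rw [e3] at h
  set b := a + 1 / κ
  have hab : a ≤ b := by simp only [b]; linarith
  have hUm := h.monotoneOn_of_deriv_nonneg hV
  have hVm := h.monotoneOn_abs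
  have ha0 : a ∈ Icc a (b + 2 * (1 / κ)) := ⟨le_rfl, by linarith⟩
  set M := U a
  have hM : 0 < M := lt_of_lt_of_le (by positivity) hU
  -- On `[a, a + 1/κ]` one has `U'' ≥ 6M²`, so `U` gains at least `3M² / κ² ≥ 3M`.
  have hb : 4 * M ≤ U b := by
    have := (h.mono (Icc_subset_Icc_right (by linarith))).quadratic_lower (c := 6 * M ^ 2) hab
      (fun t ht => by
        have h1 := hUm ha0 ⟨ht.1, by linarith [ht.2]⟩ ht.1
        nlinarith [abs_nonneg t])
    have e : b - a = 1 / κ := by simp only [b]; ring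
    rw [e] at this
    have h1 : 0 ≤ V a * (1 / κ) := by positivity
    have h2 : M ≤ M ^ 2 * (1 / κ) ^ 2 := by
      have h3 : M * κ ^ 2 * (1 / κ) ^ 2 ≤ M * M * (1 / κ) ^ 2 := by gcongr
      have h4 : M * κ ^ 2 * (1 / κ) ^ 2 = M := by field_simp
      nlinarith
    nlinarith
  have hpos : ∀ t ∈ Icc b (b + 2 * (1 / κ)), 4 * M ≤ U t := fun t ht =>
    hb.trans (hUm ⟨hab, by linarith⟩ ⟨hab.trans ht.1, ht.2⟩ ht.1)
  have hVU : ∀ t ∈ Icc b (b + 2 * (1 / κ)), U t * √(U t) ≤ V t := by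
    intro t ht
    have h1 := (h.mono (Icc_subset_Icc_right ht.2)).energy_le (hab.trans ht.1) hV
    have h2 := hpos t ht
    have h3 : 0 ≤ V t := hV.trans (hVm ha0 ⟨hab.trans ht.1, ht.2⟩ (hab.trans ht.1))
    apply abs_le_of_sq_le_sq' _ h3 |>.2
    rw [mul_pow, Real.sq_sqrt (by linarith)]
    have h4 : (4 * M) ^ 3 ≤ U t ^ 3 := pow_le_pow_left₀ (by linarith) h2 3
    nlinarith [sq_nonneg (V a)]
  -- Since `U ≥ 4M`, the energy gives `V ≥ U^(3/2)`, that is `(U^(-1/2))' ≤ -1/2`. As `U^(-1/2) ≤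
  -- 1/κ` at `b`, it would reach zero within `2/κ`.
  have key := le_of_hasDerivAt_nonneg (f := fun x => -(√(U x))⁻¹ - x / 2)
    (f' := fun x => -(-(V x / (2 * √(U x))) / √(U x) ^ 2) - 1 / 2)
    (show b ≤ b + 2 * (1 / κ) by linarith)
    (fun x hx => by
      have hx0 : 0 < U x := by linarith [hpos x hx]
      exact ((((h x ⟨hab.trans hx.1, hx.2⟩).1.sqrt hx0.ne').inv
        (Real.sqrt_pos.2 hx0).ne').neg).sub ((hasDerivAt_id x).div_const 2))
    (fun x hx => by
      have hx0 : 0 < U x := by linarith [hpos x hx]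
      have hs : 0 < √(U x) := Real.sqrt_pos.2 hx0
      have h1 := hVU x hx
      have h2 : √(U x) ^ 2 = U x := Real.sq_sqrt hx0.le
      have h3 : -(-(V x / (2 * √(U x))) / √(U x) ^ 2) = V x / (2 * (U x * √(U x))) := by
        rw [h2]; field_simp
      rw [h3, sub_nonneg, div_le_div_iff₀ (by norm_num) (by positivity)]
      linarith)
  have h1 : 0 < (√(U (b + 2 * (1 / κ))))⁻¹ := by
    have := hpos (b + 2 * (1 / κ)) ⟨by linarith, le_rfl⟩
    have : 0 < U (b + 2 * (1 / κ)) := by linarith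
    positivity
  have h2 : (√(U b))⁻¹ ≤ 1 / κ := by
    rw [one_div]
    apply inv_anti₀ hκ
    apply Real.le_sqrt_of_sq_le
    linarith
  linarith

/-- A solution with a deep minimum `-κ²` blows up within time `7 / κ`. -/
theorem Sol.not_of_deep_min {κ a : ℝ} (hκ : 0 < κ) (h : Sol abs U V (Icc a (a + 7 / κ)))
    (hU : U a = -κ ^ 2) (hV : V a = 0) : False := by
  have hk : 0 < 1 / κ := by positivity
  have e3 : a + 7 / κ = a + 2 * (1 / κ) + 2 * (1 / κ) + 3 / κ := by ring
  rw [e3] at h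
  set b := a + 2 * (1 / κ)
  set c := b + 2 * (1 / κ)
  have hk3 : 0 < 3 / κ := by positivity
  have hab : a ≤ b := by simp only [b]; linarith
  have hbc : b ≤ c := by simp only [c]; linarith
  have hUm := h.monotoneOn_of_deriv_nonneg hV.ge
  have hVm := h.monotoneOn_abs
  -- While `U ≤ -κ²/2` one has `U'' ≥ 3κ⁴/2`, so in time `2/κ` the gain would be `3κ²`, which is too
  -- much. The energy then gives `V b ≥ κ³`. Another `2/κ` lifts `U` above `κ²`, and
  -- `Sol.not_of_large` costs the remaining `3/κ`.
  have hb : -(κ ^ 2 / 2) ≤ U b := by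
    by_contra! hlt
    have := (h.mono (Icc_subset_Icc_right (by linarith))).quadratic_lower
      (c := 3 / 2 * κ ^ 4) hab
      (fun t ht => by
        have h1 := hUm ⟨ht.1, by linarith [ht.2]⟩ (show b ∈ Icc _ _ from ⟨hab, by linarith⟩) ht.2
        have h2 : U t ≤ -(κ ^ 2 / 2) := h1.trans hlt.le
        nlinarith [abs_nonneg t, sq_nonneg κ])
    have e : b - a = 2 * (1 / κ) := by simp only [b]; ring
    have e2 : 3 / 2 * κ ^ 4 / 2 * (2 * (1 / κ)) ^ 2 = 3 * κ ^ 2 := by field_simp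
    rw [e, e2, hV, hU] at this
    nlinarith [sq_nonneg κ]
  have hVb : κ ^ 3 ≤ V b := by
    have h1 := (h.mono (Icc_subset_Icc_right (by linarith))).energy_le hab hV.ge
    have h3 : 0 ≤ V b := hV.ge.trans
      (hVm ⟨le_rfl, by linarith⟩ ⟨hab, by linarith⟩ hab)
    apply abs_le_of_sq_le_sq' _ h3 |>.2
    rw [hV, hU] at h1
    have h2 : (-(κ ^ 2 / 2)) ^ 3 ≤ U b ^ 3 := (Odd.strictMono_pow (by decide)).monotone hb
    have : 0 < κ ^ 6 := by positivity
    nlinarith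
  have hc := (h.mono (Icc_subset_Icc hab (by linarith : c ≤ c + 3 / κ))).quadratic_lower
    (c := 0) hbc (fun t _ => by positivity)
  have e : c - b = 2 * (1 / κ) := by simp only [c]; ring
  rw [e] at hc
  have h5 : κ ^ 3 * (2 * (1 / κ)) ≤ V b * (2 * (1 / κ)) := by gcongr
  have h6 : κ ^ 3 * (2 * (1 / κ)) = 2 * κ ^ 2 := by field_simp
  refine Sol.not_of_large (a := c) hκ (h.mono (Icc_subset_Icc_left (hab.trans hbc))) ?_ ?_
  · nlinarith [sq_nonneg κ]
  · exact hV.ge.trans (hVm ⟨le_rfl, by linarith⟩ ⟨hab.trans hbc, by linarith⟩ (hab.trans hbc))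

/-- Every solution blows up in finite time. -/
theorem exists_time_no_solution (τ a b : ℝ) : ∃ S > τ, ∀ U V : ℝ → ℝ,
    Sol abs U V (Icc τ S) → U τ = a → V τ = b → False := by
  set r := max τ 1
  have hr : τ ≤ r := le_max_left _ _
  have hr1 : 1 ≤ r := le_max_right _ _
  -- After `r` the forcing is at least `1`. The gain of `U` over time `w` is at least `w (w/2 - |b|)
  -- ≥ w`, which makes up for the lowest possible `U r` and leaves `U ≥ 1` and `V ≥ 0`.
  set w := 2 * (|b| + 1) + |a| + |b| * (r - τ)
  have hbr : 0 ≤ |b| * (r - τ) := mul_nonneg (abs_nonneg _) (by linarith)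
  have hw : 2 * (|b| + 1) ≤ w := by simp only [w]; linarith [abs_nonneg a]
  have hw0 : 0 < w := by linarith [abs_nonneg b]
  refine ⟨r + w + 3 / 1, by linarith, fun U V h hU hV => ?_⟩
  have h1 : Sol abs U V (Icc τ r) := h.mono (Icc_subset_Icc_right (by linarith))
  have h2 : Sol abs U V (Icc r (r + w)) := h.mono (Icc_subset_Icc hr (by linarith))
  have v1 := h1.deriv_linear_lower (c := 0) hr (fun t _ => by positivity)
  have u1 := h1.quadratic_lower (c := 0) hr (fun t _ => by positivity)
  have hc : ∀ t ∈ Icc r (r + w), 1 ≤ 6 * U t ^ 2 + |t| := fun t ht => by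
    rw [abs_of_nonneg (by linarith [ht.1])]
    nlinarith [sq_nonneg (U t), ht.1]
  have v2 := h2.deriv_linear_lower (c := 1) (by linarith) hc
  have u2 := h2.quadratic_lower (c := 1) (by linarith) hc
  rw [hU, hV] at u1
  rw [hV] at v1
  have e : r + w - r = w := by ring
  rw [e] at u2 v2
  have b1 : -|b| ≤ b := neg_abs_le b
  have a1 : -|a| ≤ a := neg_abs_le a
  have b2 : -|b| * (r - τ) ≤ b * (r - τ) := mul_le_mul_of_nonneg_right b1 (by linarith)
  have b3 : -|b| * w ≤ V r * w := mul_le_mul_of_nonneg_right (by linarith) hw0.le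
  have b4 : w ≤ w * (w / 2 - |b|) := by nlinarith
  refine Sol.not_of_large (a := r + w) one_pos (h.mono (Icc_subset_Icc_left (by linarith))) ?_ ?_
  · nlinarith [abs_nonneg b]
  · linarith [abs_nonneg b]

end

/-! ### Solutions with two blow-up points, parametrized by their minimum. -/

section

variable {U V U₁ V₁ U₂ V₂ : ℝ → ℝ} {s s' : Set ℝ}

/-- `(U, V)` solves `U'' = 6 U ^ 2 + |t|`, `V = U'` on the interval `(S, T)` and `U` tends to
infinity at both end points. -/
structure BlowUp (U V : ℝ → ℝ) (S T : ℝ) : Prop where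
  lt : S < T
  sol : Sol abs U V (Ioo S T)
  left : Tendsto U (𝓝[>] S) atTop
  right : Tendsto U (𝓝[<] T) atTop

lemma BlowUp.reflect {S T : ℝ} (h : BlowUp U V S T) :
    BlowUp (fun t => U (-t)) (fun t => -V (-t)) (-T) (-S) := by
  refine ⟨by linarith [h.lt], h.sol.reflect_abs_Ioo, ?_, ?_⟩
  · exact h.right.comp (by simpa using tendsto_neg_nhdsGT_neg (a := T))
  · exact h.left.comp (by simpa using tendsto_neg_nhdsLT_neg (a := S))

lemma not_tendsto_atTop_of_continuousAt {f : ℝ → ℝ} {a : ℝ} {l : Filter ℝ} [l.NeBot]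
    (hl : l ≤ 𝓝 a) (hf : ContinuousAt f a) : ¬ Tendsto f l atTop :=
  fun h => not_tendsto_nhds_of_tendsto_atTop h _ (hf.tendsto.mono_left hl)

/-- A solution with the same data stays on the left of the blow-up time. -/
lemma BlowUp.lt_right {S T τ β : ℝ} (h : BlowUp U V S T) (hτ : τ ∈ Ioo S T)
    (h' : Sol abs U₂ V₂ (Icc τ β)) (hU : U τ = U₂ τ) (hV : V τ = V₂ τ) : β < T := by
  by_contra! hle
  have hT := (h' T ⟨hτ.2.le, hle⟩).1.continuousAt
  refine not_tendsto_atTop_of_continuousAt (l := 𝓝[<] T) nhdsWithin_le_nhds hT ?_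
  refine h.right.congr' ?_
  filter_upwards [Ioo_mem_nhdsLT hτ.2] with x hx
  exact (Sol.eqOn_Icc (a := τ) (b := x) (h.sol.mono fun y hy => ⟨hτ.1.trans_le hy.1,
    hy.2.trans_lt hx.2⟩) (h'.mono (Icc_subset_Icc_right (hx.2.le.trans hle)))
    ⟨le_rfl, hx.1.le⟩ hU hV ⟨hx.1.le, le_rfl⟩).1

lemma BlowUp.right_unique {S T S' T' τ : ℝ} (h : BlowUp U V S T) (h' : BlowUp U₂ V₂ S' T')
    (hτ : τ ∈ Ioo S T) (hτ' : τ ∈ Ioo S' T') (hU : U τ = U₂ τ) (hV : V τ = V₂ τ) : T = T' := by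
  apply le_antisymm
  · apply le_of_forall_lt
    intro c hc
    rcases lt_or_ge c τ with hc' | hc'
    · exact hc'.trans hτ'.2
    · exact h'.lt_right hτ' (h.sol.mono fun y hy => ⟨hτ.1.trans_le hy.1,
        hy.2.trans_lt hc⟩) hU.symm hV.symm
  · apply le_of_forall_lt
    intro c hc
    rcases lt_or_ge c τ with hc' | hc'
    · exact hc'.trans hτ.2
    · exact h.lt_right hτ (h'.sol.mono fun y hy => ⟨hτ'.1.trans_le hy.1,
        hy.2.trans_lt hc⟩) hU hV

lemma BlowUp.left_unique {S T S' T' τ : ℝ} (h : BlowUp U V S T) (h' : BlowUp U₂ V₂ S' T')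
    (hτ : τ ∈ Ioo S T) (hτ' : τ ∈ Ioo S' T') (hU : U τ = U₂ τ) (hV : V τ = V₂ τ) : S = S' := by
  have := h.reflect.right_unique h'.reflect (τ := -τ) ⟨by linarith [hτ.2], by linarith [hτ.1]⟩
    ⟨by linarith [hτ'.2], by linarith [hτ'.1]⟩ (by simpa using hU) (by simpa using hV)
  linarith

lemma BlowUp.right_le {S T a κ : ℝ} (h : BlowUp U V S T) (ha : a ∈ Ioo S T) (hκ : 0 < κ)
    (hU : κ ^ 2 ≤ U a) (hV : 0 ≤ V a) : T ≤ a + 3 / κ := by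
  by_contra! hlt
  exact Sol.not_of_large hκ (h.sol.mono fun y hy => ⟨ha.1.trans_le hy.1, hy.2.trans_lt hlt⟩) hU hV

lemma BlowUp.exists_deriv_pos {S T c : ℝ} (h : BlowUp U V S T) (hc : c ∈ Ioo S T) :
    ∃ ξ ∈ Ioo c T, 0 < V ξ := by
  obtain ⟨t, ht1, ht2⟩ :=
    ((h.right.eventually_gt_atTop (U c)).and (Ioo_mem_nhdsLT hc.2)).exists
  have hsub : Icc c t ⊆ Ioo S T := fun x hx => ⟨hc.1.trans_le hx.1, hx.2.trans_lt ht2.2⟩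
  obtain ⟨ξ, hξ, e⟩ := exists_hasDerivAt_eq_slope U V ht2.1 (h.sol.continuousOn.mono hsub)
    fun x hx => (h.sol x (hsub (Ioo_subset_Icc_self hx))).1
  refine ⟨ξ, ⟨hξ.1, hξ.2.trans ht2.2⟩, ?_⟩
  rw [e]
  exact div_pos (by linarith) (by linarith [ht2.1])

lemma BlowUp.exists_deriv_neg {S T c : ℝ} (h : BlowUp U V S T) (hc : c ∈ Ioo S T) :
    ∃ ξ ∈ Ioo S c, V ξ < 0 := by
  obtain ⟨ξ, hξ, h0⟩ := h.reflect.exists_deriv_pos (c := -c)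
    ⟨by linarith [hc.2], by linarith [hc.1]⟩
  exact ⟨-ξ, ⟨by linarith [hξ.2], by linarith [hξ.1]⟩, by linarith⟩

lemma BlowUp.exists_deriv_eq_zero {S T : ℝ} (h : BlowUp U V S T) : ∃ τ ∈ Ioo S T, V τ = 0 := by
  obtain ⟨c, hc⟩ : ∃ c, c ∈ Ioo S T := exists_between h.lt
  obtain ⟨ξ, hξ, h1⟩ := h.exists_deriv_neg hc
  obtain ⟨η, hη, h2⟩ := h.exists_deriv_pos hc
  have hsub : Icc ξ η ⊆ Ioo S T := fun x hx => ⟨hξ.1.trans_le hx.1, hx.2.trans_lt hη.2⟩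
  obtain ⟨τ, hτ, e⟩ := intermediate_value_Icc (hξ.2.trans hη.1).le (h.sol.continuousOn'.mono hsub)
    ⟨h1.le, h2.le⟩
  exact ⟨τ, hsub hτ, e⟩

/-- The maximal interval is bounded on the right by `exists_time_no_solution`, and on the left by
its reflection, as `|t|` is even. At a finite end the solution must blow up, since otherwise it
would extend and contradict maximality. -/
theorem exists_blowUp (τ a b : ℝ) : ∃ (U V : ℝ → ℝ) (S T : ℝ), BlowUp U V S T ∧ τ ∈ Ioo S T ∧
    U τ = a ∧ V τ = b := by
  obtain ⟨U, V, J, hJ, hJ', hτ, h, hU, hV, hmax⟩ :=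
    exists_maximal_solution continuous_abs τ a b
  obtain ⟨T₁, hT₁, H₁⟩ := exists_time_no_solution τ a b
  obtain ⟨S₁, hS₁, H₂⟩ := exists_time_no_solution (-τ) a (-b)
  have hub : ∀ t ∈ J, t < T₁ := by
    intro t ht
    by_contra! hle
    exact H₁ U V (h.mono ((Icc_subset_Icc_right hle).trans (hJ'.out hτ ht))) hU hV
  have hlb : ∀ t ∈ J, -S₁ < t := by
    intro t ht
    by_contra! hle
    have h1 : Icc t τ ⊆ J := hJ'.out ht hτ
    have h2 := (h.mono h1).reflect
    simp only [abs_neg] at h2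
    exact H₂ _ _ (h2.mono fun x hx => ⟨by linarith [hx.2], by linarith [hx.1]⟩) (by simpa using hU)
      (by simpa using hV)
  have hbb : BddBelow J := ⟨-S₁, fun t ht => (hlb t ht).le⟩
  have hba : BddAbove J := ⟨T₁, fun t ht => (hub t ht).le⟩
  have hsupinf : J = Ioo (sInf J) (sSup J) := by
    apply Subset.antisymm
    · intro t ht
      obtain ⟨ε, hε, hsub⟩ := Metric.isOpen_iff.1 hJ t ht
      rw [Real.ball_eq_Ioo] at hsub
      have h1 : t + ε / 2 ∈ J := hsub ⟨by linarith, by linarith⟩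
      have h2 : t - ε / 2 ∈ J := hsub ⟨by linarith, by linarith⟩
      exact ⟨by linarith [csInf_le hbb h2], by linarith [le_csSup hba h1]⟩
    · exact (show IsConnected J from ⟨⟨τ, hτ⟩, hJ'.isPreconnected⟩).Ioo_csInf_csSup_subset hbb hba
  set S := sInf J
  set T := sSup J
  rw [hsupinf] at hτ h hmax
  have hST : S < T := hτ.1.trans hτ.2
  refine ⟨U, V, S, T, ⟨hST, h, ?_, ?_⟩, hτ, hU, hV⟩
  · have hr := h.reflect_abs_Ioo
    have hτr : -τ ∈ Ioo (-T) (-S) := ⟨by linarith [hτ.2], by linarith [hτ.1]⟩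
    rcases hr.tendsto_or_extend continuous_abs (by linarith) (fun t _ => abs_nonneg t) with
      h1 | ⟨U', V', η, hη, h1, h2, h3⟩
    · have := h1.comp (tendsto_neg_nhdsGT (a := S))
      simpa [Function.comp_def] using this
    · have h4 := h1.reflect_abs_Ioo
      have := hmax _ _ (Ioo (-(-S + η)) (- -T)) isOpen_Ioo ordConnected_Ioo
        ⟨by linarith [hτ.1], by linarith [hτ.2]⟩ h4 (by rw [h2 hτr]; simpa using hU)
        (by rw [h3 hτr]; simpa using hV)
      have := this (show S ∈ Ioo (-(-S + η)) (- -T) from ⟨by linarith, by linarith⟩)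
      exact absurd this.1 (lt_irrefl _)
  · rcases h.tendsto_or_extend continuous_abs hST (fun t _ => abs_nonneg t) with
      h1 | ⟨U', V', η, hη, h1, h2, h3⟩
    · exact h1
    · have := hmax _ _ (Ioo S (T + η)) isOpen_Ioo ordConnected_Ioo
        ⟨hτ.1, by linarith [hτ.2]⟩ h1 (by rw [h2 hτ, hU]) (by rw [h3 hτ, hV])
      have := this (show T ∈ Ioo S (T + η) from ⟨hST, by linarith⟩)
      exact absurd this.2 (lt_irrefl _)

theorem exists_blowUp_family : ∃ (U V : ℝ × ℝ → ℝ → ℝ) (S T : ℝ × ℝ → ℝ), ∀ p,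
    BlowUp (U p) (V p) (S p) (T p) ∧ p.1 ∈ Ioo (S p) (T p) ∧ U p p.1 = p.2 ∧ V p p.1 = 0 := by
  choose U V S T h using fun p : ℝ × ℝ => exists_blowUp p.1 p.2 0
  exact ⟨U, V, S, T, h⟩

/-- The solution with minimum value `p.2` attained at `p.1`. -/
noncomputable def minU : ℝ × ℝ → ℝ → ℝ := exists_blowUp_family.choose

/-- The derivative of `minU`. -/
noncomputable def minV : ℝ × ℝ → ℝ → ℝ := exists_blowUp_family.choose_spec.choose

/-- The left blow-up time of the solution with minimum value `p.2` attained at `p.1`. -/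
noncomputable def leftTime : ℝ × ℝ → ℝ := exists_blowUp_family.choose_spec.choose_spec.choose

/-- The right blow-up time of the solution with minimum value `p.2` attained at `p.1`. -/
noncomputable def rightTime : ℝ × ℝ → ℝ :=
  exists_blowUp_family.choose_spec.choose_spec.choose_spec.choose

lemma min_spec (p : ℝ × ℝ) : BlowUp (minU p) (minV p) (leftTime p) (rightTime p) ∧
    p.1 ∈ Ioo (leftTime p) (rightTime p) ∧ minU p p.1 = p.2 ∧ minV p p.1 = 0 :=
  exists_blowUp_family.choose_spec.choose_spec.choose_spec.choose_spec p

lemma leftTime_eq (p : ℝ × ℝ) : leftTime p = -rightTime (-p.1, p.2) := by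
  obtain ⟨h, hp, hU, hV⟩ := min_spec p
  obtain ⟨h', hp', hU', hV'⟩ := min_spec (-p.1, p.2)
  have := h.reflect.right_unique h' (τ := -p.1) ⟨by linarith [hp.2], by linarith [hp.1]⟩ hp'
    (by simpa [hU] using hU'.symm) (by simpa [hV] using hV'.symm)
  linarith

theorem exists_nearby_min (p₀ : ℝ × ℝ) {α β ε : ℝ} (hα : leftTime p₀ < α) (hβ : β < rightTime p₀)
    (hp : p₀.1 ∈ Ioo α β) (hε : 0 < ε) :
    ∀ᶠ p in 𝓝 p₀, p.1 ∈ Ioo α β ∧ leftTime p < α ∧ β < rightTime p ∧ ∀ t ∈ Icc α β,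
      |minU p t - minU p₀ t| < ε ∧ |minV p t - minV p₀ t| < ε := by
  obtain ⟨h, hp₀, hU, hV⟩ := min_spec p₀
  obtain ⟨δ, hδ, H⟩ := (h.sol.mono (s' := Icc α β) fun x hx => ⟨hα.trans_le hx.1,
    hx.2.trans_lt hβ⟩).exists_nearby continuous_abs (Ioo_subset_Icc_self hp) hε
  have hα' : ∀ᶠ p : ℝ × ℝ in 𝓝 p₀, p.1 ∈ Ioo α β :=
    continuous_fst.continuousAt.eventually_mem (isOpen_Ioo.mem_nhds hp)
  filter_upwards [hα', Metric.ball_mem_nhds p₀ hδ] with p hpI hpb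
  rw [Metric.mem_ball, Prod.dist_eq, max_lt_iff, Real.dist_eq, Real.dist_eq] at hpb
  obtain ⟨U', V', η, hη, h', e1, e2, h3⟩ := H p.1 (Ioo_subset_Icc_self hpI) p.2 0 hpb.1
    (by rw [hU]; exact hpb.2) (by simpa [hV] using hδ)
  obtain ⟨k, hkp, kU, kV⟩ := min_spec p
  have h'' : Sol abs U' V' (Icc α β) := h'.mono fun x hx => ⟨by linarith [hx.1], by linarith [hx.2]⟩
  have hr : β < rightTime p := k.lt_right hkp (h''.mono (Icc_subset_Icc_left hpI.1.le))
    (kU.trans e1.symm) (kV.trans e2.symm)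
  have hl : -α < -leftTime p := by
    have h4 := h''.reflect
    simp only [abs_neg] at h4
    exact k.reflect.lt_right (τ := -p.1) ⟨by linarith [hkp.2], by linarith [hkp.1]⟩
      (h4.mono fun x hx => ⟨by linarith [hx.2], by linarith [hx.1, hpI.2]⟩)
      (by simpa using kU.trans e1.symm) (by simpa using kV.trans e2.symm)
  refine ⟨hpI, by linarith, hr, fun t ht => ?_⟩
  have := Sol.eqOn_Icc h'' (k.sol.mono fun x hx => ⟨by linarith [hx.1], by linarith [hx.2]⟩)
    (Ioo_subset_Icc_self hpI) (e1.trans kU.symm) (e2.trans kV.symm) ht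
  rw [← this.1, ← this.2]
  exact h3 t ht

theorem continuous_rightTime : Continuous rightTime := by
  rw [continuous_iff_continuousAt]
  intro p₀
  obtain ⟨h, hp₀, hU, hV⟩ := min_spec p₀
  obtain ⟨α, hα, hα'⟩ := exists_between hp₀.1
  rw [ContinuousAt, tendsto_order]
  constructor
  · intro c hc
    obtain ⟨β, hβ, hβ'⟩ := exists_between (max_lt hc hp₀.2)
    filter_upwards [exists_nearby_min p₀ hα hβ' ⟨hα', (le_max_right _ _).trans_lt hβ⟩ one_pos]
      with p hp
    exact (le_max_left _ _).trans_lt (hβ.trans hp.2.2.1)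
  · intro c hc
    -- Chosen so that a nondecreasing solution above `κ²` blows up within half of the distance from
    -- `rightTime p₀` to `c`. The original solution exceeds `κ² + 1` at `β`, so nearby ones exceed
    -- `κ²` there.
    set κ := 3 / ((c - rightTime p₀) / 2)
    have hc' : 0 < c - rightTime p₀ := by linarith
    have hκ : 0 < κ := by positivity
    have e : 3 / κ = (c - rightTime p₀) / 2 := by simp only [κ]; field_simp
    obtain ⟨β, hβ, hβ'⟩ := ((h.right.eventually_gt_atTop (κ ^ 2 + 1)).and
      (Ioo_mem_nhdsLT hp₀.2)).exists
    filter_upwards [exists_nearby_min p₀ hα hβ'.2 ⟨hα', hβ'.1⟩ one_pos] with p hp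
    obtain ⟨k, hkp, kU, kV⟩ := min_spec p
    obtain ⟨hpI, hl, hr, H⟩ := hp
    have hβI : β ∈ Ioo (leftTime p) (rightTime p) := ⟨hkp.1.trans hpI.2, hr⟩
    have h1 := (abs_lt.1 (H β ⟨(hα'.trans hβ'.1).le, le_rfl⟩).1).1
    have h2 : 0 ≤ minV p β := kV ▸ k.sol.monotoneOn_abs hkp hβI hpI.2.le
    have := k.right_le hβI hκ (by linarith) h2
    linarith [hβ'.2]

theorem continuous_leftTime : Continuous leftTime := by
  have : leftTime = fun p => -rightTime (-p.1, p.2) := funext leftTime_eq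
  rw [this]
  exact (continuous_rightTime.comp (by fun_prop)).neg

/-- Minima of large absolute value give short lifetimes. This is what forces the interval of
existence to shrink as `|m| → ∞`. -/
lemma rightTime_le {κ τ m : ℝ} (hκ : 0 < κ) (hm : |m| = κ ^ 2) :
    rightTime (τ, m) ≤ τ + 7 / κ := by
  obtain ⟨h, hp, hU, hV⟩ := min_spec (τ, m)
  simp only at hp hU hV
  rcases le_total 0 m with h0 | h0
  · rw [abs_of_nonneg h0] at hm
    have := h.right_le hp hκ (by rw [hU, hm]) hV.ge
    have : 3 / κ ≤ 7 / κ := by gcongr; norm_num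
    linarith
  · rw [abs_of_nonpos h0] at hm
    by_contra! hlt
    exact Sol.not_of_deep_min hκ (h.sol.mono fun y hy => ⟨hp.1.trans_le hy.1, hy.2.trans_lt hlt⟩)
      (by rw [hU]; linarith) hV

lemma le_leftTime {κ τ m : ℝ} (hκ : 0 < κ) (hm : |m| = κ ^ 2) :
    τ - 7 / κ ≤ leftTime (τ, m) := by
  rw [leftTime_eq]
  have := rightTime_le hκ hm (τ := -τ)
  simp only
  linarith

/-- On `[τ, τ/2]` the forcing is at least `-τ/2`, which raises `U` from `m` by at least `(-τ)³/16`,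
so `U ≥ 1` at `τ/2` and `3` more units suffice. Reflected, this shows that moving the minimum far to
the right moves the left blow-up point past any `t₀`. -/
lemma rightTime_le_half {τ m : ℝ} (hτ : τ < 0) (hm : 1 ≤ m + (-τ) ^ 3 / 16) :
    rightTime (τ, m) ≤ τ / 2 + 3 := by
  obtain ⟨h, hp, hU, hV⟩ := min_spec (τ, m)
  simp only at hp hU hV
  by_contra! hlt
  have h1 : Sol abs (minU (τ, m)) (minV (τ, m)) (Icc τ (τ / 2 + 3 / 1)) :=
    h.sol.mono fun y hy => ⟨hp.1.trans_le hy.1, by linarith [hy.2]⟩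
  have h2 := (h1.mono (Icc_subset_Icc_right (by linarith : τ / 2 ≤ _))).quadratic_lower
    (c := -τ / 2) (by linarith) (fun t ht => by
      rw [abs_of_nonpos (by linarith [ht.2])]
      nlinarith [sq_nonneg (minU (τ, m) t), ht.2])
  rw [hU, hV] at h2
  refine Sol.not_of_large (a := τ / 2) one_pos (h1.mono (Icc_subset_Icc_left (by linarith))) ?_ ?_
  · nlinarith
  · rw [← hV]
    exact h1.monotoneOn_abs ⟨le_rfl, by linarith⟩ ⟨by linarith, by linarith⟩ (by linarith)

lemma exists_lt_leftTime (t₀ m : ℝ) : ∃ τ > t₀, t₀ < leftTime (τ, m) := by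
  set w := 16 + |m| + 2 * |t₀|
  have hw : 16 ≤ w := by simp only [w]; linarith [abs_nonneg m, abs_nonneg t₀]
  have h0 := le_abs_self t₀
  have h1 := neg_abs_le m
  have h2 := abs_nonneg t₀
  have h3 := abs_nonneg m
  refine ⟨w, by simp only [w]; linarith, ?_⟩
  rw [leftTime_eq]
  have hw3 : 256 * w ≤ w ^ 3 := by nlinarith [mul_self_nonneg (w - 16)]
  have := rightTime_le_half (τ := -w) (m := m) (by linarith) (by rw [neg_neg]; linarith)
  simp only
  linarith

end

/-! ### Asymptotics at a blow-up point. -/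

section

variable {U V U₁ V₁ U₂ V₂ : ℝ → ℝ} {s s' : Set ℝ}

lemma nonneg_of_tendsto_zero {f f' : ℝ → ℝ} {a c : ℝ} (hf : ∀ t ∈ Ioo a c, HasDerivAt f (f' t) t)
    (h0 : ∀ t ∈ Ioo a c, 0 ≤ f' t) (hlim : Tendsto f (𝓝[>] a) (𝓝 0)) {t : ℝ}
    (ht : t ∈ Ioo a c) : 0 ≤ f t := by
  have hm := monotoneOn_of_hasDerivAt hf h0
  refine le_of_tendsto hlim ?_
  filter_upwards [Ioo_mem_nhdsGT ht.1] with x hx using hm ⟨hx.1, hx.2.trans ht.2⟩ ht hx.2.le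

lemma deriv_nonpos_of_pos_left {f : ℝ → ℝ} {f' a b : ℝ} (hab : a < b) (hf : HasDerivAt f f' b)
    (hpos : ∀ t ∈ Ioo a b, 0 < f t) (hb : f b = 0) : f' ≤ 0 := by
  by_contra! hlt
  have h1 : Tendsto (slope f b) (𝓝[<] b) (𝓝 f') :=
    (hasDerivAt_iff_tendsto_slope.1 hf).mono_left (nhdsWithin_mono b fun x hx => ne_of_lt hx)
  obtain ⟨x, hx1, hx2⟩ := ((h1.eventually_const_lt hlt).and (Ioo_mem_nhdsLT hab)).exists
  rw [slope_def_field, hb, sub_zero] at hx1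
  have := div_neg_of_pos_of_neg (hpos x hx2) (by linarith [hx2.2] : x - b < 0)
  linarith

lemma exists_first_zero {f : ℝ → ℝ} {a b : ℝ} (hab : a ≤ b) (hf : ContinuousOn f (Icc a b))
    (ha : 0 < f a) (hb : f b ≤ 0) : ∃ z ∈ Ioc a b, f z = 0 ∧ ∀ t ∈ Ico a z, 0 < f t := by
  set Z := {t ∈ Icc a b | f t = 0}
  obtain ⟨z₀, hz₀, e₀⟩ := intermediate_value_Icc' hab hf ⟨hb, ha.le⟩
  have hZc : IsClosed Z := by
    have := hf.preimage_isClosed_of_isClosed isClosed_Icc (isClosed_singleton (x := (0 : ℝ)))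
    exact this
  have hZb : BddBelow Z := ⟨a, fun t ht => ht.1.1⟩
  have hz := hZc.csInf_mem ⟨z₀, hz₀, e₀⟩ hZb
  set z := sInf Z
  have haz : a < z := lt_of_le_of_ne hz.1.1 fun h => by
    have := hz.2
    rw [← h] at this
    exact ha.ne' this
  refine ⟨z, ⟨haz, hz.1.2⟩, hz.2, fun t ht => ?_⟩
  by_contra! hle
  obtain ⟨y, hy, e⟩ := intermediate_value_Icc' ht.1
    (hf.mono (Icc_subset_Icc_right (ht.2.le.trans hz.1.2))) ⟨hle, ha.le⟩
  have : z ≤ y := csInf_le hZb ⟨⟨hy.1, hy.2.trans (ht.2.le.trans hz.1.2)⟩, e⟩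
  linarith [hy.2, ht.2]

/-- Near a left blow-up point the energy defect `V² - 4U³` grows at most linearly in `U`. -/
lemma BlowUp.exists_energy_bound {S T : ℝ} (h : BlowUp U V S T) : ∃ c ∈ Ioo S T, ∃ C > 0,
    ∀ t ∈ Ioo S c, V t < 0 ∧ 1 ≤ U t ∧ |V t ^ 2 - 4 * U t ^ 3| ≤ C * U t := by
  obtain ⟨c₀, hc₀⟩ : ∃ c, c ∈ Ioo S T := exists_between h.lt
  obtain ⟨c₁, hc₁, hV₁⟩ := h.exists_deriv_neg hc₀
  have hc₁T : c₁ < T := hc₁.2.trans hc₀.2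
  obtain ⟨c, hcU, hc⟩ := mem_nhdsGT_iff_exists_Ioc_subset.1
    ((h.left.eventually_ge_atTop 1).and (Ioo_mem_nhdsGT hc₁.1))
  have hSc : S < c := hcU
  have hcc : c < c₁ := (hc ⟨hSc, le_rfl⟩).2.2
  have hVneg : ∀ t ∈ Ioc S c, V t < 0 := fun t ht =>
    (h.sol.monotoneOn_abs ⟨ht.1, ht.2.trans_lt (hcc.trans hc₁T)⟩ ⟨hc₁.1, hc₁T⟩
      (ht.2.trans hcc.le)).trans_lt hV₁
  set A := max |S| |T|
  have hA0 : 0 ≤ A := (abs_nonneg _).trans (le_max_left _ _)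
  set Q := V c ^ 2 - 4 * U c ^ 3
  have hUc : 1 ≤ U c := (hc ⟨hSc, le_rfl⟩).1
  refine ⟨c, ⟨hSc, hcc.trans hc₁T⟩, 2 * A + |Q| + 2 * A * U c + 1, by positivity, fun t ht => ?_⟩
  have hU1 : 1 ≤ U t := (hc ⟨ht.1, ht.2.le⟩).1
  refine ⟨hVneg t ⟨ht.1, ht.2.le⟩, hU1, ?_⟩
  have hsub : ∀ x ∈ Icc t c, x ∈ Ioc S c := fun x hx => ⟨ht.1.trans_le hx.1, hx.2⟩
  -- As `V < 0`, this derivative lies between `2AV` and `0`, so the variation of the energy is at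
  -- most `2A` times that of `U`.
  have hder : ∀ x ∈ Icc t c, HasDerivAt (fun x => V x ^ 2 - 4 * U x ^ 3) (2 * V x * |x|) x := by
    intro x hx
    obtain ⟨h1, h2⟩ := h.sol x ⟨(hsub x hx).1, (hsub x hx).2.trans_lt (hcc.trans hc₁T)⟩
    refine ((h2.pow 2).sub ((h1.pow 3).const_mul 4)).congr_deriv ?_
    norm_num
    ring
  have habs : ∀ x ∈ Icc t c, |x| ≤ A := fun x hx =>
    abs_le_max_abs_abs (hsub x hx).1.le ((hsub x hx).2.trans (hcc.trans hc₁T).le)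
  have e1 := le_of_hasDerivAt_nonneg (f := fun x => -(V x ^ 2 - 4 * U x ^ 3))
    (f' := fun x => -(2 * V x * |x|)) ht.2.le (fun x hx => (hder x hx).neg)
    (fun x hx => by nlinarith [hVneg x (hsub x hx), abs_nonneg x])
  have e2 := le_of_hasDerivAt_nonneg (f := fun x => (V x ^ 2 - 4 * U x ^ 3) - 2 * A * U x)
    (f' := fun x => (2 * V x * |x|) - 2 * A * V x) ht.2.le
    (fun x hx => (hder x hx).sub ((h.sol x ⟨(hsub x hx).1,
      (hsub x hx).2.trans_lt (hcc.trans hc₁T)⟩).1.const_mul (2 * A)))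
    (fun x hx => by nlinarith [hVneg x (hsub x hx), habs x hx])
  have e3 := neg_abs_le Q
  have e4 := le_abs_self Q
  have e5 : 0 ≤ A * U c := by positivity
  have e6 : (|Q| + 2 * A * U c + 1) * 1 ≤ (|Q| + 2 * A * U c + 1) * U t :=
    mul_le_mul_of_nonneg_left hU1 (by positivity)
  have e7 : 0 ≤ A * U t := by positivity
  rw [abs_le]
  constructor <;> nlinarith

/-- At a left blow-up point `U` equals `(t - S)⁻²` up to a vanishing error. -/
theorem BlowUp.tendsto_sub_left {S T : ℝ} (h : BlowUp U V S T) :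
    Tendsto (fun t => U t - ((t - S) ^ 2)⁻¹) (𝓝[>] S) (𝓝 0) := by
  obtain ⟨c₀, hc₀, C, hC, H⟩ := h.exists_energy_bound
  -- `ρ` vanishes at `S`, and its derivative `q` satisfies `q² - 1 = (V² - 4U³) / (4U³) = O(ρ⁴)`.
  -- Hence `ρ` is comparable to `t - S`, then `ρ = (t - S) + O((t - S)⁵)`, and `U = ρ⁻²` differs
  -- from `(t - S)⁻²` by `O((t - S)²)`.
  set ρ : ℝ → ℝ := fun t => (√(U t))⁻¹
  set q : ℝ → ℝ := fun t => -V t / (2 * (U t * √(U t)))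
  have hρ : ∀ t ∈ Ioo S c₀, 0 < ρ t ∧ HasDerivAt ρ (q t) t ∧ |q t - 1| ≤ C * ρ t ^ 4 ∧
      U t = (ρ t ^ 2)⁻¹ := by
    intro t ht
    obtain ⟨hV, hU, hQ⟩ := H t ht
    have hU0 : 0 < U t := by linarith
    have hs : 0 < √(U t) := Real.sqrt_pos.2 hU0
    have hsq : √(U t) ^ 2 = U t := Real.sq_sqrt hU0.le
    refine ⟨by positivity, ?_, ?_, by simp only [ρ]; rw [inv_pow, hsq, inv_inv]⟩
    · refine ((((h.sol t ⟨ht.1, ht.2.trans hc₀.2⟩).1).sqrt hU0.ne').inv hs.ne').congr_deriv ?_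
      simp only [q]
      rw [hsq]
      field_simp
    · have hq0 : 0 < q t := div_pos (by linarith) (by positivity)
      have e1 : q t ^ 2 - 1 = (V t ^ 2 - 4 * U t ^ 3) / (4 * U t ^ 3) := by
        simp only [q]
        rw [div_pow, mul_pow, mul_pow, hsq]
        field_simp
        ring
      have e2 : |q t ^ 2 - 1| ≤ C * ρ t ^ 4 := by
        rw [e1, abs_div, abs_of_pos (show 0 < 4 * U t ^ 3 by positivity)]
        have : ρ t ^ 4 = (U t ^ 2)⁻¹ := by
          simp only [ρ]
          rw [inv_pow, show (4 : ℕ) = 2 * 2 by norm_num, pow_mul, hsq]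
        rw [this, div_le_iff₀ (by positivity)]
        calc _ ≤ C * U t := hQ
          _ ≤ 4 * (C * U t) := by nlinarith [mul_pos hC hU0]
          _ = _ := by field_simp
      calc |q t - 1| ≤ |q t - 1| * (q t + 1) := by
            nlinarith [abs_nonneg (q t - 1)]
        _ = |q t ^ 2 - 1| := by
            rw [show q t ^ 2 - 1 = (q t - 1) * (q t + 1) by ring, abs_mul,
              abs_of_pos (show 0 < q t + 1 by linarith)]
        _ ≤ _ := e2
  have hlim : Tendsto ρ (𝓝[>] S) (𝓝 0) :=
    tendsto_inv_atTop_zero.comp (Real.tendsto_sqrt_atTop.comp h.left)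
  have hlim4 : Tendsto (fun t => C * ρ t ^ 4) (𝓝[>] S) (𝓝 0) := by
    simpa using (hlim.pow 4).const_mul C
  obtain ⟨c, hSc, hc⟩ := mem_nhdsGT_iff_exists_Ioo_subset.1
    ((hlim4.eventually_le_const (show (0 : ℝ) < 1 / 2 by norm_num)).and
      (Ioo_mem_nhdsGT hc₀.1))
  have hs0 : ∀ k : ℕ, k ≠ 0 → Tendsto (fun t : ℝ => (t - S) ^ k) (𝓝[>] S) (𝓝 0) := by
    intro k hk
    have : Tendsto (fun t : ℝ => (t - S) ^ k) (𝓝 S) (𝓝 ((S - S) ^ k)) :=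
      Continuous.tendsto (by fun_prop) S
    simpa [hk] using this.mono_left nhdsWithin_le_nhds
  have hs1 : Tendsto (fun t : ℝ => t - S) (𝓝[>] S) (𝓝 0) := by simpa using hs0 1 one_ne_zero
  have hder : ∀ t, HasDerivAt (fun t : ℝ => t - S) 1 t := fun t => (hasDerivAt_id t).sub_const S
  have up : ∀ t ∈ Ioo S c, ρ t ≤ 2 * (t - S) := by
    intro t ht
    have := nonneg_of_tendsto_zero (f := fun t => 2 * (t - S) - ρ t) (f' := fun t => 2 * 1 - q t)
      (fun t ht => ((hder t).const_mul 2).sub (hρ t (hc ht).2).2.1)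
      (fun t ht => by
        have := (hρ t (hc ht).2).2.2.1.trans (hc ht).1
        linarith [(abs_le.1 this).2])
      (by simpa using (hs1.const_mul 2).sub hlim) ht
    linarith
  have lo : ∀ t ∈ Ioo S c, (t - S) / 2 ≤ ρ t := by
    intro t ht
    have := nonneg_of_tendsto_zero (f := fun t => ρ t - (t - S) / 2) (f' := fun t => q t - 1 / 2)
      (fun t ht => (hρ t (hc ht).2).2.1.sub ((hder t).div_const 2))
      (fun t ht => by
        have := (hρ t (hc ht).2).2.2.1.trans (hc ht).1
        linarith [(abs_le.1 this).1])
      (by simpa using hlim.sub (hs1.div_const 2)) ht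
    linarith
  have qb : ∀ t ∈ Ioo S c, |q t - 1| ≤ 16 * C * (t - S) ^ 4 := by
    intro t ht
    have h1 := (hρ t (hc ht).2)
    have h2 : ρ t ^ 4 ≤ (2 * (t - S)) ^ 4 := pow_le_pow_left₀ h1.1.le (up t ht) 4
    calc _ ≤ C * ρ t ^ 4 := h1.2.2.1
      _ ≤ C * (2 * (t - S)) ^ 4 := by gcongr
      _ = _ := by ring
  have hpow : ∀ t, HasDerivAt (fun t : ℝ => (t - S) ^ 5) (5 * (t - S) ^ 4 * 1) t := fun t => by
    simpa using! (hder t).pow 5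
  have close : ∀ t ∈ Ioo S c, |t - S - ρ t| ≤ 16 * C * (t - S) ^ 5 := by
    intro t ht
    have hn : ∀ x ∈ Ioo S c, 0 ≤ C * (x - S) ^ 4 := fun x _ => by positivity
    have h1 := nonneg_of_tendsto_zero (f := fun t => (t - S - ρ t) + 16 * C * (t - S) ^ 5)
      (f' := fun t => (1 - q t) + 16 * C * (5 * (t - S) ^ 4 * 1))
      (fun t ht => ((hder t).sub (hρ t (hc ht).2).2.1).add ((hpow t).const_mul _))
      (fun t ht => by
        have := (abs_le.1 (qb t ht)).2
        linarith [hn t ht])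
      (by simpa using (hs1.sub hlim).add ((hs0 5 (by norm_num)).const_mul (16 * C))) ht
    have h2 := nonneg_of_tendsto_zero (f := fun t => 16 * C * (t - S) ^ 5 - (t - S - ρ t))
      (f' := fun t => 16 * C * (5 * (t - S) ^ 4 * 1) - (1 - q t))
      (fun t ht => ((hpow t).const_mul _).sub ((hder t).sub (hρ t (hc ht).2).2.1))
      (fun t ht => by
        have := (abs_le.1 (qb t ht)).1
        linarith [hn t ht])
      (by simpa using ((hs0 5 (by norm_num)).const_mul (16 * C)).sub (hs1.sub hlim)) ht
    rw [abs_le]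
    constructor <;> linarith
  have final : ∀ t ∈ Ioo S c, |U t - ((t - S) ^ 2)⁻¹| ≤ 192 * C * (t - S) ^ 2 := by
    intro t ht
    have hst : 0 < t - S := by linarith [ht.1]
    obtain ⟨hρ0, -, -, hUρ⟩ := hρ t (hc ht).2
    have e : U t - ((t - S) ^ 2)⁻¹ =
        (t - S - ρ t) * ((t - S + ρ t) / (ρ t ^ 2 * (t - S) ^ 2)) := by
      rw [hUρ]; field_simp; ring
    have h1 : (t - S + ρ t) / (ρ t ^ 2 * (t - S) ^ 2) ≤ 12 / (t - S) ^ 3 := by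
      rw [div_le_div_iff₀ (by positivity) (by positivity)]
      have h2 : ((t - S) / 2) ^ 2 ≤ ρ t ^ 2 := pow_le_pow_left₀ (by positivity) (lo t ht) 2
      have h3 : t - S + ρ t ≤ 3 * (t - S) := by linarith [up t ht]
      calc (t - S + ρ t) * (t - S) ^ 3 ≤ 3 * (t - S) * (t - S) ^ 3 := by gcongr
        _ = 12 * (((t - S) / 2) ^ 2 * (t - S) ^ 2) := by ring
        _ ≤ _ := by gcongr
    have h0 : 0 ≤ (t - S + ρ t) / (ρ t ^ 2 * (t - S) ^ 2) := by positivity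
    rw [e, abs_mul, abs_of_nonneg h0]
    calc _ ≤ 16 * C * (t - S) ^ 5 * (12 / (t - S) ^ 3) :=
          mul_le_mul (close t ht) h1 h0 (by positivity)
      _ = _ := by field_simp; ring
  apply squeeze_zero_norm' (a := fun t => 192 * C * (t - S) ^ 2)
  · filter_upwards [Ioo_mem_nhdsGT hSc] with t ht using final t ht
  · simpa using (hs0 2 two_ne_zero).const_mul (192 * C)

/-- The singular parts depend only on `S` and cancel. This replaces an initial condition at the
singular point in all the comparisons below. -/
lemma BlowUp.tendsto_diff_left {S T₁ T₂ : ℝ} (h₁ : BlowUp U₁ V₁ S T₁) (h₂ : BlowUp U₂ V₂ S T₂) :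
    Tendsto (fun t => U₂ t - U₁ t) (𝓝[>] S) (𝓝 0) := by
  simpa using h₂.tendsto_sub_left.sub h₁.tendsto_sub_left

lemma BlowUp.tendsto_diff_right {S₁ S₂ T : ℝ} (h₁ : BlowUp U₁ V₁ S₁ T) (h₂ : BlowUp U₂ V₂ S₂ T) :
    Tendsto (fun t => U₂ t - U₁ t) (𝓝[<] T) (𝓝 0) := by
  have := (h₁.reflect.tendsto_diff_left h₂.reflect).comp (tendsto_neg_nhdsLT (a := T))
  simpa [Function.comp_def] using this

end

/-! ### Order of solutions with a common left blow-up point `t₀ ≥ 0`. -/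

section

variable {U V U₁ V₁ U₂ V₂ : ℝ → ℝ} {s s' : Set ℝ} {t₀ T T₁ T₂ : ℝ}

lemma BlowUp.strictMonoOn_deriv (h : BlowUp U V t₀ T) (ht₀ : 0 ≤ t₀) :
    StrictMonoOn V (Ioo t₀ T) :=
  strictMonoOn_of_hasDerivAt (fun t ht => (h.sol t ht).2) fun t ht => by
    have := (interior_subset ht).1
    have : 0 < |t| := abs_pos.2 (by linarith)
    positivity

lemma BlowUp.min_le (h : BlowUp U V t₀ T) {τ t : ℝ} (hτ : τ ∈ Ioo t₀ T) (hV : V τ = 0)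
    (ht : t ∈ Ioo t₀ T) : U τ ≤ U t := by
  have hm := h.sol.monotoneOn_abs
  rcases le_total τ t with hle | hle
  · exact le_of_hasDerivAt_nonneg hle (fun x hx => (h.sol x ⟨hτ.1.trans_le hx.1,
      hx.2.trans_lt ht.2⟩).1) fun x hx => hV ▸ hm hτ ⟨hτ.1.trans_le hx.1,
      hx.2.trans_lt ht.2⟩ hx.1
  · have := le_of_hasDerivAt_nonneg (f := fun x => -U x) (f' := fun x => -V x) hle
      (fun x hx => (h.sol x ⟨ht.1.trans_le hx.1, hx.2.trans_lt hτ.2⟩).1.neg) fun x hx => by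
        have := hm ⟨ht.1.trans_le hx.1, hx.2.trans_lt hτ.2⟩ hτ hx.2
        linarith
    linarith

/-- Twice the energy difference of two solutions. -/
def energyDiff (U₁ V₁ U₂ V₂ : ℝ → ℝ) (t : ℝ) : ℝ :=
  V₁ t ^ 2 - V₂ t ^ 2 - 4 * (U₁ t ^ 3 - U₂ t ^ 3) - 2 * t * (U₁ t - U₂ t)

/-- For `t ≥ 0` the quantity `V² - 4U³ - 2tU` has derivative `-2U`, so the sign of the derivative of
the difference only sees which solution is larger. -/
lemma hasDerivAt_energyDiff {t : ℝ} (ht : 0 ≤ t) (h₁ : Sol abs U₁ V₁ {t})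
    (h₂ : Sol abs U₂ V₂ {t}) :
    HasDerivAt (energyDiff U₁ V₁ U₂ V₂) (2 * (U₂ t - U₁ t)) t := by
  obtain ⟨a1, b1⟩ := h₁ t rfl
  obtain ⟨a2, b2⟩ := h₂ t rfl
  unfold energyDiff
  refine ((((b1.pow 2).sub (b2.pow 2)).sub (((a1.pow 3).sub (a2.pow 3)).const_mul 4)).sub
    (((hasDerivAt_id t).const_mul 2).mul (a1.sub a2))).congr_deriv ?_
  rw [abs_of_nonneg ht]
  simp
  ring

/-- Among two solutions with the same left blow-up point, the smaller one has more energy. -/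
theorem BlowUp.energyDiff_pos (ht₀ : 0 ≤ t₀) (h₁ : BlowUp U₁ V₁ t₀ T₁) (h₂ : BlowUp U₂ V₂ t₀ T₂)
    {b t : ℝ} (hb₁ : b < T₁) (hb₂ : b < T₂) (hlt : ∀ x ∈ Ioo t₀ b, U₁ x < U₂ x)
    (ht : t ∈ Ioc t₀ b) : 0 < energyDiff U₁ V₁ U₂ V₂ t := by
  obtain ⟨c₁, hc₁, C₁, -, H₁⟩ := h₁.exists_energy_bound
  obtain ⟨c₂, hc₂, C₂, -, H₂⟩ := h₂.exists_energy_bound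
  obtain ⟨c, hc, hc'⟩ : ∃ c, t₀ < c ∧ c < min (min c₁ c₂) t :=
    exists_between (lt_min (lt_min hc₁.1 hc₂.1) ht.1)
  have hcc := lt_min_iff.1 hc'
  have hcc' := lt_min_iff.1 hcc.1
  have hcb : c < b := hcc.2.trans_le ht.2
  obtain ⟨x, hx1, hx2⟩ := (((h₁.tendsto_diff_left h₂).eventually_lt_const
    (sub_pos.2 (hlt c ⟨hc, hcb⟩))).and (Ioo_mem_nhdsGT hc)).exists
  have hsub : ∀ y ∈ Icc x t, y ∈ Ioo t₀ T₁ ∧ y ∈ Ioo t₀ T₂ := fun y hy =>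
    ⟨⟨hx2.1.trans_le hy.1, (hy.2.trans ht.2).trans_lt hb₁⟩,
      ⟨hx2.1.trans_le hy.1, (hy.2.trans ht.2).trans_lt hb₂⟩⟩
  have hder : ∀ y ∈ Icc x t, HasDerivAt (fun y => U₂ y - U₁ y) (V₂ y - V₁ y) y := fun y hy =>
    (h₂.sol y (hsub y hy).2).1.sub (h₁.sol y (hsub y hy).1).1
  -- The difference is positive and tends to `0` at `t₀`, so its derivative is positive at some `ξ`
  -- near `t₀`. There both slopes are negative and both solutions are at least `1`, so every term in
  -- the factorization of `energyDiff` is positive. From `ξ` on it does not decrease.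
  obtain ⟨ξ, hξ, e⟩ := exists_hasDerivAt_eq_slope (fun y => U₂ y - U₁ y) (fun y => V₂ y - V₁ y)
    hx2.2 (fun y hy => (hder y ⟨hy.1, hy.2.trans hcc.2.le⟩).continuousAt.continuousWithinAt)
    (fun y hy => hder y ⟨hy.1.le, hy.2.le.trans hcc.2.le⟩)
  have hξd : 0 < V₂ ξ - V₁ ξ := by
    rw [e]
    exact div_pos (by linarith) (by linarith [hx2.2])
  have hξt : ξ < t := hξ.2.trans hcc.2
  have hξ0 : t₀ < ξ := hx2.1.trans hξ.1
  obtain ⟨v1, u1, -⟩ := H₁ ξ ⟨hξ0, hξ.2.trans hcc'.1⟩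
  obtain ⟨v2, u2, -⟩ := H₂ ξ ⟨hξ0, hξ.2.trans hcc'.2⟩
  have hU : 0 < U₂ ξ - U₁ ξ := sub_pos.2 (hlt ξ ⟨hξ0, hξ.2.trans hcb⟩)
  have hpos : 0 < energyDiff U₁ V₁ U₂ V₂ ξ := by
    have e1 : energyDiff U₁ V₁ U₂ V₂ ξ = (-(V₁ ξ + V₂ ξ)) * (V₂ ξ - V₁ ξ) +
        (4 * (U₁ ξ ^ 2 + U₁ ξ * U₂ ξ + U₂ ξ ^ 2) + 2 * ξ) * (U₂ ξ - U₁ ξ) := by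
      unfold energyDiff; ring
    rw [e1]
    have : 0 < ξ := by linarith
    have : 0 < U₁ ξ * U₂ ξ := by positivity
    have : 0 < -(V₁ ξ + V₂ ξ) := by linarith
    positivity
  refine hpos.trans_le (le_of_hasDerivAt_nonneg hξt.le (fun y hy => hasDerivAt_energyDiff
    (by linarith [hy.1]) (h₁.sol.mono ?_) (h₂.sol.mono ?_)) ?_)
  · rintro _ rfl; exact (hsub _ ⟨hξ.1.le.trans hy.1, hy.2⟩).1
  · rintro _ rfl; exact (hsub _ ⟨hξ.1.le.trans hy.1, hy.2⟩).2
  · intro y hy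
    have hy2 := hsub y ⟨hξ.1.le.trans hy.1, hy.2⟩
    rcases lt_or_eq_of_le (hy.2.trans ht.2) with h | rfl
    · linarith [hlt y ⟨hy2.1.1, h⟩]
    · have : t₀ < y := hy2.1.1
      have hle : 0 ≤ U₂ y - U₁ y := by
        have hcont : ContinuousAt (fun y => U₂ y - U₁ y) y :=
          (hder y ⟨hξ.1.le.trans hy.1, hy.2⟩).continuousAt
        refine ge_of_tendsto (hcont.tendsto.mono_left (nhdsWithin_le_nhds (s := Iio y))) ?_
        filter_upwards [Ioo_mem_nhdsLT this] with z hz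
        linarith [hlt z hz]
      linarith

/-- At a first crossing the solution coming from below is increasing and is the steeper one. -/
theorem BlowUp.abs_deriv_lt_of_crossing (ht₀ : 0 ≤ t₀) (h₁ : BlowUp U₁ V₁ t₀ T₁)
    (h₂ : BlowUp U₂ V₂ t₀ T₂) {b : ℝ} (hb₁ : b < T₁) (hb₂ : b < T₂) (hb : t₀ < b)
    (hlt : ∀ x ∈ Ioo t₀ b, U₁ x < U₂ x) (heq : U₁ b = U₂ b) : |V₂ b| < V₁ b := by
  have he := h₁.energyDiff_pos ht₀ h₂ hb₁ hb₂ hlt ⟨hb, le_rfl⟩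
  unfold energyDiff at he
  rw [heq] at he
  -- At the crossing `energyDiff` reduces to `V₁² - V₂² > 0`; together with `V₂ ≤ V₁` this gives `V₁
  -- > |V₂|`.
  have hd := deriv_nonpos_of_pos_left hb (f := fun y => U₂ y - U₁ y)
    ((h₂.sol b ⟨hb, hb₂⟩).1.sub (h₁.sol b ⟨hb, hb₁⟩).1) (fun x hx => sub_pos.2 (hlt x hx))
    (sub_eq_zero.2 heq.symm)
  rw [abs_lt]
  constructor
  · nlinarith
  · refine lt_of_le_of_ne (by linarith) fun h => ?_
    rw [h] at he
    linarith

lemma BlowUp.right_le_of_lt {S₁ S₂ c : ℝ} (h₁ : BlowUp U₁ V₁ S₁ T₁) (h₂ : BlowUp U₂ V₂ S₂ T₂)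
    (hc₁ : c ∈ Ioo S₁ T₁) (hc₂ : c ∈ Ioo S₂ T₂)
    (hlt : ∀ x ∈ Ioo c (min T₁ T₂), U₁ x ≤ U₂ x) : T₂ ≤ T₁ := by
  by_contra! h
  rw [min_eq_left h.le] at hlt
  have hcont := (h₂.sol T₁ ⟨hc₂.1.trans hc₁.2, h⟩).1.continuousAt
  refine not_tendsto_atTop_of_continuousAt (l := 𝓝[<] T₁) nhdsWithin_le_nhds hcont
    (tendsto_atTop_mono' _ ?_ h₁.right)
  filter_upwards [Ioo_mem_nhdsLT hc₁.2] with x hx using hlt x hx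

/-- Two functions ordered near the left end point stay ordered up to a first crossing. -/
lemma exists_first_crossing {f g : ℝ → ℝ} {a b c : ℝ} (hc : c ∈ Ioo a b)
    (hf : ContinuousOn f (Ioo a b)) (hg : ContinuousOn g (Ioo a b))
    (hlt : ∀ x ∈ Ioo a c, f x < g x) :
    (∀ x ∈ Ioo a b, f x < g x) ∨
      ∃ z ∈ Ioo a b, f z = g z ∧ ∀ x ∈ Ioo a z, f x < g x := by
  by_cases hall : ∀ x ∈ Ioo a b, f x < g x
  · exact Or.inl hall
  push Not at hall
  obtain ⟨x, hx, hle⟩ := hall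
  right
  obtain ⟨y, hy⟩ : ∃ y, y ∈ Ioo a c := exists_between hc.1
  have hyx : y < x := by
    by_contra! h
    linarith [hlt x ⟨hx.1, h.trans_lt hy.2⟩]
  obtain ⟨z, hz, e, hpos⟩ := exists_first_zero (f := fun t => g t - f t) hyx.le
    ((hg.sub hf).mono fun t ht => ⟨hy.1.trans_le ht.1, ht.2.trans_lt hx.2⟩)
    (sub_pos.2 (hlt y hy)) (by simpa using hle)
  refine ⟨z, ⟨hy.1.trans hz.1, hz.2.trans_lt hx.2⟩, by linarith [e], fun t ht => ?_⟩
  rcases lt_or_ge t y with h | h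
  · exact hlt t ⟨ht.1, h.trans hy.2⟩
  · exact sub_pos.1 (hpos t ⟨h, ht.2⟩)

/-- Two solutions with the same left blow-up point are ordered near that point, or equal. -/
theorem BlowUp.trichotomy (h₁ : BlowUp U₁ V₁ t₀ T₁) (h₂ : BlowUp U₂ V₂ t₀ T₂) :
    ∃ c, t₀ < c ∧ c < T₁ ∧ c < T₂ ∧ ((∀ t ∈ Ioo t₀ c, U₁ t < U₂ t) ∨
      (∀ t ∈ Ioo t₀ c, U₂ t < U₁ t) ∨ ∀ t ∈ Ioo t₀ c, U₁ t = U₂ t ∧ V₁ t = V₂ t) := by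
  obtain ⟨c₁, hc₁, C₁, -, H₁⟩ := h₁.exists_energy_bound
  obtain ⟨c₂, hc₂, C₂, -, H₂⟩ := h₂.exists_energy_bound
  set c := min c₁ c₂
  have hc : t₀ < c := lt_min hc₁.1 hc₂.1
  have hcT₁ : c < T₁ := (min_le_left _ _).trans_lt hc₁.2
  have hcT₂ : c < T₂ := (min_le_right _ _).trans_lt hc₂.2
  refine ⟨c, hc, hcT₁, hcT₂, ?_⟩
  have hm₁ : ∀ t ∈ Ioo t₀ c, t ∈ Ioo t₀ T₁ := fun t ht => ⟨ht.1, ht.2.trans hcT₁⟩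
  have hm₂ : ∀ t ∈ Ioo t₀ c, t ∈ Ioo t₀ T₂ := fun t ht => ⟨ht.1, ht.2.trans hcT₂⟩
  by_cases hz : ∃ z ∈ Ioo t₀ c, U₁ z = U₂ z
  · right; right
    obtain ⟨z, hz, e⟩ := hz
    -- `F` is half the derivative of the squared difference. It is nondecreasing where the solutions
    -- are positive and vanishes at `z`, so the square is nonincreasing before `z`. Since it tends
    -- to `0` at `t₀`, it vanishes.
    set F : ℝ → ℝ := fun t => (U₂ t - U₁ t) * (V₂ t - V₁ t)
    have hd : ∀ t ∈ Ioo t₀ c, HasDerivAt (fun t => U₂ t - U₁ t) (V₂ t - V₁ t) t := fun t ht =>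
      (h₂.sol t (hm₂ t ht)).1.sub (h₁.sol t (hm₁ t ht)).1
    have hF : MonotoneOn F (Ioo t₀ c) := by
      refine monotoneOn_of_hasDerivAt (f' := fun t => (V₂ t - V₁ t) * (V₂ t - V₁ t) +
        (U₂ t - U₁ t) * ((6 * U₂ t ^ 2 + |t|) - (6 * U₁ t ^ 2 + |t|)))
        (fun t ht => (hd t ht).mul ((h₂.sol t (hm₂ t ht)).2.sub (h₁.sol t (hm₁ t ht)).2)) ?_
      intro t ht
      have u1 := (H₁ t ⟨ht.1, ht.2.trans_le (min_le_left _ _)⟩).2.1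
      have u2 := (H₂ t ⟨ht.1, ht.2.trans_le (min_le_right _ _)⟩).2.1
      have : (U₂ t - U₁ t) * ((6 * U₂ t ^ 2 + |t|) - (6 * U₁ t ^ 2 + |t|)) =
        6 * (U₁ t + U₂ t) * (U₂ t - U₁ t) ^ 2 := by ring
      rw [this, ← sq]
      positivity
    have hzero : ∀ t ∈ Ioo t₀ z, U₂ t - U₁ t = 0 := by
      intro t ht
      have hG : MonotoneOn (fun t => -(U₂ t - U₁ t) ^ 2) (Ioo t₀ z) := by
        refine monotoneOn_of_hasDerivAt (f' := fun t => -(2 * F t)) (fun x hx => ?_) ?_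
        · refine ((hd x ⟨hx.1, hx.2.trans hz.2⟩).pow 2).neg.congr_deriv ?_
          simp [F]
          ring
        · intro x hx
          have := hF ⟨hx.1, hx.2.trans hz.2⟩ hz hx.2.le
          have e0 : F z = 0 := by simp [F, e]
          linarith
      have hlim : Tendsto (fun t => -(U₂ t - U₁ t) ^ 2) (𝓝[>] t₀) (𝓝 0) := by
        simpa using ((h₁.tendsto_diff_left h₂).pow 2).neg
      have : 0 ≤ -(U₂ t - U₁ t) ^ 2 := by
        refine le_of_tendsto hlim ?_
        filter_upwards [Ioo_mem_nhdsGT ht.1] with x hx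
        exact hG ⟨hx.1, hx.2.trans ht.2⟩ ht hx.2.le
      nlinarith [sq_nonneg (U₂ t - U₁ t)]
    obtain ⟨y, hy⟩ : ∃ y, y ∈ Ioo t₀ z := exists_between hz.1
    have hyc : y ∈ Ioo t₀ c := ⟨hy.1, hy.2.trans hz.2⟩
    have hVy : V₂ y - V₁ y = 0 := by
      refine (hd y hyc).unique ((hasDerivAt_const y (0 : ℝ)).congr_of_eventuallyEq ?_)
      filter_upwards [isOpen_Ioo.mem_nhds hy] with x hx using hzero x hx
    intro t ht
    exact Sol.eqOn (s := Ioo t₀ c) (h₁.sol.mono hm₁) (h₂.sol.mono hm₂) hyc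
      (by linarith [hzero y hy]) (by linarith) ht
  · push Not at hz
    have hcont : ContinuousOn (fun t => U₂ t - U₁ t) (Ioo t₀ c) :=
      (h₂.sol.mono hm₂).continuousOn.sub (h₁.sol.mono hm₁).continuousOn
    by_contra! hcon
    obtain ⟨⟨x, hx, hx'⟩, ⟨y, hy, hy'⟩, -⟩ := hcon
    obtain ⟨w, hw, e⟩ := isPreconnected_Ioo.intermediate_value hx hy hcont
      (show (0 : ℝ) ∈ Icc _ _ from ⟨by linarith, by linarith⟩)
    exact hz w hw (by linarith [e])

/-- The energy with the forcing frozen at `k`; the sign of its derivative is read off from the side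
of `k` and the branch of `U`. -/
lemma BlowUp.hasDerivAt_energy {t k : ℝ} (h : BlowUp U V t₀ T) (ht₀ : 0 ≤ t₀) (ht : t ∈ Ioo t₀ T) :
    HasDerivAt (fun t => V t ^ 2 - 4 * U t ^ 3 - 2 * k * U t) (2 * ((t - k) * V t)) t := by
  obtain ⟨a, b⟩ := h.sol t ht
  refine (((b.pow 2).sub ((a.pow 3).const_mul 4)).sub (a.const_mul (2 * k))).congr_deriv ?_
  rw [abs_of_nonneg (by linarith [ht.1])]
  norm_num
  ring

/-- The order near the left blow-up point is the order of the minimum values. -/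
theorem BlowUp.min_lt_min (ht₀ : 0 ≤ t₀) (h₁ : BlowUp U₁ V₁ t₀ T₁) (h₂ : BlowUp U₂ V₂ t₀ T₂)
    {τ₁ τ₂ c : ℝ} (hτ₁ : τ₁ ∈ Ioo t₀ T₁) (hτ₂ : τ₂ ∈ Ioo t₀ T₂) (hV₁ : V₁ τ₁ = 0) (hV₂ : V₂ τ₂ = 0)
    (hc : t₀ < c) (hlt : ∀ t ∈ Ioo t₀ c, U₁ t < U₂ t) : U₁ τ₁ < U₂ τ₂ := by
  obtain ⟨c', hc', hc''⟩ : ∃ c', t₀ < c' ∧ c' < min c (min T₁ T₂) :=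
    exists_between (lt_min hc (lt_min h₁.lt h₂.lt))
  have hcc := lt_min_iff.1 hc''
  rcases exists_first_crossing (f := U₁) (g := U₂) ⟨hc', hcc.2⟩
    (h₁.sol.continuousOn.mono (Ioo_subset_Ioo_right (min_le_left _ _)))
    (h₂.sol.continuousOn.mono (Ioo_subset_Ioo_right (min_le_right _ _)))
    (fun x hx => hlt x ⟨hx.1, hx.2.trans hcc.1⟩) with hall | ⟨b, hb, e, hlt'⟩
  · have hT := h₁.right_le_of_lt h₂ ⟨hc', (lt_min_iff.1 hcc.2).1⟩ ⟨hc', (lt_min_iff.1 hcc.2).2⟩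
      (fun x hx => (hall x ⟨hc'.trans hx.1, hx.2⟩).le)
    rw [min_eq_right hT] at hall
    exact (h₁.min_le hτ₁ hV₁ ⟨hτ₂.1, hτ₂.2.trans_le hT⟩).trans_lt (hall τ₂ hτ₂)
  · have hb' := lt_min_iff.1 hb.2
    have hVb := h₁.abs_deriv_lt_of_crossing ht₀ h₂ hb'.1 hb'.2 hb.1 hlt' e
    have hVb₁ : 0 < V₁ b := (abs_nonneg _).trans_lt hVb
    have hs₁ := h₁.strictMonoOn_deriv ht₀
    have hs₂ := h₂.strictMonoOn_deriv ht₀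
    have hτb : τ₁ < b := (hs₁.lt_iff_lt hτ₁ ⟨hb.1, hb'.1⟩).1 (by rw [hV₁]; exact hVb₁)
    rcases lt_trichotomy τ₂ b with hlt₂ | rfl | hgt
    · exact (h₁.min_le hτ₁ hV₁ ⟨hτ₂.1, hlt₂.trans hb'.1⟩).trans_lt (hlt' τ₂ ⟨hτ₂.1, hlt₂⟩)
    · rw [← e]
      refine lt_of_hasDerivAt_pos hτb (fun x hx => (h₁.sol x ⟨hτ₁.1.trans_le hx.1,
        hx.2.trans_lt hb'.1⟩).1) fun x hx => ?_
      rw [← hV₁]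
      exact hs₁ hτ₁ ⟨hτ₁.1.trans hx.1, hx.2.trans hb'.1⟩ hx.1
    -- The remaining case `τ₁ < b < τ₂`. The energy frozen at `k = b` is nonincreasing along `U₁` on
    -- `[τ₁, b]` and along `U₂` on `[b, τ₂]`. With `V₂ b ^ 2 < V₁ b ^ 2` this compares the
    -- increasing function `4m³ + 2bm` at the two minimum values.
    · have q₁ := le_of_hasDerivAt_nonneg
        (f := fun t => -(V₁ t ^ 2 - 4 * U₁ t ^ 3 - 2 * b * U₁ t)) hτb.le
        (fun x hx => (h₁.hasDerivAt_energy ht₀ ⟨hτ₁.1.trans_le hx.1, hx.2.trans_lt hb'.1⟩).neg)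
        (fun x hx => by
          have : V₁ τ₁ ≤ V₁ x := h₁.sol.monotoneOn_abs hτ₁ ⟨hτ₁.1.trans_le hx.1,
            hx.2.trans_lt hb'.1⟩ hx.1
          nlinarith [hx.2])
      have q₂ := le_of_hasDerivAt_nonneg
        (f := fun t => -(V₂ t ^ 2 - 4 * U₂ t ^ 3 - 2 * b * U₂ t)) hgt.le
        (fun x hx => (h₂.hasDerivAt_energy ht₀ ⟨hb.1.trans_le hx.1, hx.2.trans_lt hτ₂.2⟩).neg)
        (fun x hx => by
          have : V₂ x ≤ V₂ τ₂ := h₂.sol.monotoneOn_abs ⟨hb.1.trans_le hx.1,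
            hx.2.trans_lt hτ₂.2⟩ hτ₂ hx.2
          nlinarith [hx.1])
      simp only [hV₁, hV₂, ← e] at q₁ q₂
      have hsq : V₂ b ^ 2 < V₁ b ^ 2 := sq_lt_sq' (by linarith [(abs_lt.1 hVb).1]) (abs_lt.1 hVb).2
      have hb0 : 0 ≤ b := by linarith [hb.1]
      by_contra! hle
      have : U₂ τ₂ ^ 3 ≤ U₁ τ₁ ^ 3 := (Odd.strictMono_pow (by decide)).monotone hle
      have : b * U₂ τ₂ ≤ b * U₁ τ₁ := mul_le_mul_of_nonneg_left hle hb0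
      linarith

/-- The increasing branch is at most as long as the decreasing one. -/
theorem BlowUp.right_sub_min_le (ht₀ : 0 ≤ t₀) (h : BlowUp U V t₀ T) {τ : ℝ} (hτ : τ ∈ Ioo t₀ T)
    (hV : V τ = 0) : T - τ ≤ τ - t₀ := by
  by_contra! hlt
  -- The left branch, reflected at `τ` and delayed by `δ`, would blow up at `τ + ρ + δ < T`. It
  -- stays below the right branch, which is finite there.
  obtain ⟨δ, hδ, hδ'⟩ := exists_between (sub_pos.2 hlt)
  set ρ := τ - t₀
  have hρ : 0 < ρ := by simp only [ρ]; linarith [hτ.1]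
  have hmem₁ : ∀ x ∈ Ico δ (ρ + δ), τ + x ∈ Ioo t₀ T := fun x hx =>
    ⟨by linarith [hx.1, hτ.1], by linarith [hx.2]⟩
  have hmem₂ : ∀ x ∈ Ico δ (ρ + δ), τ - (x - δ) ∈ Ioo t₀ T := fun x hx =>
    ⟨by simp only [ρ] at hx; linarith [hx.2], by linarith [hx.1, hτ.2]⟩
  have hs := h.strictMonoOn_deriv ht₀
  have hd₁ : ∀ x ∈ Ico δ (ρ + δ), HasDerivAt (fun x => U (τ + x)) (V (τ + x)) x := fun x hx =>
    (h.sol _ (hmem₁ x hx)).1.comp_const_add τ x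
  have hd₂ : ∀ x ∈ Ico δ (ρ + δ),
      HasDerivAt (fun x => U (τ - (x - δ))) (-V (τ - (x - δ))) x := fun x hx => by
    have e : HasDerivAt (fun x => τ - (x - δ)) (-1) x := by
      simpa using! ((hasDerivAt_id x).sub_const δ).const_sub τ
    simpa [Function.comp_def] using! (h.sol _ (hmem₂ x hx)).1.scomp x e
  have key : ∀ x ∈ Ico δ (ρ + δ), U (τ - (x - δ)) < U (τ + x) := by
    intro x hx
    by_contra! hle
    have hδm : δ ∈ Ico δ (ρ + δ) := ⟨le_rfl, by linarith⟩
    have hsub : ∀ y ∈ Icc δ x, y ∈ Ico δ (ρ + δ) := fun y hy => ⟨hy.1, hy.2.trans_lt hx.2⟩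
    obtain ⟨z, hz, e, hpos⟩ := exists_first_zero (f := fun x => U (τ + x) - U (τ - (x - δ))) hx.1
      (fun y hy => ((hd₁ y (hsub y hy)).sub (hd₂ y (hsub y hy))).continuousAt.continuousWithinAt)
      (by
        simp only [sub_self, sub_zero, sub_pos]
        refine lt_of_hasDerivAt_pos (by linarith) (fun y hy => (h.sol y ⟨hτ.1.trans_le hy.1,
          hy.2.trans_lt (hmem₁ δ hδm).2⟩).1) fun y hy => ?_
        rw [← hV]
        exact hs hτ ⟨hτ.1.trans hy.1, hy.2.trans (hmem₁ δ hδm).2⟩ hy.1)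
      (by simpa using hle)
    have hzm := hsub z ⟨hz.1.le, hz.2⟩
    have hdz := deriv_nonpos_of_pos_left hz.1 ((hd₁ z hzm).sub (hd₂ z hzm))
      (fun y hy => hpos y ⟨hy.1.le, hy.2⟩) e
    have m₁ := hmem₁ z hzm
    have m₂ := hmem₂ z hzm
    have hτz : τ < τ + z := by linarith [hz.1]
    have hzτ : τ - (z - δ) < τ := by linarith [hz.1]
    -- The energy frozen at `τ` is nondecreasing across `τ`, because `(t - τ) V ≥ 0` on both
    -- branches. At equal heights the right branch is therefore strictly steeper, contrary to the
    -- first contact.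
    have q₁ := lt_of_hasDerivAt_pos hτz
      (fun y hy => h.hasDerivAt_energy (k := τ) ht₀ ⟨hτ.1.trans_le hy.1, hy.2.trans_lt m₁.2⟩)
      (fun y hy => by
        have : V τ < V y := hs hτ ⟨hτ.1.trans hy.1, hy.2.trans m₁.2⟩ hy.1
        rw [hV] at this
        have := mul_pos (sub_pos.2 hy.1) this
        linarith)
    have q₂ := le_of_hasDerivAt_nonneg hzτ.le
      (fun y hy => h.hasDerivAt_energy (k := τ) ht₀ ⟨m₂.1.trans_le hy.1, hy.2.trans_lt hτ.2⟩)
      (fun y hy => by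
        have : V y ≤ V τ := hs.monotoneOn ⟨m₂.1.trans_le hy.1, hy.2.trans_lt hτ.2⟩ hτ hy.2
        rw [hV] at this
        nlinarith [hy.2])
    have hVpos : V τ < V (τ + z) := hs hτ m₁ hτz
    have e' : U (τ + z) = U (τ - (z - δ)) := sub_eq_zero.1 e
    rw [e'] at q₁
    rw [hV] at hVpos
    nlinarith
  have hT : τ + (ρ + δ) ∈ Ioo t₀ T := ⟨by linarith [hτ.1], by linarith⟩
  have hcont : ContinuousAt (fun x => U (τ + x)) (ρ + δ) :=
    ((h.sol _ hT).1.comp_const_add τ (ρ + δ)).continuousAt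
  refine not_tendsto_atTop_of_continuousAt (l := 𝓝[<] (ρ + δ)) nhdsWithin_le_nhds hcont ?_
  have hlim : Tendsto (fun x => τ - (x - δ)) (𝓝[<] (ρ + δ)) (𝓝[>] t₀) := by
    apply tendsto_nhdsWithin_of_tendsto_nhds_of_eventually_within
    · have : Tendsto (fun x => τ - (x - δ)) (𝓝 (ρ + δ)) (𝓝 (τ - (ρ + δ - δ))) :=
        Continuous.tendsto (by fun_prop) _
      rw [show τ - (ρ + δ - δ) = t₀ by simp only [ρ]; ring] at this
      exact this.mono_left nhdsWithin_le_nhds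
    · filter_upwards [self_mem_nhdsWithin] with x hx
      have : x < ρ + δ := hx
      simp only [ρ] at this
      exact mem_Ioi.2 (by linarith)
  refine tendsto_atTop_mono' _ ?_ (h.left.comp hlim)
  filter_upwards [Ioo_mem_nhdsLT (show δ < ρ + δ by linarith)] with x hx
    using (key x ⟨hx.1.le, hx.2⟩).le

end

/-! ### Crossings: which branch they lie on and which solution blows up first. -/

section

variable {U V U₁ V₁ U₂ V₂ : ℝ → ℝ} {s s' : Set ℝ} {t₀ T T₁ T₂ : ℝ}

/-- If `φ > 0` satisfies `φ'' ≤ 12 U₂ φ`, then `(U₁ - U₂) / φ` increases from a common point on. -/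
lemma Sol.exists_diff_ge_mul {φ φ' φ'' : ℝ → ℝ} {b T : ℝ} (h₁ : Sol abs U₁ V₁ (Ico b T))
    (h₂ : Sol abs U₂ V₂ (Ico b T)) (hφ : ∀ t ∈ Ico b T, HasDerivAt φ (φ' t) t)
    (hφ' : ∀ t ∈ Ico b T, HasDerivAt φ' (φ'' t) t) (hpos : ∀ t ∈ Ico b T, 0 < φ t)
    (hle : ∀ t ∈ Ico b T, φ'' t ≤ 12 * U₂ t * φ t) (hbT : b < T) (hU : U₁ b = U₂ b)
    (hV : V₂ b < V₁ b) :
    ∀ x ∈ Ioo b T, ∃ r > 0, ∀ t ∈ Ico x T, r * φ t ≤ U₁ t - U₂ t := by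
  have hd : ∀ t ∈ Ico b T, HasDerivAt (fun t => U₁ t - U₂ t) (V₁ t - V₂ t) t := fun t ht =>
    (h₁ t ht).1.sub (h₂ t ht).1
  -- Sturm comparison: `W / φ²` is the derivative of `(U₁ - U₂) / φ`. While `W ≥ 0` the difference
  -- is nonnegative, which makes `W' ≥ 0`, so `W` can never reach zero.
  set W : ℝ → ℝ := fun t => (V₁ t - V₂ t) * φ t - (U₁ t - U₂ t) * φ' t
  have hW : ∀ t ∈ Ico b T, HasDerivAt W (6 * (U₁ t - U₂ t) ^ 2 * φ t +
      (U₁ t - U₂ t) * (12 * U₂ t * φ t - φ'' t)) t := fun t ht =>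
    ((((h₁ t ht).2.sub (h₂ t ht).2).mul (hφ t ht)).sub ((hd t ht).mul (hφ' t ht))).congr_deriv
      (by simp only [Pi.sub_apply]; ring)
  have hbm : b ∈ Ico b T := ⟨le_rfl, hbT⟩
  have hWb : 0 < W b := by
    simp only [W, hU, sub_self, zero_mul, sub_zero]
    exact mul_pos (by linarith) (hpos b hbm)
  have hR : ∀ t ∈ Ico b T, HasDerivAt (fun t => (U₁ t - U₂ t) / φ t) (W t / φ t ^ 2) t :=
    fun t ht => ((hd t ht).div (hφ t ht) (hpos t ht).ne').congr_deriv (by simp only [W])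
  have hR0 : (U₁ b - U₂ b) / φ b = 0 := by simp [hU]
  have hWpos : ∀ t ∈ Ico b T, 0 < W t := by
    intro t ht
    by_contra! hcon
    have hsub : ∀ z ∈ Icc b t, z ∈ Ico b T := fun z hz => ⟨hz.1, hz.2.trans_lt ht.2⟩
    obtain ⟨z, hz, e, hz'⟩ := exists_first_zero ht.1
      (fun y hy => (hW y (hsub y hy)).continuousAt.continuousWithinAt) hWb hcon
    have hsub' : ∀ y ∈ Icc b z, y ∈ Ico b T := fun y hy => hsub y ⟨hy.1, hy.2.trans hz.2⟩
    have hd0 : ∀ y ∈ Icc b z, 0 ≤ U₁ y - U₂ y := by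
      intro y hy
      have := le_of_hasDerivAt_nonneg hy.1 (fun x hx => hR x (hsub' x ⟨hx.1, hx.2.trans hy.2⟩))
        (fun x hx => by
          rcases lt_or_eq_of_le (hx.2.trans hy.2) with h | rfl
          · exact div_nonneg (hz' x ⟨hx.1, h⟩).le (sq_nonneg _)
          · rw [e, zero_div])
      rw [hR0] at this
      by_contra! hneg
      exact absurd this (not_le.2 (div_neg_of_neg_of_pos hneg (hpos y (hsub' y hy))))
    have := le_of_hasDerivAt_nonneg hz.1.le (fun x hx => hW x (hsub' x hx)) fun x hx => by
      have h1 := hd0 x hx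
      have h2 := hpos x (hsub' x hx)
      have h3 := sub_nonneg.2 (hle x (hsub' x hx))
      positivity
    linarith
  intro x hx
  have hxm : x ∈ Ico b T := ⟨hx.1.le, hx.2⟩
  have hm : StrictMonoOn (fun t => (U₁ t - U₂ t) / φ t) (Ico b T) :=
    strictMonoOn_of_hasDerivAt hR fun t ht => by
      have ht' := interior_subset ht
      exact div_pos (hWpos t ht') (pow_pos (hpos t ht') 2)
  refine ⟨(U₁ x - U₂ x) / φ x, by rw [← hR0]; exact hm hbm hxm hx.1, fun t ht => ?_⟩
  have htm : t ∈ Ico b T := ⟨hx.1.le.trans ht.1, ht.2⟩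
  rw [← le_div_iff₀ (hpos t htm)]
  exact hm.monotoneOn hxm htm ht.1

/-- The combination of scaling and translation used as a positive supersolution of the
linearized equation. -/
def scalingField (U V : ℝ → ℝ) (b t : ℝ) : ℝ := (5 * b - t) * V t - 2 * U t

/-- `BlowUp.right_sub_min_le` gives `T ≤ 2b`, hence `5b - t ≥ 3b`. For large `U` the energy yields
`bV ≥ U`, so the field is at least `3U - 2U`. -/
lemma scalingField_eventually_ge {b τ : ℝ} (ht₀ : 0 ≤ t₀) (h : BlowUp U V t₀ T)
    (hτ : τ ∈ Ioo t₀ T) (hVτ : V τ = 0) (hb : b ∈ Ioo t₀ T) (hV : 0 ≤ V b) (hU : U b < 0) :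
    ∀ᶠ t in 𝓝[<] T, 1 ≤ scalingField U V b t := by
  have hb0 : 0 < b := by linarith [hb.1]
  have hτb : τ ≤ b := ((h.strictMonoOn_deriv ht₀).le_iff_le hτ hb).1 (by rw [hVτ]; exact hV)
  have hT : T ≤ 2 * b := by linarith [h.right_sub_min_le ht₀ hτ hVτ]
  filter_upwards [h.right.eventually_ge_atTop (1 + 1 / b ^ 2), Ioo_mem_nhdsLT hb.2] with t hUt ht
  have hp : 0 < 1 / b ^ 2 := by positivity
  have hU0 : 0 < U t := by linarith
  have htm : t ∈ Ioo t₀ T := ⟨hb.1.trans ht.1, ht.2⟩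
  have hV0 : 0 ≤ V t := hV.trans (h.sol.monotoneOn_abs hb htm ht.1.le)
  have he := (h.sol.mono (s' := Icc b t) fun x hx => ⟨hb.1.trans_le hx.1,
    hx.2.trans_lt ht.2⟩).energy_le ht.1.le hV
  have hUb : U b ^ 3 < 0 := Odd.pow_neg (by decide) hU
  have hVU : U t / b ≤ V t := by
    apply abs_le_of_sq_le_sq' _ hV0 |>.2
    have : (U t / b) ^ 2 = U t ^ 2 * (1 / b ^ 2) := by field_simp
    rw [this]
    have h2 : U t ^ 2 * (1 / b ^ 2) ≤ U t ^ 2 * U t :=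
      mul_le_mul_of_nonneg_left (by linarith) (sq_nonneg _)
    have h3 : 0 < U t ^ 3 := by positivity
    nlinarith [sq_nonneg (V b)]
  rw [div_le_iff₀ hb0] at hVU
  have : 3 * b * V t ≤ (5 * b - t) * V t := mul_le_mul_of_nonneg_right (by linarith [ht.2]) hV0
  unfold scalingField
  linarith

/-- The translation field `V` satisfies `V'' = 12UV + 1`, and the scaling field `Z = tV + 2U`
satisfies `Z'' = 12UZ + 5t`. The combination `5bV - Z` leaves the error `-5(t - b)`, nonpositive
from `b` on. -/
lemma BlowUp.hasDerivAt_scalingField {b t : ℝ} (ht₀ : 0 ≤ t₀) (h : BlowUp U V t₀ T)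
    (ht : t ∈ Ioo t₀ T) :
    HasDerivAt (scalingField U V b) ((5 * b - t) * (6 * U t ^ 2 + t) - 3 * V t) t ∧
    HasDerivAt (fun t => (5 * b - t) * (6 * U t ^ 2 + t) - 3 * V t)
      (12 * U t * scalingField U V b t - 5 * (t - b)) t := by
  obtain ⟨a1, a2⟩ := h.sol t ht
  rw [abs_of_nonneg (by linarith [ht.1])] at a2
  have e : HasDerivAt (fun t => 5 * b - t) (-1) t := by
    simpa using! (hasDerivAt_id t).const_sub (5 * b)
  constructor
  · exact ((e.mul a2).sub (a1.const_mul 2)).congr_deriv (by ring)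
  · refine ((e.mul (((a1.pow 2).const_mul 6).add (hasDerivAt_id t))).sub
      (a2.const_mul 3)).congr_deriv ?_
    simp [scalingField]
    ring

/-- Where `U < 0` the field is visibly positive. A nonpositive interior minimum would thus lie where
`U ≥ 0` and `t > b`, but there the second derivative is negative. -/
lemma scalingField_pos {b τ : ℝ} (ht₀ : 0 ≤ t₀) (h : BlowUp U V t₀ T)
    (hτ : τ ∈ Ioo t₀ T) (hVτ : V τ = 0) (hb : b ∈ Ioo t₀ T) (hV : 0 ≤ V b) (hU : U b < 0) :
    ∀ t ∈ Ico b T, 0 < scalingField U V b t := by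
  have hb0 : 0 < b := by linarith [hb.1]
  have hτb : τ ≤ b := ((h.strictMonoOn_deriv ht₀).le_iff_le hτ hb).1 (by rw [hVτ]; exact hV)
  have hT : T ≤ 2 * b := by linarith [h.right_sub_min_le ht₀ hτ hVτ]
  have hmem : ∀ t ∈ Ico b T, t ∈ Ioo t₀ T := fun t ht => ⟨hb.1.trans_le ht.1, ht.2⟩
  have hV0 : ∀ t ∈ Ico b T, 0 ≤ V t := fun t ht =>
    hV.trans (h.sol.monotoneOn_abs hb (hmem t ht) ht.1)
  have hneg : ∀ t ∈ Ico b T, U t < 0 → 0 < scalingField U V b t := fun t ht hUt => by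
    have := mul_nonneg (show 0 ≤ 5 * b - t by linarith [ht.2]) (hV0 t ht)
    unfold scalingField
    linarith
  intro t ht
  by_contra! hcon
  obtain ⟨c, hc1, hc2⟩ := ((scalingField_eventually_ge ht₀ h hτ hVτ hb hV hU).and
    (Ioo_mem_nhdsLT ht.2)).exists
  have hsub : ∀ x ∈ Icc b c, x ∈ Ico b T := fun x hx => ⟨hx.1, hx.2.trans_lt hc2.2⟩
  obtain ⟨x, hx, hmin⟩ := isCompact_Icc.exists_isMinOn (s := Icc b c)
    ⟨b, le_rfl, (ht.1.trans_lt hc2.1).le⟩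
    (f := scalingField U V b) fun y hy => (h.hasDerivAt_scalingField ht₀
      (hmem y (hsub y hy))).1.continuousAt.continuousWithinAt
  have hxle : scalingField U V b x ≤ 0 := (hmin ⟨ht.1, hc2.1.le⟩).trans hcon
  have hxb : b < x := lt_of_le_of_ne hx.1 fun e => by
    have := hneg b ⟨le_rfl, hb.2⟩ hU
    rw [← e] at hxle
    linarith
  have hxc : x < c := lt_of_le_of_ne hx.2 fun e => by
    rw [e] at hxle
    linarith
  obtain ⟨d1, d2⟩ := h.hasDerivAt_scalingField (b := b) ht₀ (hmem x (hsub x hx))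
  have hloc : IsLocalMin (scalingField U V b) x := hmin.isLocalMin (Icc_mem_nhds hxb hxc)
  have hz := hloc.hasDerivAt_eq_zero d1
  have hUx : 0 ≤ U x := by
    by_contra! hlt
    linarith [hneg x (hsub x hx) hlt]
  have hlt : 12 * U x * scalingField U V b x - 5 * (x - b) < 0 := by
    have := mul_nonneg hUx (neg_nonneg.2 hxle)
    nlinarith
  have hslope := (hasDerivAt_iff_tendsto_slope.1 d2).mono_left
    (nhdsWithin_mono x fun y (hy : y ∈ Ioi x) => ne_of_gt hy)
  obtain ⟨y, hy, hy'⟩ := mem_nhdsGT_iff_exists_Ioo_subset.1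
    ((hslope.eventually_lt_const hlt).and (Ioo_mem_nhdsGT hxc))
  have hxy : x < y := hy
  obtain ⟨z, hz1, hz2⟩ := exists_between hxy
  have hzc : z < c := (hy' ⟨hz1, hz2⟩).2.2
  have := lt_of_hasDerivAt_pos (f := fun t => -scalingField U V b t) hz1
    (fun w hw => (h.hasDerivAt_scalingField (b := b) ht₀
      (hmem w (hsub w ⟨hx.1.trans hw.1, hw.2.trans hzc.le⟩))).1.neg)
    (fun w hw => by
      have := (hy' ⟨hw.1, hw.2.trans hz2⟩).1
      rw [slope_def_field, hz, sub_zero] at this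
      have := (div_neg_iff.1 this).resolve_left fun h => by linarith [hw.1, h.2]
      linarith [this.1])
  have h3 : scalingField U V b x ≤ scalingField U V b z := hmin ⟨hx.1.trans hz1.le, hzc.le⟩
  linarith

/-- The steeper of two solutions crossing on their increasing branches blows up first. -/
theorem BlowUp.right_lt_of_crossing (ht₀ : 0 ≤ t₀) (h₁ : BlowUp U₁ V₁ t₀ T₁)
    (h₂ : BlowUp U₂ V₂ t₀ T₂) {b τ : ℝ} (hτ : τ ∈ Ioo t₀ T₂) (hVτ : V₂ τ = 0)
    (hb₁ : b ∈ Ioo t₀ T₁) (hb₂ : b ∈ Ioo t₀ T₂) (hU : U₁ b = U₂ b) (hV₂ : 0 ≤ V₂ b)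
    (hV : V₂ b < V₁ b) : T₁ < T₂ := by
  by_contra! hle
  have hs₁ : Sol abs U₁ V₁ (Ico b T₂) := h₁.sol.mono fun x hx => ⟨hb₁.1.trans_le hx.1,
    hx.2.trans_le hle⟩
  have hs₂ : Sol abs U₂ V₂ (Ico b T₂) := h₂.sol.mono fun x hx => ⟨hb₂.1.trans_le hx.1, hx.2⟩
  -- If `U₂ b ≥ 0`, then `12 U₂ ≥ 0` afterwards and the constant `1` is a supersolution; the scaling
  -- field is needed only for a negative crossing value. Either way the difference stays above some
  -- `r > 0` near `T₂`, whereas a common blow-up time would force it to `0`.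
  have key : ∃ φ : ℝ → ℝ, (∀ t ∈ Ico b T₂, 0 < φ t) ∧ (∀ᶠ t in 𝓝[<] T₂, 1 ≤ φ t) ∧
      ∀ x ∈ Ioo b T₂, ∃ r > 0, ∀ t ∈ Ico x T₂, r * φ t ≤ U₁ t - U₂ t := by
    rcases lt_or_ge (U₂ b) 0 with hneg | hpos
    · have hp := scalingField_pos ht₀ h₂ hτ hVτ hb₂ hV₂ hneg
      have hm : ∀ t ∈ Ico b T₂, t ∈ Ioo t₀ T₂ := fun t ht => ⟨hb₂.1.trans_le ht.1, ht.2⟩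
      refine ⟨scalingField U₂ V₂ b, hp, scalingField_eventually_ge ht₀ h₂ hτ hVτ hb₂ hV₂ hneg, ?_⟩
      exact hs₁.exists_diff_ge_mul hs₂ (fun t ht => (h₂.hasDerivAt_scalingField ht₀ (hm t ht)).1)
        (fun t ht => (h₂.hasDerivAt_scalingField ht₀ (hm t ht)).2) hp
        (fun t ht => by linarith [ht.1]) hb₂.2 hU hV
    · refine ⟨fun _ => 1, fun _ _ => one_pos, Eventually.of_forall fun _ => le_rfl, ?_⟩
      refine hs₁.exists_diff_ge_mul hs₂ (φ' := fun _ => 0) (φ'' := fun _ => 0)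
        (fun t _ => hasDerivAt_const t 1) (fun t _ => hasDerivAt_const t 0)
        (fun _ _ => one_pos) (fun t ht => ?_) hb₂.2 hU hV
      have : U₂ b ≤ U₂ t := le_of_hasDerivAt_nonneg ht.1
        (fun x hx => (hs₂ x ⟨hx.1, hx.2.trans_lt ht.2⟩).1)
        fun x hx => hV₂.trans (h₂.sol.monotoneOn_abs hb₂ ⟨hb₂.1.trans_le hx.1,
          hx.2.trans_lt ht.2⟩ hx.1)
      linarith
  obtain ⟨φ, hpos, hge, H⟩ := key
  obtain ⟨x, hx⟩ : ∃ x, x ∈ Ioo b T₂ := exists_between hb₂.2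
  obtain ⟨r, hr, hr'⟩ := H x hx
  have hTle : T₁ ≤ T₂ := h₂.right_le_of_lt h₁ (c := x) ⟨hb₂.1.trans hx.1, hx.2⟩
    ⟨hb₁.1.trans hx.1, hx.2.trans_le hle⟩ fun y hy => by
      have hy2 := hy.2.trans_le (min_le_left _ _)
      have h1 := hr' y ⟨hy.1.le, hy2⟩
      have h2 := mul_pos hr (hpos y ⟨(hx.1.trans hy.1).le, hy2⟩)
      linarith
  have hTT : T₁ = T₂ := le_antisymm hTle hle
  subst hTT
  have hlim := h₂.tendsto_diff_right h₁
  have : r ≤ 0 := by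
    refine ge_of_tendsto hlim ?_
    filter_upwards [hge, Ioo_mem_nhdsLT hx.2] with t ht1 ht2
    have := hr' t ⟨ht2.1.le, ht2.2⟩
    nlinarith
  linarith

/-- A solution slightly below `U` can only meet `U` on the increasing branch of `U`. -/
theorem BlowUp.exists_crossing_deriv_nonneg (ht₀ : 0 ≤ t₀) (h : BlowUp U V t₀ T) {τ : ℝ}
    (hτ : τ ∈ Ioo t₀ T) (hVτ : V τ = 0) : ∃ ε > 0, ∀ (U₁ V₁ : ℝ → ℝ) (T₁ τ₁ b : ℝ),
      BlowUp U₁ V₁ t₀ T₁ → τ₁ ∈ Ioo t₀ T₁ → V₁ τ₁ = 0 → |τ₁ - τ| < ε → U τ - 1 ≤ U₁ τ₁ →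
      b ∈ Ioo t₀ T₁ → b < T → U₁ b = U b → (∀ x ∈ Ioo t₀ b, U₁ x < U x) → 0 ≤ V b := by
  set η := (τ - t₀) / 2
  have hη : 0 < η := by simp only [η]; linarith [hτ.1]
  set a := τ - η
  have ha : t₀ < a := by simp only [a, η]; linarith [hτ.1]
  have haτ : a < τ := by simp only [a]; linarith
  have haT : a ∈ Ioo t₀ T := ⟨ha, haτ.trans hτ.2⟩
  set B := max (|U τ| + 1) |U a|
  have hB : 0 ≤ B := (abs_nonneg _).trans (le_max_right _ _)
  -- This `C` makes the derivative of the auxiliary function in `key` nonnegative, since `U + U₁ ≥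
  -- -2B` and `(x - a)² ≤ η²`.
  set C := 12 * B * η ^ 2 + 2
  have hC : 0 < C := by positivity
  set K := 6 * B ^ 2 + τ
  have hτ0 : 0 < τ := by linarith [hτ.1]
  have hK : 0 < K := by positivity
  refine ⟨min (η / 2) (η ^ 2 / (2 * C) / K), by positivity, ?_⟩
  intro U₁ V₁ T₁ τ₁ b h₁ hτ₁ hV₁ hclose hmin hb hbT heq hlt
  by_contra! hVb
  have hs := h.strictMonoOn_deriv ht₀
  have hs₁ := h₁.strictMonoOn_deriv ht₀
  have hbT' : b ∈ Ioo t₀ T := ⟨hb.1, hbT⟩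
  have hcross := h₁.abs_deriv_lt_of_crossing ht₀ h hb.2 hbT hb.1 hlt heq
  have hbτ : b < τ := (hs.lt_iff_lt hbT' hτ).1 (by rw [hVτ]; exact hVb)
  have hτ₁b : τ₁ < b := (hs₁.lt_iff_lt hτ₁ hb).1 (by
    rw [hV₁]; exact (abs_nonneg _).trans_lt hcross)
  have hc1 := abs_lt.1 (hclose.trans_le (min_le_left _ _))
  have hc2 := abs_lt.1 (hclose.trans_le (min_le_right _ _))
  have haτ₁ : a + η / 2 < τ₁ := by simp only [a]; linarith [hc1.1]
  have hab : a < b := by linarith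
  have m : ∀ x ∈ Icc a b, x ∈ Ioo t₀ T := fun x hx => ⟨ha.trans_le hx.1, hx.2.trans_lt hbT⟩
  have m₁ : ∀ x ∈ Icc a b, x ∈ Ioo t₀ T₁ := fun x hx => ⟨ha.trans_le hx.1, hx.2.trans_lt hb.2⟩
  have hle : ∀ x ∈ Icc a b, U₁ x ≤ U x := fun x hx => by
    rcases lt_or_eq_of_le hx.2 with h' | rfl
    · exact (hlt x ⟨ha.trans_le hx.1, h'⟩).le
    · exact heq.le
  have hUa : ∀ x ∈ Icc a τ, U x ≤ U a := fun x hx => by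
    have := le_of_hasDerivAt_nonneg (f := fun x => -U x) hx.1
      (fun y hy => (h.sol y ⟨ha.trans_le hy.1, (hy.2.trans hx.2).trans_lt hτ.2⟩).1.neg)
      (fun y hy => by
        have := hs.monotoneOn ⟨ha.trans_le hy.1, (hy.2.trans hx.2).trans_lt hτ.2⟩ hτ
          (hy.2.trans hx.2)
        linarith)
    linarith
  have hBU : ∀ x ∈ Icc a τ, U x ≤ B := fun x hx =>
    (hUa x hx).trans ((le_abs_self _).trans (le_max_right _ _))
  have hBU' : ∀ x ∈ Ioo t₀ T, -B ≤ U x := fun x hx => by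
    linarith [h.min_le hτ hVτ hx, neg_abs_le (U τ), le_max_left (|U τ| + 1) |U a|]
  have hBU₁' : ∀ x ∈ Ioo t₀ T₁, -B ≤ U₁ x := fun x hx => by
    linarith [h₁.min_le hτ₁ hV₁ hx, neg_abs_le (U τ), le_max_left (|U τ| + 1) |U a|]
  have hsq : ∀ u : ℝ, -B ≤ u → u ≤ B → u ^ 2 ≤ B ^ 2 := fun u h1 h2 => sq_le_sq' h1 h2
  set δ := V₁ b - V b
  have hδ : 0 < δ := by
    simp only [δ]
    linarith [(abs_lt.1 hcross).2, neg_abs_le (V b), le_abs_self (V b)]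
  -- Both minimum points enclose `b` at distance less than `τ - τ₁` apart in slope time: `V₁ b ≤ K
  -- (b - τ₁)` and `-V b ≤ K (τ - b)` add up to `δ ≤ K (τ - τ₁)`.
  have hδK : δ < η ^ 2 / (2 * C) := by
    have e1 := le_of_hasDerivAt_nonneg (f := fun x => K * x - V₁ x) hτ₁b.le
      (fun x hx => ((hasDerivAt_id x).const_mul K).sub
        (h₁.sol x (m₁ x ⟨by linarith [hx.1], hx.2⟩)).2)
      (fun x hx => by
        have hxm : x ∈ Icc a b := ⟨by linarith [hx.1], hx.2⟩
        have := hsq _ (hBU₁' x (m₁ x hxm)) ((hle x hxm).trans (hBU x ⟨hxm.1, hx.2.trans hbτ.le⟩))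
        rw [abs_of_pos (by linarith [(m₁ x hxm).1])]
        simp only [K]
        linarith [hx.2])
    have e2 := le_of_hasDerivAt_nonneg (f := fun x => K * x - V x) hbτ.le
      (fun x hx => ((hasDerivAt_id x).const_mul K).sub (h.sol x ⟨hb.1.trans_le hx.1,
        hx.2.trans_lt hτ.2⟩).2)
      (fun x hx => by
        have := hsq _ (hBU' x ⟨hb.1.trans_le hx.1, hx.2.trans_lt hτ.2⟩)
          (hBU x ⟨hab.le.trans hx.1, hx.2⟩)
        rw [abs_of_pos (by linarith [hb.1, hx.1])]
        simp only [K]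
        linarith [hx.2])
    rw [hV₁] at e1
    rw [hVτ] at e2
    have e3 : K * (τ - τ₁) < η ^ 2 / (2 * C) := by
      rw [mul_comm, ← lt_div_iff₀ hK]
      linarith [hc2.1]
    simp only [δ]
    linarith
  have hder : ∀ x ∈ Icc a b, HasDerivAt (fun x => U x - U₁ x) (V x - V₁ x) x := fun x hx =>
    (h.sol x (m x hx)).1.sub (h₁.sol x (m₁ x hx)).1
  have hψ : ∀ x, HasDerivAt (fun x => (x - a) ^ 2) (2 * (x - a)) x := fun x => by
    simpa using! ((hasDerivAt_id x).sub_const a).pow 2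
  have hψ' : ∀ x, HasDerivAt (fun x => 2 * (x - a)) 2 x := fun x => by
    simpa using! ((hasDerivAt_id x).sub_const a).const_mul 2
  -- Green's identity for the difference against `(x - a)²`, corrected by `C/2` times the energy
  -- difference. The value at `a` is positive. The value at `b` is below `-δη²/4 + Cδ²/2`, because
  -- `V b < 0` and `b - a ≥ η/2`, and this is negative for small `δ`.
  have key := le_of_hasDerivAt_nonneg
    (f := fun x => (V x - V₁ x) * (x - a) ^ 2 - (U x - U₁ x) * (2 * (x - a)) +
      C / 2 * energyDiff U₁ V₁ U V x) hab.le
    (fun x hx => ((((h.sol x (m x hx)).2.sub (h₁.sol x (m₁ x hx)).2).mul (hψ x)).sub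
      ((hder x hx).mul (hψ' x))).add ((hasDerivAt_energyDiff (by linarith [(m x hx).1])
        (h₁.sol.mono (by rintro _ rfl; exact m₁ _ hx))
        (h.sol.mono (by rintro _ rfl; exact m _ hx))).const_mul (C / 2)))
    (fun x hx => by
      have d0 : 0 ≤ U x - U₁ x := sub_nonneg.2 (hle x hx)
      have l1 := hBU' x (m x hx)
      have l2 := hBU₁' x (m₁ x hx)
      have hxa : (x - a) ^ 2 ≤ η ^ 2 :=
        pow_le_pow_left₀ (by linarith [hx.1]) (by simp only [a]; linarith [hx.2]) 2
      have l3 : 0 ≤ (6 * (U x + U₁ x) + 12 * B) * (x - a) ^ 2 :=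
        mul_nonneg (by linarith) (sq_nonneg _)
      have l4 : 12 * B * (x - a) ^ 2 ≤ 12 * B * η ^ 2 :=
        mul_le_mul_of_nonneg_left hxa (by positivity)
      have l5 : 0 ≤ 6 * (U x + U₁ x) * (x - a) ^ 2 - 2 + C := by simp only [C]; linarith
      have := mul_nonneg d0 l5
      refine this.trans (le_of_eq ?_)
      simp only [Pi.sub_apply]
      ring)
  have hea := h₁.energyDiff_pos ht₀ h hb.2 hbT hlt ⟨ha, hab.le⟩
  have heb : energyDiff U₁ V₁ U V b = δ * (δ + 2 * V b) := by
    simp only [energyDiff, heq, δ]; ring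
  simp only [sub_self, heq, heb] at key
  have h6 : (η / 2) ^ 2 ≤ (b - a) ^ 2 := pow_le_pow_left₀ (by linarith) (by linarith) 2
  have h7 : δ * (η / 2) ^ 2 ≤ δ * (b - a) ^ 2 := mul_le_mul_of_nonneg_left h6 hδ.le
  have h8 : C / 2 * (δ * (δ + 2 * V b)) < C / 2 * (δ * δ) := by
    apply mul_lt_mul_of_pos_left _ (by linarith)
    exact mul_lt_mul_of_pos_left (by linarith) hδ
  have h9 : 0 < C / 2 * energyDiff U₁ V₁ U V a := mul_pos (by linarith) hea
  have h10 : V b - V₁ b = -δ := by simp only [δ]; ring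
  rw [h10] at key
  rw [lt_div_iff₀ (by linarith)] at hδK
  have h11 : δ * (δ * (2 * C)) < δ * η ^ 2 := mul_lt_mul_of_pos_left hδK hδ
  norm_num at key
  nlinarith

end

/-! ### The Wronskian argument and the shape of the right blow-up time. -/

section

variable {U V U₁ V₁ U₂ V₂ : ℝ → ℝ} {s s' : Set ℝ} {t₀ T T₁ T₂ : ℝ}

/-- Near `t₀` the difference is convex, positive and tends to `0`, so its slope is nonnegative and
nondecreasing. The bound controls Wronskian terms at the singular end. -/
lemma BlowUp.exists_deriv_diff_bound (h₁ : BlowUp U₁ V₁ t₀ T₁) (h₂ : BlowUp U₂ V₂ t₀ T₂) {c : ℝ}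
    (hc : t₀ < c) (hlt : ∀ t ∈ Ioo t₀ c, U₁ t < U₂ t) :
    ∃ c' > t₀, ∃ M, 0 ≤ M ∧ ∀ t ∈ Ioo t₀ c', 0 ≤ V₂ t - V₁ t ∧ V₂ t - V₁ t ≤ M := by
  obtain ⟨c₁, hc₁, C₁, -, H₁⟩ := h₁.exists_energy_bound
  obtain ⟨c₂, hc₂, C₂, -, H₂⟩ := h₂.exists_energy_bound
  obtain ⟨x, hx, hx'⟩ : ∃ x, t₀ < x ∧ x < min c (min c₁ c₂) :=
    exists_between (lt_min hc (lt_min hc₁.1 hc₂.1))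
  obtain ⟨hxc, hx'⟩ := lt_min_iff.1 hx'
  obtain ⟨hx₁, hx₂⟩ := lt_min_iff.1 hx'
  have hd : ∀ t ∈ Ioc t₀ x, HasDerivAt (fun t => U₂ t - U₁ t) (V₂ t - V₁ t) t := fun t ht =>
    (h₂.sol t ⟨ht.1, (ht.2.trans_lt hx₂).trans hc₂.2⟩).1.sub
      (h₁.sol t ⟨ht.1, (ht.2.trans_lt hx₁).trans hc₁.2⟩).1
  have hm : MonotoneOn (fun t => V₂ t - V₁ t) (Ioc t₀ x) := by
    refine monotoneOn_of_hasDerivAt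
      (fun t ht => (h₂.sol t ⟨ht.1, (ht.2.trans_lt hx₂).trans hc₂.2⟩).2.sub
        (h₁.sol t ⟨ht.1, (ht.2.trans_lt hx₁).trans hc₁.2⟩).2) fun t ht => ?_
    have u1 := (H₁ t ⟨ht.1, ht.2.trans_lt hx₁⟩).2.1
    have := hlt t ⟨ht.1, ht.2.trans_lt hxc⟩
    nlinarith
  have hnn : ∀ t ∈ Ioc t₀ x, 0 ≤ V₂ t - V₁ t := by
    intro t ht
    by_contra! hneg
    have hlim := h₁.tendsto_diff_left h₂
    have : U₂ t - U₁ t ≤ 0 := by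
      refine ge_of_tendsto hlim ?_
      filter_upwards [Ioo_mem_nhdsGT ht.1] with y hy
      have := le_of_hasDerivAt_nonneg (f := fun t => -(U₂ t - U₁ t)) hy.2.le
        (fun z hz => (hd z ⟨hy.1.trans_le hz.1, hz.2.trans ht.2⟩).neg) fun z hz => by
          have : V₂ z - V₁ z ≤ V₂ t - V₁ t := hm ⟨hy.1.trans_le hz.1, hz.2.trans ht.2⟩ ht hz.2
          linarith
      linarith
    linarith [hlt t ⟨ht.1, ht.2.trans_lt hxc⟩]
  exact ⟨x, hx, V₂ x - V₁ x, hnn x ⟨hx, le_rfl⟩, fun t ht => ⟨hnn t ⟨ht.1, ht.2.le⟩,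
    hm ⟨ht.1, ht.2.le⟩ ⟨hx, le_rfl⟩ ht.2.le⟩⟩

lemma BlowUp.exists_deriv_diff_bound_right {S₁ S₂ : ℝ} (h₁ : BlowUp U₁ V₁ S₁ T)
    (h₂ : BlowUp U₂ V₂ S₂ T) {c : ℝ} (hc : c < T) (hlt : ∀ t ∈ Ioo c T, U₁ t < U₂ t) :
    ∃ c' < T, ∃ M, 0 ≤ M ∧ ∀ t ∈ Ioo c' T, -M ≤ V₂ t - V₁ t ∧ V₂ t - V₁ t ≤ 0 := by
  obtain ⟨c', hc', M, hM, H⟩ := h₁.reflect.exists_deriv_diff_bound h₂.reflect (c := -c)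
    (by linarith) (fun t ht => hlt (-t) ⟨by linarith [ht.2], by linarith [ht.1]⟩)
  refine ⟨-c', by linarith, M, hM, fun t ht => ?_⟩
  have := H (-t) ⟨by linarith [ht.2], by linarith [ht.1]⟩
  simp only [neg_neg] at this
  constructor <;> linarith [this.1, this.2]

lemma BlowUp.eq_of_eqOn (h₁ : BlowUp U₁ V₁ t₀ T₁) (h₂ : BlowUp U₂ V₂ t₀ T₂) {c : ℝ} (hc : t₀ < c)
    (hc₁ : c < T₁) (hc₂ : c < T₂) (heq : ∀ t ∈ Ioo t₀ c, U₁ t = U₂ t ∧ V₁ t = V₂ t) :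
    T₁ = T₂ ∧ ∀ t ∈ Ioo t₀ T₁, U₁ t = U₂ t ∧ V₁ t = V₂ t := by
  obtain ⟨x, hx⟩ : ∃ x, x ∈ Ioo t₀ c := exists_between hc
  have hT := h₁.right_unique h₂ (τ := x) ⟨hx.1, hx.2.trans hc₁⟩ ⟨hx.1, hx.2.trans hc₂⟩
    (heq x hx).1 (heq x hx).2
  subst hT
  exact ⟨rfl, fun t ht => Sol.eqOn (s := Ioo t₀ T₁) h₁.sol h₂.sol
    (τ := x) ⟨hx.1, hx.2.trans hc₁⟩ (heq x hx).1 (heq x hx).2 ht⟩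

/-- Two distinct solutions are strictly ordered near `t₀`, hence so are their minimum values: for
fixed `t₀`, the minimum value is a faithful parameter. -/
lemma BlowUp.eq_of_min_eq (ht₀ : 0 ≤ t₀) (h₁ : BlowUp U₁ V₁ t₀ T₁) (h₂ : BlowUp U₂ V₂ t₀ T₂)
    {τ₁ τ₂ : ℝ} (hτ₁ : τ₁ ∈ Ioo t₀ T₁) (hτ₂ : τ₂ ∈ Ioo t₀ T₂) (hV₁ : V₁ τ₁ = 0) (hV₂ : V₂ τ₂ = 0)
    (hm : U₁ τ₁ = U₂ τ₂) : τ₁ = τ₂ ∧ T₁ = T₂ ∧ ∀ t ∈ Ioo t₀ T₁, U₁ t = U₂ t ∧ V₁ t = V₂ t := by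
  obtain ⟨c, hc, hc₁, hc₂, h | h | h⟩ := h₁.trichotomy h₂
  · exact absurd (h₁.min_lt_min ht₀ h₂ hτ₁ hτ₂ hV₁ hV₂ hc h) (by rw [hm]; exact lt_irrefl _)
  · exact absurd (h₂.min_lt_min ht₀ h₁ hτ₂ hτ₁ hV₂ hV₁ hc h) (by rw [hm]; exact lt_irrefl _)
  · obtain ⟨hT, hE⟩ := h₁.eq_of_eqOn h₂ hc hc₁ hc₂ h
    refine ⟨?_, hT, hE⟩
    apply (h₁.strictMonoOn_deriv ht₀).injOn hτ₁ (hT ▸ hτ₂)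
    rw [hV₁, (hE τ₂ (hT ▸ hτ₂)).2, hV₂]

lemma BlowUp.lt_of_min_lt (ht₀ : 0 ≤ t₀) (h₁ : BlowUp U₁ V₁ t₀ T₁) (h₂ : BlowUp U₂ V₂ t₀ T₂)
    {τ₁ τ₂ : ℝ} (hτ₁ : τ₁ ∈ Ioo t₀ T₁) (hτ₂ : τ₂ ∈ Ioo t₀ T₂) (hV₁ : V₁ τ₁ = 0) (hV₂ : V₂ τ₂ = 0)
    (hm : U₁ τ₁ < U₂ τ₂) : ∃ c, t₀ < c ∧ c < T₁ ∧ c < T₂ ∧ ∀ t ∈ Ioo t₀ c, U₁ t < U₂ t := by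
  obtain ⟨c, hc, hc₁, hc₂, h | h | h⟩ := h₁.trichotomy h₂
  · exact ⟨c, hc, hc₁, hc₂, h⟩
  · exact absurd (h₂.min_lt_min ht₀ h₁ hτ₂ hτ₁ hV₂ hV₁ hc h) (not_lt.2 hm.le)
  · obtain ⟨hT, hE⟩ := h₁.eq_of_eqOn h₂ hc hc₁ hc₂ h
    have : τ₁ = τ₂ := by
      apply (h₁.strictMonoOn_deriv ht₀).injOn hτ₁ (hT ▸ hτ₂)
      rw [hV₁, (hE τ₂ (hT ▸ hτ₂)).2, hV₂]
    subst this
    exact absurd (hE τ₁ hτ₁).1 hm.ne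

/-- The Wronskian of two consecutive differences of three ordered solutions is positive. -/
lemma BlowUp.wronskian_pos {Um Vm Up Vp : ℝ → ℝ} {Tm Tp b : ℝ} (hm : BlowUp Um Vm t₀ Tm)
    (h : BlowUp U V t₀ T) (hp : BlowUp Up Vp t₀ Tp) (hb : t₀ < b)
    (hlt₁ : ∀ t ∈ Ioo t₀ b, Um t < U t) (hlt₂ : ∀ t ∈ Ioo t₀ b, U t < Up t)
    [s.OrdConnected] (hs : Ioo t₀ b ⊆ s) (hs' : interior s ⊆ Ioo t₀ b) (hs0 : ∀ t ∈ s, t₀ < t)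
    (hsm : ∀ t ∈ s, t < Tm) (hsT : ∀ t ∈ s, t < T) (hsp : ∀ t ∈ s, t < Tp) :
    StrictMonoOn (fun t => (U t - Um t) * (Vp t - V t) - (V t - Vm t) * (Up t - U t)) s ∧
    ∀ t ∈ s, 0 < (U t - Um t) * (Vp t - V t) - (V t - Vm t) * (Up t - U t) := by
  have hmono : StrictMonoOn (fun t => (U t - Um t) * (Vp t - V t) - (V t - Vm t) * (Up t - U t))
      s := by
    -- The two differences satisfy `D'' = pD` with coefficients `6(U + Um) < 6(Up + U)`, whence the
    -- positive derivative.
    refine strictMonoOn_of_hasDerivAt (f' := fun t =>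
      6 * (U t - Um t) * (Up t - U t) * (Up t - Um t)) (fun t ht => ?_) fun t ht => ?_
    · obtain ⟨a1, b1⟩ := hm.sol t ⟨hs0 t ht, hsm t ht⟩
      obtain ⟨a2, b2⟩ := h.sol t ⟨hs0 t ht, hsT t ht⟩
      obtain ⟨a3, b3⟩ := hp.sol t ⟨hs0 t ht, hsp t ht⟩
      refine (((a2.sub a1).mul (b3.sub b2)).sub ((b2.sub b1).mul (a3.sub a2))).congr_deriv ?_
      simp only [Pi.sub_apply]
      ring
    · have h1 := sub_pos.2 (hlt₁ t (hs' ht))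
      have h2 := sub_pos.2 (hlt₂ t (hs' ht))
      have h3 : 0 < Up t - Um t := by linarith
      positivity
  refine ⟨hmono, ?_⟩
  -- Near `t₀` the Wronskian is at least `-M₁ (Up - U)`, which tends to `0`.
  obtain ⟨c₁, hc₁, M₁, hM₁, H₁⟩ := hm.exists_deriv_diff_bound h hb hlt₁
  obtain ⟨c₂, hc₂, M₂, hM₂, H₂⟩ := h.exists_deriv_diff_bound hp hb hlt₂
  have hlim : Tendsto (fun t => -(M₁ * (Up t - U t))) (𝓝[>] t₀) (𝓝 0) := by
    simpa using ((h.tendsto_diff_left hp).const_mul M₁).neg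
  have hnn : ∀ t ∈ Ioo t₀ b,
      0 ≤ (U t - Um t) * (Vp t - V t) - (V t - Vm t) * (Up t - U t) := by
    intro t ht
    refine le_of_tendsto hlim ?_
    filter_upwards [Ioo_mem_nhdsGT ht.1, Ioo_mem_nhdsGT hc₁, Ioo_mem_nhdsGT hc₂] with x h1 h2 h3
    have hxb : x ∈ Ioo t₀ b := ⟨h1.1, h1.2.trans ht.2⟩
    refine le_trans ?_ (hmono (hs hxb) (hs ht) h1.2).le
    have e1 := mul_nonneg (sub_pos.2 (hlt₁ x hxb)).le (H₂ x h3).1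
    have e2 := mul_le_mul_of_nonneg_right (H₁ x h2).2 (sub_pos.2 (hlt₂ x hxb)).le
    simp only
    linarith
  intro t ht
  obtain ⟨x, hx, hx'⟩ : ∃ x, t₀ < x ∧ x < min t b := exists_between (lt_min (hs0 t ht) hb)
  obtain ⟨h1, h2⟩ := lt_min_iff.1 hx'
  exact (hnn x ⟨hx, h2⟩).trans_lt (hmono (hs ⟨hx, h2⟩) ht h1)

/-- A solution cannot blow up at least as early as slightly lower and slightly higher ones. -/
theorem BlowUp.exists_not_le_right (ht₀ : 0 ≤ t₀) (h : BlowUp U V t₀ T) {τ : ℝ}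
    (hτ : τ ∈ Ioo t₀ T) (hVτ : V τ = 0) : ∃ ε > 0,
      ∀ (Um Vm Up Vp : ℝ → ℝ) (Tm Tp τm τp : ℝ), BlowUp Um Vm t₀ Tm → BlowUp Up Vp t₀ Tp →
      τm ∈ Ioo t₀ Tm → τp ∈ Ioo t₀ Tp → Vm τm = 0 → Vp τp = 0 → |τm - τ| < ε →
      U τ - 1 ≤ Um τm → Um τm < U τ → U τ < Up τp → T ≤ Tm → T ≤ Tp → False := by
  obtain ⟨ε, hε, hcross⟩ := h.exists_crossing_deriv_nonneg ht₀ hτ hVτ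
  refine ⟨ε, hε, fun Um Vm Up Vp Tm Tp τm τp hm hp hτm hτp hVm hVp
    hclose hge hltm hltp hTm hTp => ?_⟩
  obtain ⟨c₁, hc₁, hc₁m, hc₁T, hord₁⟩ := hm.lt_of_min_lt ht₀ h hτm hτ hVm hVτ hltm
  obtain ⟨c₂, hc₂, hc₂T, hc₂p, hord₂⟩ := h.lt_of_min_lt ht₀ hp hτ hτp hVτ hVp hltp
  -- A crossing would lie on the increasing branch of `U` with `Um` steeper, so `Um` would blow up
  -- before `T`.
  have hlt₁ : ∀ t ∈ Ioo t₀ T, Um t < U t := by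
    rcases exists_first_crossing (f := Um) (g := U) (b := T) ⟨hc₁, hc₁T⟩
      (hm.sol.continuousOn.mono (Ioo_subset_Ioo_right hTm)) h.sol.continuousOn hord₁
      with hall | ⟨b, hb, e, hlt⟩
    · exact hall
    · exfalso
      have hbm : b ∈ Ioo t₀ Tm := ⟨hb.1, hb.2.trans_le hTm⟩
      have hV := hcross Um Vm Tm τm b hm hτm hVm hclose hge hbm hb.2 e hlt
      have hVlt := hm.abs_deriv_lt_of_crossing ht₀ h hbm.2 hb.2 hb.1 hlt e
      exact absurd (hm.right_lt_of_crossing ht₀ h hτ hVτ hbm hb e hV (abs_lt.1 hVlt).2)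
        (not_lt.2 hTm)
  rcases exists_first_crossing (f := U) (g := Up) (b := T) ⟨hc₂, hc₂T⟩
    h.sol.continuousOn (hp.sol.continuousOn.mono (Ioo_subset_Ioo_right hTp)) hord₂
    with hlt₂ | ⟨b, hb, e, hlt₂⟩
  · have hTT : Tp = T := le_antisymm (h.right_le_of_lt hp ⟨hc₂, hc₂T⟩ ⟨hc₂, hc₂p⟩ fun x hx =>
      (hlt₂ x ⟨hc₂.trans hx.1, hx.2.trans_le (min_le_left _ _)⟩).le) hTp
    subst hTT
    obtain ⟨hmono, hpos⟩ := hm.wronskian_pos h hp h.lt hlt₁ hlt₂ (s := Ioo t₀ Tp) Subset.rfl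
      (by simp) (fun t ht => ht.1) (fun t ht => ht.2.trans_le hTm) (fun t ht => ht.2)
      (fun t ht => ht.2)
    obtain ⟨d₂, hd₂, M₂, -, H₂⟩ := h.exists_deriv_diff_bound_right hp h.lt hlt₂
    -- Near the common blow-up time `Up - U` has slope `≤ 0`, so with this bound the Wronskian is at
    -- most `M (Up - U) → 0`, although it is positive and increasing. `Um` may blow up later, hence
    -- two cases.
    have hM : ∃ d < Tp, ∃ M, ∀ t ∈ Ioo d Tp, -M ≤ V t - Vm t := by
      rcases lt_or_eq_of_le hTm with hlt | heq
      · refine ⟨τ, hτ.2, Vm Tp, fun t ht => ?_⟩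
        have htm : t ∈ Ioo t₀ Tp := ⟨hτ.1.trans ht.1, ht.2⟩
        have h1 := h.sol.monotoneOn_abs hτ htm ht.1.le
        have h2 := hm.sol.monotoneOn_abs ⟨htm.1, htm.2.trans hlt⟩ ⟨h.lt, hlt⟩ ht.2.le
        linarith
      · subst heq
        obtain ⟨d, hd, M, -, H⟩ := hm.exists_deriv_diff_bound_right h h.lt hlt₁
        exact ⟨d, hd, M, fun t ht => (H t ht).1⟩
    obtain ⟨d₁, hd₁, M, H₁⟩ := hM
    obtain ⟨x, hx⟩ : ∃ x, x ∈ Ioo t₀ Tp := exists_between h.lt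
    have hlim : Tendsto (fun t => M * (Up t - U t)) (𝓝[<] Tp) (𝓝 0) := by
      simpa using (h.tendsto_diff_right hp).const_mul M
    refine absurd (hpos x hx) (not_lt.2 (ge_of_tendsto hlim ?_))
    filter_upwards [Ioo_mem_nhdsLT hx.2, Ioo_mem_nhdsLT hd₁, Ioo_mem_nhdsLT hd₂] with t h1 h2 h3
    have htm : t ∈ Ioo t₀ Tp := ⟨hx.1.trans h1.1, h1.2⟩
    refine (hmono hx htm h1.1).le.trans ?_
    have e1 := mul_nonneg (sub_pos.2 (hlt₁ t htm)).le (neg_nonneg.2 (H₂ t h3).2)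
    have e2 := mul_le_mul_of_nonneg_right (H₁ t h2) (sub_pos.2 (hlt₂ t htm)).le
    simp only
    linarith
  -- At a crossing of `U` and `Up` the Wronskian is `(U - Um)(Vp - V)`, and `Vp - V ≤ 0` there.
  · obtain ⟨-, hpos⟩ := hm.wronskian_pos h hp hb.1 (fun t ht => hlt₁ t ⟨ht.1, ht.2.trans hb.2⟩)
      hlt₂ (s := Ioc t₀ b) Ioo_subset_Ioc_self (by simp) (fun t ht => ht.1)
      (fun t ht => (ht.2.trans_lt hb.2).trans_le hTm) (fun t ht => ht.2.trans_lt hb.2)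
      (fun t ht => (ht.2.trans_lt hb.2).trans_le hTp)
    have hW := hpos b ⟨hb.1, le_rfl⟩
    have hd := deriv_nonpos_of_pos_left hb.1 (f := fun y => Up y - U y)
      ((hp.sol b ⟨hb.1, hb.2.trans_le hTp⟩).1.sub (h.sol b hb).1)
      (fun x hx => sub_pos.2 (hlt₂ x hx)) (sub_eq_zero.2 e.symm)
    have h1 := sub_pos.2 (hlt₁ b hb)
    rw [← e, sub_self, mul_zero, sub_zero] at hW
    nlinarith

/-- The solutions with left blow-up point `t₀` are parametrized by their minimum value `m`;
`τ m` is the point where the minimum is attained. -/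
theorem exists_minPoint (ht₀ : 0 ≤ t₀) : ∃ τ : ℝ → ℝ, Continuous τ ∧ (∀ m, t₀ < τ m) ∧
    (∀ m, leftTime (τ m, m) = t₀) ∧ (∀ m σ, leftTime (σ, m) = t₀ → σ = τ m) ∧
    ∀ m σ, t₀ ≤ σ → σ < τ m → leftTime (σ, m) < t₀ := by
  have hcont : ∀ m, Continuous fun σ => leftTime (σ, m) := fun m =>
    continuous_leftTime.comp (by fun_prop)
  have h0 : ∀ m, leftTime (t₀, m) < t₀ := fun m => (min_spec (t₀, m)).2.1.1
  have hex : ∀ m, ∃ σ, t₀ < σ ∧ leftTime (σ, m) = t₀ := by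
    intro m
    obtain ⟨σ₁, h1, h2⟩ := exists_lt_leftTime t₀ m
    obtain ⟨σ, hσ, e⟩ := intermediate_value_Icc h1.le (hcont m).continuousOn ⟨(h0 m).le, h2.le⟩
    refine ⟨σ, lt_of_le_of_ne hσ.1 fun h => ?_, e⟩
    rw [← h] at e
    exact (h0 m).ne e
  choose τ hτ hτ' using hex
  have huniq : ∀ m σ, leftTime (σ, m) = t₀ → σ = τ m := by
    intro m σ e
    obtain ⟨h₁, m₁, u₁, v₁⟩ := min_spec (σ, m)
    obtain ⟨h₂, m₂, u₂, v₂⟩ := min_spec (τ m, m)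
    rw [e] at h₁ m₁
    rw [hτ'] at h₂ m₂
    exact (h₁.eq_of_min_eq ht₀ h₂ m₁ m₂ v₁ v₂ (u₁.trans u₂.symm)).1
  -- As `τ m` is the only root, `leftTime (·, m) - t₀` has a constant sign on each side of it. These
  -- strict inequalities are open in `m`, which gives the continuity of `τ`.
  have hlow : ∀ m σ, t₀ ≤ σ → σ < τ m → leftTime (σ, m) < t₀ := by
    intro m σ h1 h2
    by_contra! hle
    obtain ⟨x, hx, e⟩ := intermediate_value_Icc h1 (hcont m).continuousOn ⟨(h0 m).le, hle⟩
    have := huniq m x e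
    linarith [hx.2]
  have hhigh : ∀ m σ, τ m < σ → t₀ < leftTime (σ, m) := by
    intro m σ h1
    by_contra! hle
    obtain ⟨σ₁, h2, h3⟩ := exists_lt_leftTime σ m
    obtain ⟨x, hx, e⟩ := intermediate_value_Icc h2.le (hcont m).continuousOn
      ⟨hle, (((hτ m).trans h1).trans h3).le⟩
    have := huniq m x e
    linarith [hx.1]
  refine ⟨τ, ?_, hτ, hτ', huniq, hlow⟩
  rw [continuous_iff_continuousAt]
  intro m
  have hc : ∀ σ, Continuous fun m => leftTime (σ, m) := fun σ =>
    continuous_leftTime.comp (by fun_prop)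
  rw [ContinuousAt, tendsto_order]
  constructor
  · intro c hcm
    obtain ⟨x, hx1, hx2⟩ := exists_between (max_lt hcm (hτ m))
    obtain ⟨hx1, hx3⟩ := max_lt_iff.1 hx1
    filter_upwards [(hc x).continuousAt.eventually_lt_const (hlow m x hx3.le hx2)] with y hy
    by_contra! hle
    exact absurd (hhigh y x (hle.trans_lt hx1)) (not_lt.2 hy.le)
  · intro c hcm
    obtain ⟨x, hx1, hx2⟩ := exists_between hcm
    filter_upwards [(hc x).continuousAt.eventually_const_lt (hhigh m x hx1)] with y hy
    by_contra! hle
    exact absurd (hlow y x ((hτ m).trans hx1).le (hx2.trans_le hle)) (not_lt.2 hy.le)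

/-- Level sets of a continuous function above its limit at infinity, in the absence of local
minima. -/
theorem encard_levels {f : ℝ → ℝ} {l : ℝ} (hf : Continuous f) (hl : ∀ m, l < f m)
    (hlim : ∀ ε > 0, ∃ M > 0, ∀ m, M ≤ |m| → f m < l + ε)
    (hmin : ∀ m, ∃ ε > 0, ∀ a b, m - ε < a → a < m → m < b → f m ≤ f a → f m ≤ f b → False) :
    ∃ m₀, (∀ m, f m ≤ f m₀) ∧ {m | f m = f m₀}.encard = 1 ∧
      ∀ y, l < y → y < f m₀ → {m | f m = y}.encard = 2 := by
  have quasi : ∀ a x b, a < x → x < b → min (f a) (f b) < f x := by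
    intro a x b hax hxb
    by_contra! hle
    obtain ⟨y, hy, hymin⟩ := isCompact_Icc.exists_isMinOn (s := Icc a b)
      ⟨a, le_rfl, (hax.trans hxb).le⟩ hf.continuousOn
    -- If the minimum over `[a, b]` is attained at an end point, then `x` attains it as well. An
    -- interior minimizer contradicts `hmin`, where only the left comparison point has to be close.
    have hint : ∃ z ∈ Ioo a b, ∀ w ∈ Icc a b, f z ≤ f w := by
      by_cases hyI : y ∈ Ioo a b
      · exact ⟨y, hyI, hymin⟩
      · refine ⟨x, ⟨hax, hxb⟩, fun w hw => ?_⟩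
        have h1 : f y ≤ f w := hymin hw
        have hyab : y = a ∨ y = b := by
          by_contra! hne
          exact hyI ⟨lt_of_le_of_ne hy.1 hne.1.symm, lt_of_le_of_ne hy.2 hne.2⟩
        rcases hyab with rfl | rfl
        · exact (hle.trans (min_le_left _ _)).trans h1
        · exact (hle.trans (min_le_right _ _)).trans h1
    obtain ⟨z, hz, hzmin⟩ := hint
    obtain ⟨ε, hε, H⟩ := hmin z
    obtain ⟨p, hp1, hp2⟩ := exists_between (max_lt hz.1 (show z - ε < z by linarith))
    obtain ⟨hp1, hp3⟩ := max_lt_iff.1 hp1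
    exact H p b hp3 hp2 hz.2 (hzmin p ⟨hp1.le, hp2.le.trans hz.2.le⟩)
      (hzmin b ⟨(hz.1.trans hz.2).le, le_rfl⟩)
  obtain ⟨M, hM, HM⟩ := hlim (f 0 - l) (by linarith [hl 0])
  obtain ⟨m₀, hm₀, hmax⟩ := isCompact_Icc.exists_isMaxOn (s := Icc (-M) M)
    ⟨0, by linarith, hM.le⟩ hf.continuousOn
  have hmax' : ∀ m, f m ≤ f m₀ := by
    intro m
    by_cases hm : m ∈ Icc (-M) M
    · exact hmax hm
    · have h1 : M ≤ |m| := by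
        by_contra! h
        exact hm ⟨(abs_lt.1 h).1.le, (abs_lt.1 h).2.le⟩
      have h2 := HM m h1
      have h3 : f 0 ≤ f m₀ := hmax ⟨by linarith, hM.le⟩
      linarith
  refine ⟨m₀, hmax', ?_, fun y hy1 hy2 => ?_⟩
  · rw [Set.encard_eq_one]
    refine ⟨m₀, ?_⟩
    ext m
    simp only [mem_ofPred_eq, mem_singleton_iff]
    refine ⟨fun h => ?_, fun h => by rw [h]⟩
    by_contra hne
    rcases lt_or_gt_of_ne hne with hlt | hlt
    · have := quasi m ((m + m₀) / 2) m₀ (by linarith) (by linarith)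
      rw [h, min_self] at this
      linarith [hmax' ((m + m₀) / 2)]
    · have := quasi m₀ ((m + m₀) / 2) m (by linarith) (by linarith)
      rw [h, min_self] at this
      linarith [hmax' ((m + m₀) / 2)]
  · obtain ⟨N, hN, HN⟩ := hlim (y - l) (by linarith)
    set K := N + |m₀| + 1
    have hK : N ≤ |K| := by
      rw [abs_of_pos (by positivity)]
      simp only [K]
      linarith [abs_nonneg m₀]
    have h1 : f K < y := by linarith [HN K hK]
    have h2 : f (-K) < y := by linarith [HN (-K) (by rwa [abs_neg])]
    have hm1 : m₀ < K := by simp only [K]; linarith [le_abs_self m₀]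
    have hm2 : -K < m₀ := by simp only [K]; linarith [neg_abs_le m₀]
    obtain ⟨a, ha, ea⟩ := intermediate_value_Icc hm2.le hf.continuousOn ⟨h2.le, hy2.le⟩
    obtain ⟨b, hb, eb⟩ := intermediate_value_Icc' hm1.le hf.continuousOn ⟨h1.le, hy2.le⟩
    have ha' : a < m₀ := lt_of_le_of_ne ha.2 fun h => by rw [h] at ea; linarith
    have hb' : m₀ < b := lt_of_le_of_ne hb.1 fun h => by rw [← h] at eb; linarith
    rw [Set.encard_eq_two]
    refine ⟨a, b, (ha'.trans hb').ne, ?_⟩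
    ext m
    simp only [mem_ofPred_eq, mem_insert_iff, mem_singleton_iff]
    refine ⟨fun h => ?_, ?_⟩
    · by_contra! hne
      rcases lt_trichotomy m a with h3 | h3 | h3
      · have := quasi m a b h3 (ha'.trans hb')
        rw [h, ea, eb, min_self] at this
        exact lt_irrefl _ this
      · exact hne.1 h3
      · rcases lt_trichotomy m b with h4 | h4 | h4
        · have := quasi a m b h3 h4
          rw [h, ea, eb, min_self] at this
          exact lt_irrefl _ this
        · exact hne.2 h4
        · have := quasi a b m (ha'.trans hb') h4
          rw [h, ea, eb, min_self] at this
          exact lt_irrefl _ this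
    · rintro (rfl | rfl) <;> assumption

/-- The distribution of the right blow-up times of the solutions with left blow-up point `t₀`. -/
theorem encard_rightTime (ht₀ : 0 ≤ t₀) {τ : ℝ → ℝ} (hτc : Continuous τ)
    (hτ' : ∀ m, leftTime (τ m, m) = t₀) : ∃ m₀, (∀ m, rightTime (τ m, m) ≤ rightTime (τ m₀, m₀)) ∧
      {m | rightTime (τ m, m) = rightTime (τ m₀, m₀)}.encard = 1 ∧
      ∀ y, t₀ < y → y < rightTime (τ m₀, m₀) → {m | rightTime (τ m, m) = y}.encard = 2 := by
  have hspec : ∀ m, BlowUp (minU (τ m, m)) (minV (τ m, m)) t₀ (rightTime (τ m, m)) ∧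
      τ m ∈ Ioo t₀ (rightTime (τ m, m)) ∧ minU (τ m, m) (τ m) = m ∧ minV (τ m, m) (τ m) = 0 := by
    intro m
    have := min_spec (τ m, m)
    rwa [hτ'] at this
  refine encard_levels (f := fun m => rightTime (τ m, m))
    (continuous_rightTime.comp (by fun_prop)) (fun m => (hspec m).1.lt) ?_ ?_
  · intro ε hε
    -- Each branch lasts at most `7 / √|m|`, so the lifetime is at most `14 / √|m|`; `15` makes the
    -- inequality strict.
    refine ⟨(15 / ε) ^ 2, by positivity, fun m hm => ?_⟩
    have hκ : 15 / ε ≤ √|m| := Real.le_sqrt_of_sq_le hm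
    have hκ0 : 0 < √|m| := lt_of_lt_of_le (by positivity) hκ
    have hsq : |m| = √|m| ^ 2 := (Real.sq_sqrt (abs_nonneg m)).symm
    have h1 := rightTime_le (τ := τ m) hκ0 hsq
    have h2 := le_leftTime (τ := τ m) hκ0 hsq
    rw [hτ'] at h2
    have h3 : 14 / √|m| < ε := by
      rw [div_le_iff₀ hε] at hκ
      rw [div_lt_iff₀ hκ0]
      linarith
    have h4 : 14 / √|m| = 7 / √|m| + 7 / √|m| := by ring
    linarith
  · intro m
    obtain ⟨h, hm, hU, hV⟩ := hspec m
    obtain ⟨ε, hε, H⟩ := h.exists_not_le_right ht₀ hm hV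
    obtain ⟨δ, hδ, hδ'⟩ := Metric.continuousAt_iff.1 (hτc.continuousAt (x := m)) ε hε
    refine ⟨min δ 1, by positivity, fun a b ha1 ha2 hb h1 h2 => ?_⟩
    obtain ⟨ka, ma, ua, va⟩ := hspec a
    obtain ⟨kb, mb, ub, vb⟩ := hspec b
    have e1 := min_le_left δ 1
    have e2 := min_le_right δ 1
    refine H _ _ _ _ _ _ _ _ ka kb ma mb va vb ?_ ?_ ?_ ?_ h1 h2
    · have := hδ' (x := a) (by rw [Real.dist_eq, abs_lt]; constructor <;> linarith)
      rwa [Real.dist_eq] at this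
    · rw [hU, ua]; linarith
    · rw [hU, ua]; exact ha2
    · rw [hU, ub]; exact hb

end

/-! ### Regular solutions at `t₀` against the singular ones. -/

section

variable {U V U₁ V₁ U₂ V₂ : ℝ → ℝ} {s s' : Set ℝ} {t₀ T T₁ T₂ : ℝ}

lemma BlowUp.monotoneOn_right {S : ℝ} (h : BlowUp U V S T) {τ : ℝ} (hτ : τ ∈ Ioo S T)
    (hV : V τ = 0) : MonotoneOn U (Ico τ T) :=
  have hmem : ∀ t ∈ Ico τ T, t ∈ Ioo S T := fun _ ht => ⟨hτ.1.trans_le ht.1, ht.2⟩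
  monotoneOn_of_hasDerivAt (fun t ht => (h.sol t (hmem t ht)).1) fun t ht =>
    hV ▸ h.sol.monotoneOn_abs hτ (hmem t ht) ht.1

lemma BlowUp.antitoneOn_left {S : ℝ} (h : BlowUp U V S T) {τ : ℝ} (hτ : τ ∈ Ioo S T)
    (hV : V τ = 0) : AntitoneOn U (Ioc S τ) := by
  intro a ha b hb hab
  have := h.reflect.monotoneOn_right (τ := -τ) ⟨by linarith [hτ.2], by linarith [hτ.1]⟩
    (by simpa using hV) (a := -b) (b := -a) ⟨by linarith [hb.2], by linarith [hb.1]⟩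
    ⟨by linarith [ha.2], by linarith [ha.1]⟩ (by linarith)
  simpa using this

/-- A function that touches another one from above has the same derivative there. -/
lemma deriv_eq_of_touch {f g f' g' : ℝ → ℝ} {s : Set ℝ} {t : ℝ} (hs : s ∈ 𝓝 t)
    (hf : HasDerivAt f (f' t) t) (hg : HasDerivAt g (g' t) t) (hle : ∀ x ∈ s, g x ≤ f x) (he : f t = g t) : f' t = g' t := by
  have hmin : IsLocalMin (fun x => f x - g x) t := by
    filter_upwards [hs] with x hx
    linarith [hle x hx]
  linarith [hmin.hasDerivAt_eq_zero (hf.sub hg)]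

/-- A solution on `[t₀, s]` cannot outlive all the solutions blowing up at `t₀`. -/
theorem exists_le_rightTime {τ : ℝ → ℝ} (hτc : Continuous τ)
    (hτ' : ∀ m, leftTime (τ m, m) = t₀) {b : ℝ} (hU : Sol abs U V (Icc t₀ b)) :
    ∃ m, b ≤ rightTime (τ m, m) := by
  have hspec : ∀ m, BlowUp (minU (τ m, m)) (minV (τ m, m)) t₀ (rightTime (τ m, m)) ∧
      τ m ∈ Ioo t₀ (rightTime (τ m, m)) ∧ minU (τ m, m) (τ m) = m ∧ minV (τ m, m) (τ m) = 0 := by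
    intro m
    have := min_spec (τ m, m)
    rwa [hτ'] at this
  by_contra! hT
  obtain ⟨M, -, hM⟩ := hU.exists_bound
  have hM' : ∀ m, ∀ t ∈ Ioo t₀ (rightTime (τ m, m)), |U t| ≤ M := fun m t ht =>
    (hM t ⟨ht.1.le, (ht.2.trans (hT m)).le⟩).1
  have hUc : ContinuousOn U (Icc t₀ b) := hU.continuousOn
  have hpc : Continuous fun m : ℝ => (τ m, m) := by fun_prop
  -- `U` is bounded on all these intervals. Near both blow-up points the singular solutions exceed
  -- that bound uniformly for nearby `m`, so openness of `A` is only a compactness question in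
  -- between.
  let A : Set ℝ := {m | ∀ t ∈ Ioo t₀ (rightTime (τ m, m)), U t < minU (τ m, m) t}
  let B : Set ℝ := {m | ∃ t ∈ Ioo t₀ (rightTime (τ m, m)), minU (τ m, m) t < U t}
  have hA : IsOpen A := by
    rw [isOpen_iff_mem_nhds]
    intro m hm
    obtain ⟨h, hτm, hu, hv⟩ := hspec m
    obtain ⟨α, hα1, hα2⟩ := ((h.left.eventually_gt_atTop (M + 1)).and
      (Ioo_mem_nhdsGT hτm.1)).exists
    obtain ⟨β, hβ1, hβ2⟩ := ((h.right.eventually_gt_atTop (M + 1)).and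
      (Ioo_mem_nhdsLT hτm.2)).exists
    have hsub : Icc α β ⊆ Ioo t₀ (rightTime (τ m, m)) := fun x hx =>
      ⟨hα2.1.trans_le hx.1, hx.2.trans_lt hβ2.2⟩
    have hαβ : α ≤ β := (hα2.2.trans hβ2.1).le
    obtain ⟨x₀, hx₀, hmin⟩ := isCompact_Icc.exists_isMinOn (nonempty_Icc.2 hαβ)
      ((h.sol.continuousOn.mono hsub).sub (hUc.mono fun x hx => ⟨(hsub hx).1.le,
        ((hsub hx).2.trans (hT m)).le⟩))
    have hgap : 0 < minU (τ m, m) x₀ - U x₀ := sub_pos.2 (hm x₀ (hsub hx₀))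
    have := hpc.continuousAt.eventually (exists_nearby_min (τ m, m) (α := α) (β := β)
      (by rw [hτ']; exact hα2.1) hβ2.2 ⟨hα2.2, hβ2.1⟩ (lt_min hgap one_pos))
    filter_upwards [this] with m' hm' t ht
    obtain ⟨k1, -, k2, k3⟩ := hm'
    obtain ⟨h', hτm', hu', hv'⟩ := hspec m'
    have hMt := (le_abs_self _).trans (hM' m' t ht)
    rcases lt_or_ge t α with hlt | hge
    · have := h'.antitoneOn_left hτm' hv' ⟨ht.1, (hlt.trans k1.1).le⟩ ⟨hα2.1, k1.1.le⟩ hlt.le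
      have h2 := abs_lt.1 ((k3 α ⟨le_rfl, hαβ⟩).1.trans_le (min_le_right _ _))
      linarith [h2.1]
    rcases lt_or_ge β t with hlt | hle
    · have := h'.monotoneOn_right hτm' hv' ⟨k1.2.le, k2⟩ ⟨(k1.2.trans hlt).le, ht.2⟩ hlt.le
      have h2 := abs_lt.1 ((k3 β ⟨hαβ, le_rfl⟩).1.trans_le (min_le_right _ _))
      linarith [h2.1]
    · have h1 : minU (τ m, m) x₀ - U x₀ ≤ minU (τ m, m) t - U t := hmin ⟨hge, hle⟩
      have h2 := abs_lt.1 ((k3 t ⟨hge, hle⟩).1.trans_le (min_le_left _ _))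
      linarith [h2.1]
  have hB : IsOpen B := by
    rw [isOpen_iff_mem_nhds]
    rintro m ⟨t, ht, hlt⟩
    obtain ⟨h, hτm, hu, hv⟩ := hspec m
    obtain ⟨α, hα1, hα2⟩ := exists_between (lt_min ht.1 hτm.1)
    obtain ⟨β, hβ1, hβ2⟩ := exists_between (max_lt ht.2 hτm.2)
    rw [lt_min_iff] at hα2
    rw [max_lt_iff] at hβ1
    have := hpc.continuousAt.eventually (exists_nearby_min (τ m, m) (α := α) (β := β)
      (by rw [hτ']; exact hα1) hβ2 ⟨hα2.2, hβ1.2⟩ (sub_pos.2 hlt))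
    filter_upwards [this] with m' hm'
    obtain ⟨k1, -, k2, k3⟩ := hm'
    refine ⟨t, ⟨ht.1, hβ1.1.trans k2⟩, ?_⟩
    have h2 := abs_lt.1 (k3 t ⟨hα2.1.le, hβ1.1.le⟩).1
    linarith [h2.2]
  -- A singular solution above `U` that touches it has the same slope there, so by uniqueness it
  -- coincides with the bounded `U`.
  have hAB : A ∪ B = univ := by
    refine eq_univ_of_forall fun m => ?_
    by_contra hm
    obtain ⟨h, hτm, hu, hv⟩ := hspec m
    have hmA : m ∉ A := fun h => hm (Or.inl h)
    have hmB : m ∉ B := fun h => hm (Or.inr h)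
    simp only [A, B, mem_ofPred_eq, not_forall, not_exists, not_and, not_lt, exists_prop] at hmA hmB
    obtain ⟨t, ht, hle⟩ := hmA
    have he := le_antisymm hle (hmB t ht)
    have hsub : Ioo t₀ (rightTime (τ m, m)) ⊆ Icc t₀ b := fun x hx =>
      ⟨hx.1.le, (hx.2.trans (hT m)).le⟩
    have hd := deriv_eq_of_touch (Ioo_mem_nhds ht.1 ht.2) (h.sol t ht).1 (hU t (hsub ht)).1 hmB he
    obtain ⟨x, hx1, hx2⟩ := ((h.left.eventually_gt_atTop M).and (Ioo_mem_nhdsGT h.lt)).exists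
    have := (Sol.eqOn h.sol (hU.mono hsub) ht he hd hx2).1
    have := (le_abs_self _).trans (hM' m x hx2)
    linarith
  have hMA : M + 1 ∈ A := fun t ht => by
    obtain ⟨h, hτm, hu, hv⟩ := hspec (M + 1)
    have := h.min_le hτm hv ht
    have := (le_abs_self _).trans (hM' _ t ht)
    linarith
  have hMB : -M - 1 ∈ B := by
    obtain ⟨h, hτm, hu, hv⟩ := hspec (-M - 1)
    exact ⟨_, hτm, by linarith [(abs_le.1 (hM' _ _ hτm)).1]⟩
  obtain ⟨m, -, hmA, t, ht, hlt⟩ := isPreconnected_univ A B hA hB hAB.ge ⟨_, trivial, hMA⟩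
    ⟨_, trivial, hMB⟩
  exact lt_asymm hlt (hmA t ht)

/-- Before the time `rightTime (τ m, m)` there are solutions that are regular at `t₀`. -/
theorem exists_sol_Icc {τ : ℝ → ℝ} (hτ : ∀ m, t₀ < τ m)
    (hτ' : ∀ m σ, t₀ ≤ σ → σ < τ m → leftTime (σ, m) < t₀) {b m : ℝ}
    (hb : b < rightTime (τ m, m)) : ∃ U V, Sol abs U V (Icc t₀ b) := by
  have hc : Continuous fun σ : ℝ => rightTime (σ, m) := continuous_rightTime.comp (by fun_prop)
  have h1 : ∀ᶠ σ in 𝓝[<] τ m, b < rightTime (σ, m) :=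
    (hc.continuousAt.eventually (eventually_gt_nhds hb)).filter_mono nhdsWithin_le_nhds
  -- Moving the minimum point slightly left of `τ m` pushes the left blow-up point below `t₀`, while
  -- by continuity the right one stays beyond `b`.
  obtain ⟨σ, h2, h3⟩ := (h1.and (Ioo_mem_nhdsLT (hτ m))).exists
  exact ⟨_, _, (min_spec (σ, m)).1.sol.mono fun x hx =>
    ⟨(hτ' m σ h3.1.le h3.2).trans_le hx.1, hx.2.trans_lt h2⟩⟩

end

/-! ### Back to the Painlevé equation: intervals of existence, `X` and the count. -/

section

variable {g U V y : ℝ → ℝ} {s J : Set ℝ} {x₀ x₁ : ℝ}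

lemma Sol.congr_forcing {g' : ℝ → ℝ} (h : Sol g U V s) (hg : EqOn g g' s) : Sol g' U V s :=
  fun t ht => ⟨(h t ht).1, hg ht ▸ (h t ht).2⟩

lemma isSolutionOn_iff : IsSolutionOn y J ↔ Sol (fun x => -x) y (deriv y) J := by
  refine forall₂_congr fun x _ => ?_
  rw [sub_eq_add_neg]
  exact and_congr_left fun _ => ⟨fun h => h.hasDerivAt, fun h => h.differentiableAt⟩

lemma Sol.isSolutionOn (hJ : IsOpen J) (h : Sol (fun x => -x) U V J) : IsSolutionOn U J := by
  refine isSolutionOn_iff.2 fun x hx => ⟨(h x hx).1.differentiableAt.hasDerivAt, ?_⟩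
  refine (h x hx).2.congr_of_eventuallyEq ?_
  filter_upwards [hJ.mem_nhds hx] with z hz using (h z hz).1.deriv

lemma eqOn_neg_abs (hs : s ⊆ Iic 0) : EqOn (fun x : ℝ => -x) abs s :=
  fun _ hx => (abs_of_nonpos (hs hx)).symm

lemma BlowUp.isSolutionOn (hx₀ : x₀ ≤ 0) (h : BlowUp y V x₁ x₀) : IsSolutionOn y (Ioo x₁ x₀) :=
  Sol.isSolutionOn isOpen_Ioo
    (h.sol.congr_forcing (eqOn_neg_abs fun _ hx => hx.2.le.trans hx₀).symm)

lemma blowUp_deriv_iff (hx₀ : x₀ ≤ 0) (hx : x₁ < x₀) : BlowUp y (deriv y) x₁ x₀ ↔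
    IsSolutionOn y (Ioo x₁ x₀) ∧ Tendsto y (𝓝[>] x₁) atTop ∧ Tendsto y (𝓝[<] x₀) atTop :=
  ⟨fun h => ⟨h.isSolutionOn hx₀, h.left, h.right⟩,
    fun h => ⟨hx, (isSolutionOn_iff.1 h.1).congr_forcing
    (eqOn_neg_abs fun _ hx => hx.2.le.trans hx₀), h.2.1, h.2.2⟩⟩

lemma BlowUp.hasIntervalOfExistence (hx₀ : x₀ ≤ 0) (h : BlowUp y V x₁ x₀) :
    HasIntervalOfExistence y (Ioo x₁ x₀) where
  isOpen := isOpen_Ioo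
  isConnected := isConnected_Ioo h.lt
  isSolutionOn := h.isSolutionOn hx₀
  maximal z K _ hK hsub hz he := by
    refine Subset.antisymm (fun p hp => ?_) hsub
    obtain ⟨c, hc⟩ : ∃ c, c ∈ Ioo x₁ x₀ := exists_between h.lt
    have hK' : K.OrdConnected := hK.isPreconnected.ordConnected
    by_contra hp'
    rcases le_or_gt p x₁ with h1 | h1
    · have hx : x₁ ∈ K := hK'.out hp (hsub hc) ⟨h1, hc.1.le⟩
      refine not_tendsto_atTop_of_continuousAt (l := 𝓝[>] x₁) nhdsWithin_le_nhds
        (hz _ hx).1.continuousAt (h.left.congr' ?_)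
      filter_upwards [Ioo_mem_nhdsGT h.lt] with t ht using (he ht).symm
    · have h2 : x₀ ≤ p := not_lt.1 fun h2 => hp' ⟨h1, h2⟩
      have hx : x₀ ∈ K := hK'.out (hsub hc) hp ⟨hc.2.le, h2⟩
      refine not_tendsto_atTop_of_continuousAt (l := 𝓝[<] x₀) nhdsWithin_le_nhds
        (hz _ hx).1.continuousAt (h.right.congr' ?_)
      filter_upwards [Ioo_mem_nhdsLT h.lt] with t ht using (he ht).symm

/-- On `(x₁, x₀)` the forcing `-x` is nonnegative, so at each end the solution tends to infinity or
extends; extension contradicts maximality. -/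
lemma HasIntervalOfExistence.blowUp (hx₀ : x₀ ≤ 0) (hx : x₁ < x₀)
    (h : HasIntervalOfExistence y (Ioo x₁ x₀)) : BlowUp y (deriv y) x₁ x₀ := by
  have hsol := isSolutionOn_iff.1 h.isSolutionOn
  refine (blowUp_deriv_iff hx₀ hx).2 ⟨h.isSolutionOn, ?_, ?_⟩
  · rcases hsol.reflect_Ioo.tendsto_or_extend (by fun_prop) (by linarith) (fun t ht => by
        linarith [ht.1]) with h1 | ⟨U', V', η, hη, h1, h2, -⟩
    · simpa [Function.comp_def] using h1.comp (tendsto_neg_nhdsGT (a := x₁))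
    · have h3 : Sol (fun x => -x) _ _ (Ioo (-(-x₁ + η)) (- -x₀)) :=
        h1.reflect_Ioo.congr_forcing fun t _ => by simp
      have hsub : Ioo x₁ x₀ ⊆ Ioo (-(-x₁ + η)) (- -x₀) :=
        Ioo_subset_Ioo (by linarith) (by linarith)
      have := h.maximal _ _ isOpen_Ioo (isConnected_Ioo (by linarith)) hsub
        (h3.isSolutionOn isOpen_Ioo) fun t ht => by
          have := h2 (x := -t) ⟨by linarith [ht.2], by linarith [ht.1]⟩
          simpa using this
      exact absurd (this.le (show x₁ ∈ _ from ⟨by linarith, by linarith⟩)).1 (lt_irrefl _)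
  · rcases hsol.tendsto_or_extend (by fun_prop) hx (fun t ht => by linarith [ht.2]) with
      h1 | ⟨U', V', η, hη, h1, h2, -⟩
    · exact h1
    · have := h.maximal _ _ isOpen_Ioo (isConnected_Ioo (by linarith))
        (Ioo_subset_Ioo_right (by linarith)) (h1.isSolutionOn isOpen_Ioo) h2
      exact absurd (this.le (show x₀ ∈ _ from ⟨by linarith, by linarith⟩)).2 (lt_irrefl _)

/-- A solution on `[b, x₀]` lies below the interval of existence of some solution through `x₀`. -/
lemma exists_hasIntervalOfExistence {b : ℝ} (hb : b ≤ x₀) (h : Sol (fun x => -x) U V (Icc b x₀)) :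
    ∃ y J, HasIntervalOfExistence y J ∧ x₀ ∈ J ∧ b ∈ J := by
  have hg : Continuous fun x : ℝ => -x := by fun_prop
  obtain ⟨δ, hδ, H⟩ := h.exists_nearby hg (τ₀ := x₀) ⟨hb, le_rfl⟩ one_pos
  obtain ⟨U', V', η, hη, h', e1, e2, -⟩ := H x₀ ⟨hb, le_rfl⟩ (U x₀) (V x₀) (by simpa) (by simpa)
    (by simpa)
  obtain ⟨y, W, J, hJ, hJ', hx, hs, f1, f2, hmax⟩ := exists_maximal_solution hg x₀ (U x₀) (V x₀)
  refine ⟨y, J, ⟨hJ, ⟨⟨x₀, hx⟩, hJ'.isPreconnected⟩, hs.isSolutionOn hJ, ?_⟩, hx,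
    hmax U' V' _ isOpen_Ioo ordConnected_Ioo ⟨by linarith, by linarith⟩ h' e1 e2
      ⟨by linarith, by linarith⟩⟩
  intro z K hK hK' hsub hz he
  refine Subset.antisymm (hmax z (deriv z) K hK hK'.isPreconnected.ordConnected (hsub hx)
    (isSolutionOn_iff.1 hz) ((he hx).trans f1) ?_) hsub
  have : z =ᶠ[𝓝 x₀] y := by filter_upwards [hJ.mem_nhds hx] with t ht using he ht
  rw [this.deriv_eq, (hs x₀ hx).1.deriv, f2]

/-- Solutions through `x₀` are the solutions regular at `t₀ = -x₀`. `exists_sol_Icc` provides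
lifetimes arbitrarily close to the largest right blow-up time, and `exists_le_rightTime` excludes
longer ones. -/
theorem X_eq (hx₀ : x₀ ≤ 0) {τ : ℝ → ℝ} (hτc : Continuous τ) (hτ : ∀ m, -x₀ < τ m)
    (hτ' : ∀ m, leftTime (τ m, m) = -x₀)
    (hlow : ∀ m σ, -x₀ ≤ σ → σ < τ m → leftTime (σ, m) < -x₀) {m₀ : ℝ}
    (hm₀ : ∀ m, rightTime (τ m, m) ≤ rightTime (τ m₀, m₀)) :
    X x₀ = ((-rightTime (τ m₀, m₀) : ℝ) : EReal) := by
  set T := rightTime (τ m₀, m₀)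
  have hT : -x₀ < T := (hτ m₀).trans (min_spec (τ m₀, m₀)).2.1.2
  apply le_antisymm
  · refine le_of_forall_gt fun c hc => ?_
    obtain ⟨r, hr, hrc⟩ := EReal.lt_iff_exists_real_btwn.1 hc
    rw [EReal.coe_lt_coe_iff] at hr
    refine lt_of_le_of_lt ?_ hrc
    obtain ⟨b, hb, hbT⟩ := exists_between (max_lt hT (show -r < T by linarith))
    rw [max_lt_iff] at hb
    obtain ⟨U, V, h⟩ := exists_sol_Icc hτ hlow hbT
    have h1 : Sol (fun x => -x) (fun t => U (-t)) (fun t => -V (-t)) (Icc (-b) x₀) :=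
      (h.reflect.mono (s' := Icc (-b) x₀) fun x hx =>
      ⟨by linarith [hx.2], by linarith [hx.1]⟩).congr_forcing fun x hx => by
        simp [abs_of_nonpos (hx.2.trans hx₀)]
    obtain ⟨y, J, hy, hx, hbJ⟩ := exists_hasIntervalOfExistence (by linarith) h1
    have hX : X x₀ ≤ leftEnd J := sInf_le ⟨y x₀, deriv y x₀, y, J, hy, hx, rfl, rfl, rfl⟩
    refine hX.trans ?_
    refine (sInf_le (mem_image_of_mem _ hbJ)).trans ?_
    exact EReal.coe_le_coe_iff.2 (by linarith)
  · refine le_sInf ?_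
    rintro _ ⟨-, -, y, J, hy, hx, -, -, rfl⟩
    refine le_sInf ?_
    rintro _ ⟨x, hxJ, rfl⟩
    refine EReal.coe_le_coe_iff.2 ?_
    by_contra! hlt
    have hsub : Icc x x₀ ⊆ J := hy.isConnected.isPreconnected.ordConnected.out hxJ hx
    have h1 : Sol abs (fun t => y (-t)) (fun t => -deriv y (-t)) (Icc (-x₀) (-x)) :=
      (((isSolutionOn_iff.1 hy.isSolutionOn).mono
      hsub).reflect.mono (s' := Icc (-x₀) (-x)) fun t ht =>
        ⟨by linarith [ht.2], by linarith [ht.1]⟩).congr_forcing fun t ht => by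
          simp [abs_of_nonneg (show 0 ≤ t by linarith [ht.1])]
    obtain ⟨m, hm⟩ := exists_le_rightTime hτc hτ' h1
    linarith [hm₀ m]

/-- A solution corresponds to the minimum value of its reflection. Injectivity holds because the
restricted function determines its own minimum. -/
theorem encard_solutionsWithInterval (hx₀ : x₀ ≤ 0) (hx : x₁ < x₀) {τ : ℝ → ℝ}
    (hτ' : ∀ m, leftTime (τ m, m) = -x₀) (huniq : ∀ m σ, leftTime (σ, m) = -x₀ → σ = τ m) :
    (solutionsWithInterval x₁ x₀).encard = {m | rightTime (τ m, m) = -x₁}.encard := by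
  have hspec : ∀ m ∈ {m | rightTime (τ m, m) = -x₁},
      BlowUp (minU (τ m, m)) (minV (τ m, m)) (-x₀) (-x₁) ∧
      τ m ∈ Ioo (-x₀) (-x₁) ∧ minU (τ m, m) (τ m) = m ∧ minV (τ m, m) (τ m) = 0 := by
    intro m (hm : _ = _)
    have := min_spec (τ m, m)
    rwa [hτ', hm] at this
  have himage : solutionsWithInterval x₁ x₀ =
      (fun m => (Ioo x₁ x₀).domRestrict fun x => minU (τ m, m) (-x)) ''
        {m | rightTime (τ m, m) = -x₁} := by
    ext f
    constructor
    · rintro ⟨y, hy, rfl⟩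
      have h := (HasIntervalOfExistence.blowUp hx₀ hx hy).reflect
      obtain ⟨σ, hσ, h0⟩ := h.exists_deriv_eq_zero
      obtain ⟨k, kσ, ku, kv⟩ := min_spec (σ, y (-σ))
      have hl := k.left_unique h kσ hσ ku (kv.trans h0.symm)
      have hr := k.right_unique h kσ hσ ku (kv.trans h0.symm)
      rw [hl, hr] at k
      refine ⟨y (-σ), ?_, ?_⟩
      · rw [mem_ofPred_eq, ← huniq _ _ hl, hr]
      · ext x
        have := (Sol.eqOn k.sol h.sol hσ ku (kv.trans h0.symm) (t := -x)
          ⟨by linarith [x.2.2], by linarith [x.2.1]⟩).1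
        simpa [← huniq _ _ hl] using this
    · rintro ⟨m, hm, rfl⟩
      have h := (hspec m hm).1.reflect
      rw [neg_neg, neg_neg] at h
      exact ⟨_, h.hasIntervalOfExistence hx₀, rfl⟩
  rw [himage, InjOn.encard_image]
  intro m hm m' hm' he
  obtain ⟨h, hτm, hu, hv⟩ := hspec m hm
  obtain ⟨h', hτm', hu', hv'⟩ := hspec m' hm'
  have he' : ∀ t ∈ Ioo (-x₀) (-x₁), minU (τ m, m) t = minU (τ m', m') t := fun t ht => by
    have := congrFun he ⟨-t, by linarith [ht.2], by linarith [ht.1]⟩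
    simpa using this
  have h1 := h.min_le hτm hv hτm'
  have h2 := h'.min_le hτm' hv' hτm
  rw [he' _ hτm', hu, hu'] at h1
  rw [← he' _ hτm, hu, hu'] at h2
  exact le_antisymm h1 h2

end

end PainleveOne

theorem theorem7p1 (x₀ : ℝ) (hx₀ : x₀ ≤ 0) :
    (⊥ < PainleveOne.X x₀ ∧ PainleveOne.X x₀ < (x₀ : EReal)) ∧
    ∀ x₁ : ℝ, x₁ < x₀ →
      ((x₁ : EReal) < PainleveOne.X x₀ →
        PainleveOne.solutionsWithInterval x₁ x₀ = ∅) ∧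
      ((x₁ : EReal) = PainleveOne.X x₀ →
        (PainleveOne.solutionsWithInterval x₁ x₀).encard = 1) ∧
      (PainleveOne.X x₀ < (x₁ : EReal) →
        (PainleveOne.solutionsWithInterval x₁ x₀).encard = 2) ∧
      (∀ y : ℝ → ℝ, PainleveOne.HasIntervalOfExistence y (Ioo x₁ x₀) ↔
        PainleveOne.IsSolutionOn y (Ioo x₁ x₀) ∧
          Tendsto y (𝓝[>] x₁) atTop ∧ Tendsto y (𝓝[<] x₀) atTop) := by
  have ht₀ : 0 ≤ -x₀ := by linarith
  obtain ⟨τ, hτc, hτ, hτ', huniq, hlow⟩ := PainleveOne.exists_minPoint ht₀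
  obtain ⟨m₀, hm₀, hone, htwo⟩ := PainleveOne.encard_rightTime ht₀ hτc hτ'
  rw [PainleveOne.X_eq hx₀ hτc hτ hτ' hlow hm₀]
  have hT := (hτ m₀).trans (PainleveOne.min_spec (τ m₀, m₀)).2.1.2
  refine ⟨⟨EReal.bot_lt_coe _, EReal.coe_lt_coe_iff.2 (by linarith)⟩, fun x₁ hx₁ => ?_⟩
  have hcard := PainleveOne.encard_solutionsWithInterval hx₀ hx₁ hτ' huniq
  simp only [EReal.coe_lt_coe_iff, EReal.coe_eq_coe_iff]
  refine ⟨fun h => ?_, fun h => ?_, fun h => ?_, fun y => ?_⟩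
  · rw [← encard_eq_zero, hcard, encard_eq_zero, eq_empty_iff_forall_notMem]
    intro m (hm : _ = _)
    linarith [hm₀ m]
  · rw [hcard, h, neg_neg, hone]
  · rw [hcard, htwo _ (by linarith) (by linarith)]
  · rw [← PainleveOne.blowUp_deriv_iff hx₀ hx₁]
    exact ⟨fun h => h.blowUp hx₀ hx₁, fun h => h.hasIntervalOfExistence hx₀⟩
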